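/- **Setting.** Let $V$ be a set of sites with a fixed linear order (used only to order the fermionic modes). At each site $x$ there is a finite-dimensional Hilbert space: a spin space $\mathbb C^{d_x}$ tensored with the Fock space of finitely many fermionic modes (spin systems: no modes; lattice fermion systems: $d_x=1$). For finite $\Lambda\subset V$ the Hilbert space is the tensor product of the spin spaces and the Fock space of all modes in $\Lambda$. An observable $A_X$ with finite support $X$ is any operator on the Hilbert space of $X$, regarded canonically as an operator for every $\Lambda\supset X$. Let $\Lambda_n$ be a sequence of finite connected lattices (graphs) with $|\Lambda_n|\to\infty$, eventually containing each site, with graph distances ${\rm dist}_{\Lambda_n}(x,y)$ that are eventually equal to a limit ${\rm dist}(x,y)$. Put ${\rm dist}(X,Y)=\min_{x\in X,y\in Y}{\rm dist}(x,y)$ and ${\rm diam}(X)=\max_{x,y\in X}{\rm dist}(x,y)$. Let $H_\Lambda=\sum_{X\subset\Lambda}h_X$ with $h_X$ Hermitian, supported in $X$, and preserving the parity of the fermion number ($h_X$ may depend on $\Lambda$). With positive constants independent of $\Lambda$, assume for every $\Lambda=\Lambda_n$, with distances in $\Lambda$, one of the following: * (P1) $\sum_{X\ni x,y}\|h_X\|\le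 \lambda_0[1+{\rm dist}(x,y)]^{-\eta}$ and $\sum_{z\in\Lambda}[1+{\rm dist}(x,z)]^{-\eta}[1+{\rm dist}(z,y)]^{-\eta}\le p_0[1+{\rm dist}(x,y)]^{-\eta}$ for all $x,y\in\Lambda$; put $v=2\lambda_0p_0$. * (P2) $\sum_{X\ni x}\|h_X\|\,|X|\,[1+{\rm diam}(X)]^\eta\le s_1$ for all $x\in\Lambda$; put $v=2s_1$. * (E1) $\sum_{y\in\Lambda}[1+{\rm dist}(x,y)]^{-\eta}\le \kappa$ and $\sum_{X\ni x,y}\|h_X\|\le\lambda_0 e^{-(\mu+\varepsilon_0){\rm dist}(x,y)}$ for all $x,y\in\Lambda$; put $v=2\lambda_0\lambda_0'\,2^{\eta+1}\kappa$ with $\lambda_0'=\sup_{k\in\mathbb N}(1+k)^\eta e^{-\varepsilon_0k}$. * (E2) $\sum_{X\ni x}\|h_X\|\,|X|\,e^{\mu\,{\rm diam}(X)}\le s_1$ for all $x\in\Lambda$; put $v=2s_1$. For $\Delta E>0$ let $F(r)=(1+r)^{-\tilde\eta}$, $\tilde\eta=\eta/(1+2v/\Delta E)$, in the power-law cases (P1),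 (P2), and $F(r)=e^{-\tilde\mu r}$, $\tilde\mu=\mu/(1+2v/\Delta E)$, in the exponential cases (E1), (E2). *Uniform gap $\Delta E$:* the spectrum of each $H_{\Lambda_n}$ has a nonempty part at its bottom (the ground state sector) whose width tends to $0$ as $n\to\infty$ and whose distance from the rest of the spectrum is larger than $\Delta E$. Let $P_{0,\Lambda}$ be the spectral projection onto the sector, $q_\Lambda$ its rank, which may be unbounded in $\Lambda$, and $\langle\cdot\rangle_{0,\Lambda}=q_\Lambda^{-1}{\rm Tr}(\,\cdot\,P_{0,\Lambda})$. Let $\omega(\cdot)=\lim_n\langle\Phi_{\Lambda_n},(\cdot)\Phi_{\Lambda_n}\rangle$ on all local observables, with normalized vectors $\Phi_{\Lambda}$ in the ground state sectors. A pair of observables with supports $X,Y$ is *bosonic* if they commute in case $X\cap Y=\emptyset$. **Theorem.** Given the constants in one of (P1), (P2), (E1), (E2) and $\Delta E>0$, there is a constant $C>0$, depending only on them, such that the following holds for every system as above with uniform gap $\Delta E$, every $\omega$ as above, and every bosonic pair $A_X,B_Y$ with nonempty finite supports $X,Y$. Let $K>0$, let $G_1(r)\to0$ as $r\to\infty$,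 and for observables $A,B$ with supports $X',Y'$ in $\Lambda$ put $$\tilde G_\Lambda(A,B)=\max\{K\|A\|\|B\||X'||Y'|\,F({\rm dist}_\Lambda(X',Y')),\;G_1({\rm dist}_\Lambda(X',Y'))\}.$$ Suppose that for every $\epsilon>0$ there is $M_0>0$ such that for every lattice $\Lambda=\Lambda_n\supset X$ with $|\Lambda|\ge M_0$ there are, with $m=q_\Lambda^2$, observables $B^{(1)},\dots,B^{(m)}$ with nonempty supports $Y_1,\dots,Y_m\subset\Lambda$ and automorphisms $R_1,\dots,R_m$ (complex linear or antilinear) of the algebra of all operators on the Hilbert space of $\Lambda$, such that 1. every pair among $A_X,B^{(1)},\dots,B^{(m)}$ is bosonic; 2. $B^{(j)}=R_j(A_X)$, $(B^{(j)})^\dagger=R_j(A_X^\dagger)$ and $R_j(H_\Lambda)=H_\Lambda$ for $j=1,\dots,m$; 3. with $B^{(0)}=A_X^\dagger$ and $Y_0=X$, for all $i\ne j$ in $\{0,\dots,m\}$: $|\langle (B^{(i)})^\dagger B^{(j)}\rangle_{0,\Lambda}|\le G_1({\rm dist}_\Lambda(Y_i,Y_j))$; 4. $q_\Lambda^3\max_{i\ne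 j}\tilde G_\Lambda\big((B^{(i)})^\dagger,B^{(j)}\big)<\epsilon$. Then $$|\omega(A_XB_Y)|\le C\,\|A_X\|\,\|B_Y\|\,|X|\,|Y|\;F({\rm dist}(X,Y)).$$ -/

import Mathlib

open Filter Topology
open scoped Matrix.Norms.L2Operator

namespace LatticeClustering

noncomputable section

/-! ### Lattices -/

/-- A finite lattice: finitely many sites and a set of bonds between them. It is connected, so that
the graph distance is the length of a shortest path between any two sites. -/
structure FiniteLattice (V : Type*) where
  sites : Finset V
  bonds : SimpleGraph V
  mem_sites_of_adj : ∀ x y : V, bonds.Adj x y → x ∈ sites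
  reachable : ∀ x ∈ sites, ∀ y ∈ sites, bonds.Reachable x y

/-- The graph-theoretic distance. -/
def FiniteLattice.dist {V : Type*} (L : FiniteLattice V) (x y : V) : ℕ := L.bonds.dist x y

/-- `min {d x y | x ∈ X, y ∈ Y}`, for nonempty `X` and `Y`. -/
def setDist {V : Type*} (d : V → V → ℕ) (X Y : Finset V) : ℕ :=
  sInf {r | ∃ x ∈ X, ∃ y ∈ Y, r = d x y}

/-- `max {d x y | x, y ∈ X}`. -/
def setDiam {V : Type*} (d : V → V → ℕ) (X : Finset V) : ℕ :=
  (X ×ˢ X).sup fun p => d p.1 p.2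

/-! ### Hilbert spaces and local observables -/

/-- The degrees of freedom: at the site `x` there is a spin space of dimension `spinDim x`
and there are `modes x` fermionic modes. A spin system has `modes = 0`, a lattice fermion
system has `spinDim = 1`. -/
structure Sites (V : Type*) where
  spinDim : V → ℕ
  modes : V → ℕ

/-- The orthonormal basis of the Hilbert space of the finite set `Λ` of sites: a spin index and
a set of occupied modes at each site. The Hilbert space is
`⨂ x ∈ Λ, ℂ ^ spinDim x` tensored with the Fock space of the modes in `Λ`; the
occupation number vector with occupied modes `i₁ < i₂ < ⋯` (ordered by site, then within a site)
is `c†(i₁) c†(i₂) ⋯` applied to the vacuum. -/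
abbrev Config {V : Type*} (M : Sites V) (Λ : Finset V) : Type _ :=
  (x : Λ) → Fin (M.spinDim x) × Finset (Fin (M.modes x))

/-- Operators on the Hilbert space of `Λ`; the norm is the operator norm. -/
abbrev Op {V : Type*} (M : Sites V) (Λ : Finset V) : Type _ :=
  Matrix (Config M Λ) (Config M Λ) ℂ

variable {V : Type*} [LinearOrder V] {M : Sites V}

/-- The number of fermions in a configuration. -/
def Config.number {Λ : Finset V} (f : Config M Λ) : ℕ := ∑ x, (f x).2.card

/-- The number of exchanges of two creation operators that are needed to bring those of the
occupied modes in `X` to the left of all the others. -/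
def Config.crossings {Λ : Finset V} (X : Finset V) (f : Config M Λ) : ℕ :=
  ∑ x : Λ, ∑ y : Λ,
    if x.1 ∈ X ∧ y.1 ∉ X ∧ y.1 < x.1 then (f x).2.card * (f y).2.card else 0

/-- The observable `a` with support `X`, as an operator on the Hilbert space of `Λ ⊇ X`: after
the creation operators of the modes in `X` have been brought to the left it acts as `a ⊗ 1`.
For spin systems there are no signs and this is `a ⊗ 1` itself; for fermions it is the embedding
which maps each `c(x, σ)` and `c†(x, σ)` to the operator of the same name.
(It is set to `0` unless `X ⊆ Λ`.) -/
def embed (X Λ : Finset V) (a : Op M X) : Op M Λ :=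
  Matrix.of fun f g =>
    if h : X ⊆ Λ then
      if ∀ x : Λ, x.1 ∉ X → f x = g x then
        (-1 : ℂ) ^ (f.crossings X + g.crossings X) *
          a (fun x => f ⟨x.1, h x.2⟩) (fun x => g ⟨x.1, h x.2⟩)
      else 0
    else 0

/-- An operator is even if it preserves the parity of the number of fermions. (Every operator of
a spin system is even.) -/
def IsEven {X : Finset V} (a : Op M X) : Prop :=
  ∀ f g, a f g ≠ 0 → Even (f.number + g.number)

/-- Two observables, with supports `X` and `Y`, form a bosonic pair if they commute in case
`X` and `Y` are disjoint. -/
def IsBosonicPair {X Y : Finset V} (a : Op M X) (b : Op M Y) : Prop :=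
  Disjoint X Y → Commute (embed X (X ∪ Y) a) (embed Y (X ∪ Y) b)

/-- The observable `a b`, with support `X ∪ Y`. -/
def prodObs {X Y : Finset V} (a : Op M X) (b : Op M Y) : Op M (X ∪ Y) :=
  embed X (X ∪ Y) a * embed Y (X ∪ Y) b

/-- The Hamiltonian `∑ X ⊆ Λ, h X`. -/
def hamiltonian (Λ : Finset V) (h : (X : Finset V) → Op M X) : Op M Λ :=
  ∑ X ∈ Λ.powerset, embed X Λ (h X)

/-! ### Decay of the interaction -/

/-- The four kinds of assumptions on the interaction, with their constants. -/
inductive DecayLaw where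
  | powerPair (lam p eta : ℝ)
  | powerSum (eta s : ℝ)
  | expPair (lam mu eps eta K : ℝ)
  | expSum (mu s : ℝ)

namespace DecayLaw

/-- All the constants are positive. -/
def Admissible : DecayLaw → Prop
  | powerPair lam p eta => 0 < lam ∧ 0 < p ∧ 0 < eta
  | powerSum eta s => 0 < eta ∧ 0 < s
  | expPair lam mu eps eta K => 0 < lam ∧ 0 < mu ∧ 0 < eps ∧ 0 < eta ∧ 0 < K
  | expSum mu s => 0 < mu ∧ 0 < s

/-- The interaction `h` on the finite lattice `L` satisfies the assumption. -/
def Holds (L : FiniteLattice V) (h : (X : Finset V) → Op M X) : DecayLaw → Prop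
  | powerPair lam p eta =>
      (∀ x ∈ L.sites, ∀ y ∈ L.sites,
        ∑ X ∈ L.sites.powerset with x ∈ X ∧ y ∈ X, ‖h X‖
          ≤ lam / (1 + (L.dist x y : ℝ)) ^ eta) ∧
      (∀ x ∈ L.sites, ∀ y ∈ L.sites,
        ∑ z ∈ L.sites, 1 / (1 + (L.dist x z : ℝ)) ^ eta * (1 / (1 + (L.dist z y : ℝ)) ^ eta)
          ≤ p / (1 + (L.dist x y : ℝ)) ^ eta)
  | powerSum eta s =>
      ∀ x ∈ L.sites, ∑ X ∈ L.sites.powerset with x ∈ X,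
        ‖h X‖ * (X.card : ℝ) * (1 + (setDiam L.dist X : ℝ)) ^ eta ≤ s
  | expPair lam mu eps eta K =>
      (∀ x ∈ L.sites, ∑ y ∈ L.sites, 1 / (1 + (L.dist x y : ℝ)) ^ eta ≤ K) ∧
      (∀ x ∈ L.sites, ∀ y ∈ L.sites,
        ∑ X ∈ L.sites.powerset with x ∈ X ∧ y ∈ X, ‖h X‖
          ≤ lam * Real.exp (-(mu + eps) * (L.dist x y : ℝ)))
  | expSum mu s =>
      ∀ x ∈ L.sites, ∑ X ∈ L.sites.powerset with x ∈ X,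
        ‖h X‖ * (X.card : ℝ) * Real.exp (mu * (setDiam L.dist X : ℝ)) ≤ s

/-- The upper bound `v` on the group velocity of the information propagation. -/
def velocity : DecayLaw → ℝ
  | powerPair lam p _ => 2 * lam * p
  | powerSum _ s => 2 * s
  | expPair lam _ eps eta K =>
      2 * lam * (⨆ k : ℕ, (1 + (k : ℝ)) ^ eta * Real.exp (-eps * (k : ℝ))) *
        ((2 : ℝ) ^ (eta + 1) * K)
  | expSum _ s => 2 * s

/-- The decay of the correlations at the distance `r`: `(1 + r) ^ (-η / (1 + 2 v / ΔE))` or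
`exp (-μ r / (1 + 2 v / ΔE))`, respectively. -/
def profile (D : DecayLaw) (ΔE : ℝ) (r : ℕ) : ℝ :=
  match D with
  | powerPair _ _ eta => (1 + (r : ℝ)) ^ (-(eta / (1 + 2 * D.velocity / ΔE)))
  | powerSum eta _ => (1 + (r : ℝ)) ^ (-(eta / (1 + 2 * D.velocity / ΔE)))
  | expPair _ mu _ _ _ => Real.exp (-(mu / (1 + 2 * D.velocity / ΔE)) * (r : ℝ))
  | expSum mu _ => Real.exp (-(mu / (1 + 2 * D.velocity / ΔE)) * (r : ℝ))

end DecayLaw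

/-! ### Infinite systems -/

/-- A quantum lattice system: a sequence of finite lattices which exhausts the set of all the
sites, with Hermitian, even local interactions (which may depend on the finite lattice, as may the
bonds, for instance through boundary conditions). Distances are eventually those of the infinite
lattice. -/
structure System (V : Type*) [LinearOrder V] extends Sites V where
  lattice : ℕ → FiniteLattice V
  card_tendsto : Tendsto (fun n => (lattice n).sites.card) atTop atTop
  exhausts : ∀ x : V, ∀ᶠ n in atTop, x ∈ (lattice n).sites
  dist : V → V → ℕ
  dist_eq : ∀ x y : V, ∀ᶠ n in atTop, (lattice n).dist x y = dist x y
  interaction : ℕ → (X : Finset V) → Op toSites X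
  isHermitian : ∀ n, ∀ X ⊆ (lattice n).sites, (interaction n X).IsHermitian
  isEven : ∀ n, ∀ X ⊆ (lattice n).sites, IsEven (interaction n X)

namespace System

variable (Q : System V) (S : ℕ → Set ℝ)

/-- Operators on the Hilbert space of the `n`-th finite lattice. -/
abbrev FinOp (n : ℕ) : Type _ := Op Q.toSites (Q.lattice n).sites

/-- The Hamiltonian of the `n`-th finite lattice. -/
def ham (n : ℕ) : Q.FinOp n := hamiltonian (Q.lattice n).sites (Q.interaction n)

/-- The observable `a` with support `X`, on the `n`-th finite lattice. -/
def obs (n : ℕ) (X : Finset V) (a : Op Q.toSites X) : Q.FinOp n :=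
  embed X (Q.lattice n).sites a

/-- `S n` is the set of the energies of the ground state sector of the `n`-th Hamiltonian:
a nonempty set at the bottom of the spectrum, whose width tends to zero, and which
is separated from the rest of the spectrum by more than `ΔE`. -/
structure UniformGap (ΔE : ℝ) : Prop where
  nonempty : ∀ n, (S n).Nonempty
  subset : ∀ n, S n ⊆ spectrum ℝ (Q.ham n)
  quasiDegenerate : Tendsto (fun n => Metric.diam (S n)) atTop (𝓝 0)
  gap : ∀ n, ∀ E ∈ S n, ∀ E' ∈ spectrum ℝ (Q.ham n) \ S n, E + ΔE < E'

/-- The projection onto the ground state sector: the spectral projection of `S n`. -/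
def groundProj (n : ℕ) : Q.FinOp n := cfc ((S n).indicator (1 : ℝ → ℝ)) (Q.ham n)

/-- The degeneracy of the ground state sector, counted with multiplicity. -/
def degeneracy (n : ℕ) : ℕ := (Q.groundProj S n).rank

/-- `q⁻¹ Tr (A P)`. -/
def groundAvg (n : ℕ) (A : Q.FinOp n) : ℂ :=
  (Q.degeneracy S n : ℂ)⁻¹ * (A * Q.groundProj S n).trace

/-- `ω` is an infinite-volume ground state expectation: the limit of the expectations in
normalized vectors of the ground state sectors, on all the local observables. -/
def IsGroundExpectation (ω : (X : Finset V) → Op Q.toSites X → ℂ) : Prop :=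
  ∃ Φ : (n : ℕ) → Config Q.toSites (Q.lattice n).sites → ℂ,
    (∀ n, star (Φ n) ⬝ᵥ Φ n = 1 ∧ (Q.groundProj S n).mulVec (Φ n) = Φ n) ∧
    ∀ (X : Finset V) (a : Op Q.toSites X),
      Tendsto (fun n => star (Φ n) ⬝ᵥ (Q.obs n X a).mulVec (Φ n)) atTop (𝓝 (ω X a))

/-- The bound `G₀` on `|⟨A B⟩ - ⟨A P B⟩|` for `A`, `B` with supports `X`, `Y`, on the `n`-th finite
lattice; `K` is the constant in front. -/
def clusterBound (D : DecayLaw) (ΔE K : ℝ) (n : ℕ) {X Y : Finset V}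
    (a : Op Q.toSites X) (b : Op Q.toSites Y) : ℝ :=
  K * ‖a‖ * ‖b‖ * (X.card : ℝ) * (Y.card : ℝ) *
    D.profile ΔE (setDist (Q.lattice n).dist X Y)

/-- The maximum of the clustering bound `G₀` and the correlation bound `G₁`. -/
def tildeG (D : DecayLaw) (ΔE K : ℝ) (G₁ : ℕ → ℝ) (n : ℕ) {X Y : Finset V}
    (a : Op Q.toSites X) (b : Op Q.toSites Y) : ℝ :=
  max (Q.clusterBound D ΔE K n a b) (G₁ (setDist (Q.lattice n).dist X Y))

/-- On the `n`-th finite lattice there are `m = q²` images `b 1, …, b m` of the observable `a`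
under symmetries `R 1, …, R m` of the Hamiltonian, such that, with `b 0 = a†`,
all the correlations `⟨(b i)† (b j)⟩`, `i ≠ j`, obey the bound `G₁`, and `q³` times
all the bounds `tildeG` is below `ε`. A transformation is an automorphism of the
real algebra of all operators: it is complex linear or antilinear, and covers unitary and
antiunitary symmetries. -/
def HasSymmetryImages (D : DecayLaw) (ΔE K : ℝ) (G₁ : ℕ → ℝ) (ε : ℝ) (n : ℕ)
    {X : Finset V} (a : Op Q.toSites X) : Prop :=
  ∃ (Y : Fin (Q.degeneracy S n ^ 2 + 1) → Finset V) (b : ∀ j, Op Q.toSites (Y j))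
    (R : Fin (Q.degeneracy S n ^ 2) → (Q.FinOp n ≃ₐ[ℝ] Q.FinOp n)),
    (∀ j, (Y j).Nonempty ∧ Y j ⊆ (Q.lattice n).sites) ∧
    (Y 0 = X ∧ Q.obs n (Y 0) (b 0) = (Q.obs n X a).conjTranspose) ∧
    (∀ j, Q.obs n (Y j.succ) (b j.succ) = R j (Q.obs n X a) ∧
      (Q.obs n (Y j.succ) (b j.succ)).conjTranspose = R j (Q.obs n X a).conjTranspose ∧
      R j (Q.ham n) = Q.ham n) ∧
    (∀ j : Fin (Q.degeneracy S n ^ 2), IsBosonicPair a (b j.succ)) ∧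
    (∀ i j : Fin (Q.degeneracy S n ^ 2), i ≠ j → IsBosonicPair (b i.succ) (b j.succ)) ∧
    (∀ i j, i ≠ j →
      ‖Q.groundAvg S n ((Q.obs n (Y i) (b i)).conjTranspose * Q.obs n (Y j) (b j))‖
        ≤ G₁ (setDist (Q.lattice n).dist (Y i) (Y j))) ∧
    (∀ i j, i ≠ j →
      (Q.degeneracy S n : ℝ) ^ 3 * Q.tildeG D ΔE K G₁ n (b i).conjTranspose (b j) < ε)

end System

end

end LatticeClustering

/-! Let `P` project onto the ground state sector of a large finite lattice and let `Φ` be a unit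
vector in it. Since `A` and `B` commute, `2⟨AB⟩` in `Φ` is the sum of the excited part `⟨A(1-P)B⟩ +
⟨B(1-P)A⟩` and the sector part `⟨APB⟩ + ⟨BPA⟩`. The two parts are small for different reasons.

Excited part. In an energy basis it is a sum of amplitudes `c` with frequencies `ω ≥ ΔE`. Weighted
with `sin (ω t)`, the same amplitudes appear in `[A, B(t)] - [A, B(-t)]`, which the Lieb–Robinson
bound (`lieb_robinson`, `lattice_lieb_robinson`) makes smaller than a multiple of `exp (-l) (exp
(v|t|) - 1)`, with `l` the decay rate at the distance of the supports. Integrating against `exp (-α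
t²) / t` turns every sine into nearly `π / 2`, because all frequencies lie above the gap. Balancing
the spectral error, the growth up to a cutoff time and the tail beyond it gives `exp (-l / (1 +
2v/ΔE))`, which is the profile `F` (`norm_sum_le_of_filter`). For the sector average the
contributions from inside the sector cancel exactly (`diag_average_clustering`). For a single vector
they cost an error proportional to the width of the sector (`diag_vector_clustering`), which
vanishes in the limit at a fixed distance.

Sector part. It is at most `2‖PAP‖‖B‖`, so it suffices that `‖PAP‖` tends to zero. The blocks `P
B⁽ʲ⁾ P` of the `q² + 1` images live in a space of dimension `q²` and are linearly dependent. Their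
mutual Hilbert–Schmidt products, divided by `q`, are averages `⟨B⁽ⁱ⁾† P B⁽ʲ⁾⟩`, which differ from
the assumed small correlations only by an excited part, already known to decay. A linear dependence
among nearly orthogonal vectors forces one of them to be short (`exists_small_block`). The
symmetries fix the Hamiltonian, hence `P`, and preserve the norm of a block (`norm_compression_eq`),
so `PAP` itself is small (`sq_norm_block_le`).

Fermions enter only through the signs of the embedding: `commute_embed_iff` reduces commutation at
disjoint supports to a parity condition, so that even interaction terms commute with everything
disjoint from them. -/

namespace LatticeClustering

noncomputable section

/-! ### Embedding of local observables and fermionic signs -/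

section Embedding

variable {V : Type*} [LinearOrder V] {M : Sites V} {X Y W Λ : Finset V}

/-- The restriction of a configuration to a smaller set of sites. -/
def Config.restr (h : X ⊆ Λ) (f : Config M Λ) : Config M X := fun x => f ⟨x.1, h x.2⟩

/-- The configuration that is `k` on `X` and `f` elsewhere. -/
def Config.patch (f : Config M Λ) (k : Config M X) : Config M Λ :=
  fun x => if hx : x.1 ∈ X then k ⟨x.1, hx⟩ else f x

lemma Config.restr_patch (h : X ⊆ Λ) (f : Config M Λ) (k : Config M X) :
    (f.patch k).restr h = k := by
  funext x
  simp [Config.restr, Config.patch]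

lemma Config.patch_apply_of_notMem (f : Config M Λ) (k : Config M X) {x : Λ} (hx : x.1 ∉ X) :
    f.patch k x = f x := by
  simp [Config.patch, hx]

lemma Config.patch_restr (h : X ⊆ Λ) (f g : Config M Λ) (hfg : ∀ x : Λ, x.1 ∉ X → f x = g x) :
    f.patch (g.restr h) = g := by
  funext x
  by_cases hx : x.1 ∈ X
  · simp [Config.restr, Config.patch, hx]
  · rw [Config.patch_apply_of_notMem _ _ hx, hfg x hx]

lemma Config.restr_patch_of_disjoint (hXY : Disjoint X Y) (h : Y ⊆ Λ) (f : Config M Λ)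
    (k : Config M X) : (f.patch k).restr h = f.restr h := by
  funext x
  exact Config.patch_apply_of_notMem f k (Finset.disjoint_right.mp hXY x.2)

lemma embed_apply (h : X ⊆ Λ) (a : Op M X) (f g : Config M Λ) :
    embed X Λ a f g = if ∀ x : Λ, x.1 ∉ X → f x = g x then
      (-1 : ℂ) ^ (f.crossings X + g.crossings X) * a (f.restr h) (g.restr h) else 0 := by
  simp only [embed, Matrix.of_apply, h, dif_pos]
  rfl

/-- Row `f` of an embedded matrix lives on the configurations that agree with `f` off `X`, and
`f.patch` parametrizes these by the configurations of `X`. -/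
lemma sum_embed_mul (h : X ⊆ Λ) (a : Op M X) (f : Config M Λ) (F : Config M Λ → ℂ) :
    ∑ k, embed X Λ a f k * F k = ∑ k, (-1 : ℂ) ^ (f.crossings X + (f.patch k).crossings X) *
      a (f.restr h) k * F (f.patch k) := by
  classical
  simp only [embed_apply h, ite_mul, zero_mul]
  rw [← Finset.sum_filter]
  refine Finset.sum_nbij' (Config.restr h) f.patch (by simp) ?_ ?_ ?_ ?_
  · intro k _
    simp only [Finset.mem_filter, Finset.mem_univ, true_and]
    intro x hx
    rw [Config.patch_apply_of_notMem _ _ hx]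
  · intro k hk
    exact Config.patch_restr h f k (by simpa using hk)
  · intro k _
    exact Config.restr_patch h f k
  · intro k hk
    rw [Config.patch_restr h f k (by simpa using hk)]

lemma neg_one_pow_mul_eq (a b c : ℕ) :
    (-1 : ℂ) ^ (a + b) * (-1 : ℂ) ^ (b + c) = (-1) ^ (a + c) := by
  rw [← pow_add, show a + b + (b + c) = a + c + 2 * b by ring, pow_add, pow_mul]
  simp

lemma neg_one_pow_eq_iff (m n : ℕ) : (-1 : ℂ) ^ m = (-1) ^ n ↔ Even (m + n) := by
  rw [Nat.even_add]
  rcases Nat.even_or_odd m with hm | hm <;> rcases Nat.even_or_odd n with hn | hn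
  · simp [hm, hn, hm.neg_one_pow, hn.neg_one_pow]
  · simp [hm, Nat.not_even_iff_odd.mpr hn, hm.neg_one_pow, hn.neg_one_pow]
    norm_num [Complex.ext_iff]
  · simp [hn, Nat.not_even_iff_odd.mpr hm, hm.neg_one_pow, hn.neg_one_pow]
    norm_num [Complex.ext_iff]
  · simp [Nat.not_even_iff_odd.mpr hn, Nat.not_even_iff_odd.mpr hm, hm.neg_one_pow, hn.neg_one_pow]

lemma Config.agree_patch_iff (f g : Config M Λ) (k : Config M X) :
    (∀ x : Λ, x.1 ∉ X → f.patch k x = g x) ↔ ∀ x : Λ, x.1 ∉ X → f x = g x := by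
  refine forall₂_congr fun x hx => ?_
  rw [Config.patch_apply_of_notMem _ _ hx]

/-- The sign of the intermediate configuration occurs twice and cancels. -/
lemma embed_mul (h : X ⊆ Λ) (a b : Op M X) :
    embed X Λ (a * b) = embed X Λ a * embed X Λ b := by
  ext f g
  rw [Matrix.mul_apply, sum_embed_mul h, embed_apply h]
  simp only [embed_apply h, Config.restr_patch, Config.agree_patch_iff]
  split_ifs with hfg
  · rw [Matrix.mul_apply, Finset.mul_sum]
    refine Finset.sum_congr rfl fun k _ => ?_
    rw [← neg_one_pow_mul_eq _ ((f.patch k).crossings X)]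
    ring
  · simp

lemma embed_add (a b : Op M X) : embed X Λ (a + b) = embed X Λ a + embed X Λ b := by
  ext f g
  simp only [embed, Matrix.of_apply, Matrix.add_apply]
  split_ifs <;> ring

lemma embed_smul (c : ℂ) (a : Op M X) : embed X Λ (c • a) = c • embed X Λ a := by
  ext f g
  simp only [embed, Matrix.of_apply, Matrix.smul_apply, smul_eq_mul]
  split_ifs <;> ring

lemma embed_zero : embed X Λ (0 : Op M X) = 0 := by
  ext f g
  simp [embed]

lemma embed_conjTranspose (a : Op M X) :
    embed X Λ a.conjTranspose = (embed X Λ a).conjTranspose := by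
  ext f g
  by_cases h : X ⊆ Λ
  · rw [Matrix.conjTranspose_apply, embed_apply h, embed_apply h]
    simp only [eq_comm (a := g _)]
    split_ifs
    · simp [Matrix.conjTranspose_apply, add_comm]
    · simp
  · simp [embed, h]

/-- The embedding of the observables on `X` into those on `Λ`, as a star homomorphism. -/
def embedHom (h : X ⊆ Λ) : Op M X →⋆ₙₐ[ℂ] Op M Λ where
  toFun := embed X Λ
  map_smul' c a := embed_smul c a
  map_zero' := embed_zero
  map_add' := embed_add
  map_mul' := embed_mul h
  map_star' := embed_conjTranspose

/-- Star homomorphisms between C⋆-algebras are contractive, so the tensor structure need not be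
examined. -/
lemma norm_embed_le (h : X ⊆ Λ) (a : Op M X) : ‖embed X Λ a‖ ≤ ‖a‖ :=
  NonUnitalStarAlgHom.norm_apply_le (embedHom (M := M) h) a

lemma Config.crossings_eq_add (hXW : X ⊆ W) (hW : W ⊆ Λ) (f : Config M Λ) :
    f.crossings X = (f.restr hW).crossings X +
      ∑ x : Λ, ∑ y : Λ, if x.1 ∈ X ∧ y.1 ∉ W ∧ y.1 < x.1 then (f x).2.card * (f y).2.card else 0 := by
  classical
  have key : ∀ F : Λ → ℕ, ∑ x : W, F ⟨x.1, hW x.2⟩ = ∑ x : Λ, if x.1 ∈ W then F x else 0 := by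
    intro F
    rw [← Finset.sum_filter]
    refine Finset.sum_bij (fun x _ => ⟨x.1, hW x.2⟩) (by simp) ?_ ?_ (by simp)
    · intro x _ y _ hxy
      exact Subtype.ext (congrArg (fun z : Λ => z.1) hxy)
    · intro x hx
      exact ⟨⟨x.1, by simpa using hx⟩, by simp⟩
  have h1 : (f.restr hW).crossings X = ∑ x : Λ, if x.1 ∈ W then (∑ y : Λ, if y.1 ∈ W then
      (if x.1 ∈ X ∧ y.1 ∉ X ∧ y.1 < x.1 then (f x).2.card * (f y).2.card else 0) else 0)
      else 0 := by
    rw [← key]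
    refine Finset.sum_congr rfl fun x _ => ?_
    rw [← key]
    rfl
  rw [h1, Config.crossings, ← Finset.sum_add_distrib]
  refine Finset.sum_congr rfl fun x _ => ?_
  by_cases hx : x.1 ∈ X
  · simp only [hXW hx, if_true, ← Finset.sum_add_distrib]
    refine Finset.sum_congr rfl fun y _ => ?_
    by_cases hy : y.1 ∈ W
    · simp [hy]
    · have : y.1 ∉ X := fun h => hy (hXW h)
      simp [hy, this]
  · simp [hx]

/-- The exchanges of `W` with its complement split into those involving `X` and those involving `W \
X`. The latter are equally many for both configurations, which agree off `X`, so they change the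
exponent by an even number. The former complete the exchanges of `X` inside `W` to those inside `Λ`.
-/
lemma embed_embed (hXW : X ⊆ W) (hW : W ⊆ Λ) (a : Op M X) :
    embed W Λ (embed X W a) = embed X Λ a := by
  ext f g
  rw [embed_apply hW, embed_apply hXW, embed_apply (hXW.trans hW)]
  by_cases hfg : ∀ x : Λ, x.1 ∉ X → f x = g x
  · have h1 : ∀ x : Λ, x.1 ∉ W → f x = g x := fun x hx => hfg x fun h => hx (hXW h)
    have h2 : ∀ x : W, x.1 ∉ X → f.restr hW x = g.restr hW x := fun x hx => hfg ⟨x.1, hW x.2⟩ hx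
    rw [if_pos h1, if_pos h2, if_pos hfg, ← mul_assoc, ← pow_add]
    congr 1
    have e1 : ∀ k : Config M Λ, k.crossings W = (∑ x : Λ, ∑ y : Λ,
        if x.1 ∈ X ∧ y.1 ∉ W ∧ y.1 < x.1 then (k x).2.card * (k y).2.card else 0) +
        ∑ x : Λ, ∑ y : Λ, if (x.1 ∈ W ∧ x.1 ∉ X) ∧ y.1 ∉ W ∧ y.1 < x.1 then
          (k x).2.card * (k y).2.card else 0 := by
      intro k
      rw [Config.crossings, ← Finset.sum_add_distrib]
      refine Finset.sum_congr rfl fun x _ => ?_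
      rw [← Finset.sum_add_distrib]
      refine Finset.sum_congr rfl fun y _ => ?_
      by_cases hx : x.1 ∈ X
      · simp [hx, hXW hx]
      · simp [hx]
    have e2 : (∑ x : Λ, ∑ y : Λ, if (x.1 ∈ W ∧ x.1 ∉ X) ∧ y.1 ∉ W ∧ y.1 < x.1 then
          (f x).2.card * (f y).2.card else 0) = ∑ x : Λ, ∑ y : Λ,
          if (x.1 ∈ W ∧ x.1 ∉ X) ∧ y.1 ∉ W ∧ y.1 < x.1 then
          (g x).2.card * (g y).2.card else 0 := by
      refine Finset.sum_congr rfl fun x _ => Finset.sum_congr rfl fun y _ => ?_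
      split_ifs with h
      · rw [hfg x h.1.2, h1 y h.2.1]
      · rfl
    rw [e1 f, e1 g, e2, Config.crossings_eq_add hXW hW f, Config.crossings_eq_add hXW hW g]
    rw [neg_one_pow_eq_iff]
    rw [Nat.even_iff]
    omega
  · rw [if_neg hfg]
    split_ifs with h1 h2
    · exfalso
      refine hfg fun x hx => ?_
      by_cases hxW : x.1 ∈ W
      · exact h2 ⟨x.1, hxW⟩ hx
      · exact h1 x hxW
    · simp
    · rfl

/-- Each pair of a site in `X` and a site in `Y` is counted exactly once: by the first term or by
the second, according to the order of the two sites. -/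
lemma Config.crossings_add_crossings (hXY : Disjoint X Y) (f : Config M (X ∪ Y)) :
    f.crossings X + f.crossings Y = (f.restr Finset.subset_union_left).number *
      (f.restr Finset.subset_union_right).number := by
  classical
  have key : ∀ Z, ∀ hZ : Z ⊆ X ∪ Y, (f.restr hZ).number =
      ∑ x : (X ∪ Y : Finset V), if x.1 ∈ Z then (f x).2.card else 0 := by
    intro Z hZ
    rw [← Finset.sum_filter]
    refine Finset.sum_bij (fun x _ => ⟨x.1, hZ x.2⟩) (by simp) ?_ ?_ (fun _ _ => rfl)
    · intro x _ y _ hxy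
      exact Subtype.ext (congrArg (fun z : (X ∪ Y : Finset V) => z.1) hxy)
    · intro x hx
      exact ⟨⟨x.1, by simpa using hx⟩, by simp⟩
  rw [key, key, Finset.sum_mul_sum]
  have h2 : f.crossings Y = ∑ x : (X ∪ Y : Finset V), ∑ y : (X ∪ Y : Finset V),
      if y.1 ∈ Y ∧ x.1 ∉ Y ∧ x.1 < y.1 then (f y).2.card * (f x).2.card else 0 := by
    rw [Config.crossings, Finset.sum_comm]
  rw [h2, Config.crossings, ← Finset.sum_add_distrib]
  refine Finset.sum_congr rfl fun x _ => ?_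
  rw [← Finset.sum_add_distrib]
  refine Finset.sum_congr rfl fun y _ => ?_
  have hx := Finset.mem_union.mp x.2
  have hy := Finset.mem_union.mp y.2
  by_cases hxX : x.1 ∈ X
  · have hxY : x.1 ∉ Y := Finset.disjoint_left.mp hXY hxX
    by_cases hyX : y.1 ∈ X
    · have hyY : y.1 ∉ Y := Finset.disjoint_left.mp hXY hyX
      simp [hxX, hyX, hyY]
    · have hyY : y.1 ∈ Y := hy.resolve_left hyX
      have hne : x.1 ≠ y.1 := fun h => hyX (h ▸ hxX)
      rcases lt_or_gt_of_ne hne with h | h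
      · simp [hxX, hxY, hyX, hyY, h, h.not_gt, mul_comm]
      · simp [hxX, hxY, hyX, hyY, h, h.not_gt]
  · have hxY : x.1 ∈ Y := hx.resolve_left hxX
    simp [hxX, hxY]

/-- Only one intermediate configuration contributes: the one equal to `g` on `X` and to `f` on `Y`.
-/
lemma embed_mul_embed_apply (hXY : Disjoint X Y) (a : Op M X) (b : Op M Y)
    (hX : X ⊆ Λ) (hY : Y ⊆ Λ) (hΛ : Λ ⊆ X ∪ Y) (f g : Config M Λ) :
    (embed X Λ a * embed Y Λ b) f g =
      (-1 : ℂ) ^ (f.crossings X + (f.patch (g.restr hX)).crossings X +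
        ((f.patch (g.restr hX)).crossings Y + g.crossings Y)) *
        (a (f.restr hX) (g.restr hX) * b (f.restr hY) (g.restr hY)) := by
  rw [Matrix.mul_apply, sum_embed_mul hX, Finset.sum_eq_single (g.restr hX)]
  · rw [embed_apply hY, if_pos, Config.restr_patch_of_disjoint hXY, pow_add]
    · ring
    · intro x hx
      have hxX : x.1 ∈ X := (Finset.mem_union.mp (hΛ x.2)).resolve_right hx
      simp [Config.patch, Config.restr, hxX]
  · intro k _ hk
    rw [embed_apply hY, if_neg, mul_zero]
    intro h
    apply hk
    funext x
    have := h ⟨x.1, hX x.2⟩ (Finset.disjoint_left.mp hXY x.2)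
    simpa [Config.patch, Config.restr] using this
  · simp

/-- The two orders of the product have the same matrix elements up to a sign, namely `-1` to the
power of the product of the particle number changes on `X` and on `Y`. This makes commutation a
condition on parities alone. -/
lemma commute_embed_iff (hXY : Disjoint X Y) (a : Op M X) (b : Op M Y) :
    Commute (embed X (X ∪ Y) a) (embed Y (X ∪ Y) b) ↔
      ∀ f g : Config M (X ∪ Y),
        a (f.restr Finset.subset_union_left) (g.restr Finset.subset_union_left) ≠ 0 →
        b (f.restr Finset.subset_union_right) (g.restr Finset.subset_union_right) ≠ 0 →
        Even (((f.restr Finset.subset_union_left).number +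
          (g.restr Finset.subset_union_left).number) *
          ((f.restr Finset.subset_union_right).number +
          (g.restr Finset.subset_union_right).number)) := by
  rw [commute_iff_eq, ← Matrix.ext_iff]
  refine forall₂_congr fun f g => ?_
  have hX : X ⊆ X ∪ Y := Finset.subset_union_left
  have hY : Y ⊆ X ∪ Y := Finset.subset_union_right
  rw [embed_mul_embed_apply hXY a b hX hY subset_rfl,
    embed_mul_embed_apply hXY.symm b a hY hX (Finset.union_comm X Y).subset,
    mul_comm (b _ _), mul_eq_mul_right_iff, mul_eq_zero, neg_one_pow_eq_iff]
  have h1 := Config.crossings_add_crossings hXY f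
  have h2 := Config.crossings_add_crossings hXY g
  have h3 := Config.crossings_add_crossings hXY (f.patch (g.restr hX))
  have h4 := Config.crossings_add_crossings hXY (f.patch (g.restr hY))
  rw [Config.restr_patch, Config.restr_patch_of_disjoint hXY] at h3
  rw [Config.restr_patch, Config.restr_patch_of_disjoint hXY.symm] at h4
  have h5 : f.crossings X + (f.patch (g.restr hX)).crossings X +
      ((f.patch (g.restr hX)).crossings Y + g.crossings Y) +
      (f.crossings Y + (f.patch (g.restr hY)).crossings Y +
      ((f.patch (g.restr hY)).crossings X + g.crossings X)) =
      ((f.restr hX).number + (g.restr hX).number) *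
          ((f.restr hY).number + (g.restr hY).number) := by
    linarith
  rw [h5]
  tauto

/-- The parity criterion is symmetric in the row and the column on `X`, so it survives taking the
adjoint of one factor only. -/
lemma commute_embed_conjTranspose (hXY : Disjoint X Y) {a : Op M X} {b : Op M Y}
    (h : Commute (embed X (X ∪ Y) a) (embed Y (X ∪ Y) b)) :
    Commute (embed X (X ∪ Y) a.conjTranspose) (embed Y (X ∪ Y) b) := by
  rw [commute_embed_iff hXY] at h ⊢
  intro f g ha hb
  have hX : X ⊆ X ∪ Y := Finset.subset_union_left
  -- Exchanging the `X`-parts of `f` and `g` turns a matrix element of the adjoint into one of `a`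
  -- and leaves that of `b` as it is.
  have := h (f.patch (g.restr hX)) (g.patch (f.restr hX))
  simp only [Config.restr_patch, Config.restr_patch_of_disjoint hXY] at this
  rw [add_comm (Config.number (f.restr hX))]
  refine this (fun h0 => ha ?_) hb
  simp [Matrix.conjTranspose_apply, h0]

lemma commute_embed (hXY : Disjoint X Y) (hX : X ⊆ Λ) (hY : Y ⊆ Λ) {a : Op M X} {b : Op M Y}
    (h : IsBosonicPair a b) : Commute (embed X Λ a) (embed Y Λ b) := by
  have := (h hXY).map (embedHom (M := M) (Finset.union_subset hX hY))
  change Commute (embed _ _ _) (embed _ _ _) at this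
  rwa [embed_embed, embed_embed] at this
  exacts [Finset.subset_union_right, Finset.union_subset hX hY,
    Finset.subset_union_left, Finset.union_subset hX hY]

lemma IsBosonicPair.conjTranspose_left {a : Op M X} {b : Op M Y} (h : IsBosonicPair a b) :
    IsBosonicPair a.conjTranspose b :=
  fun hXY => commute_embed_conjTranspose hXY (h hXY)

lemma IsEven.isBosonicPair {a : Op M X} (ha : IsEven a) (b : Op M Y) : IsBosonicPair a b := by
  intro hXY
  rw [commute_embed_iff hXY]
  intro f g h _
  exact (ha _ _ h).mul_right _

lemma embed_prodObs (hX : X ⊆ Λ) (hY : Y ⊆ Λ) (a : Op M X) (b : Op M Y) :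
    embed (X ∪ Y) Λ (prodObs a b) = embed X Λ a * embed Y Λ b := by
  have hU := Finset.union_subset hX hY
  rw [prodObs, embed_mul hU, embed_embed Finset.subset_union_left hU,
    embed_embed Finset.subset_union_right hU]

end Embedding

/-! ### Heisenberg evolution and growth of commutators -/

section Dynamics

variable {𝔄 : Type*} [CStarAlgebra 𝔄]

/-- The unitary group `exp (i t H)`. -/
def evo (H : 𝔄) (t : ℝ) : 𝔄 := NormedSpace.exp (t • (Complex.I • H))

/-- The Heisenberg evolution `exp (i t H) A exp (-i t H)`. -/
def heis (H : 𝔄) (t : ℝ) (A : 𝔄) : 𝔄 := evo H t * A * evo H (-t)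

lemma evo_zero (H : 𝔄) : evo H 0 = 1 := by
  simp [evo]

lemma heis_zero (H A : 𝔄) : heis H 0 A = A := by
  simp [heis, evo_zero]

lemma evo_neg_left (H : 𝔄) (t : ℝ) : evo (-H) t = evo H (-t) := by
  simp [evo]

lemma heis_neg_left (H : 𝔄) (t : ℝ) (A : 𝔄) : heis (-H) t A = heis H (-t) A := by
  simp [heis, evo_neg_left]

lemma hasDerivAt_evo (H : 𝔄) (t : ℝ) : HasDerivAt (evo H) (evo H t * (Complex.I • H)) t :=
  hasDerivAt_exp_smul_const (𝕂 := ℝ) (Complex.I • H) t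

lemma hasDerivAt_evo' (H : 𝔄) (t : ℝ) : HasDerivAt (evo H) ((Complex.I • H) * evo H t) t :=
  hasDerivAt_exp_smul_const' (𝕂 := ℝ) (Complex.I • H) t

lemma hasDerivAt_evo_neg (H : 𝔄) (t : ℝ) :
    HasDerivAt (fun t => evo H (-t)) (-(evo H (-t) * (Complex.I • H))) t := by
  have := HasDerivAt.scomp t (hasDerivAt_evo H (-t)) (hasDerivAt_neg t)
  rw [neg_one_smul] at this
  exact this

lemma evo_mem_unitary {H : 𝔄} (hH : IsSelfAdjoint H) (t : ℝ) : evo H t ∈ unitary 𝔄 := by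
  have h := (selfAdjoint.expUnitary (⟨t • H, (IsSelfAdjoint.all t).smul hH⟩ : selfAdjoint 𝔄)).2
  rw [selfAdjoint.expUnitary_coe] at h
  rwa [evo, smul_comm]

lemma commute_evo {H A : 𝔄} (h : Commute A H) (t : ℝ) : Commute A (evo H t) := by
  have : Commute A (t • (Complex.I • H)) := (h.smul_right _).smul_right _
  exact this.exp_right

lemma norm_evo_mul {H : 𝔄} (hH : IsSelfAdjoint H) (t : ℝ) (A : 𝔄) : ‖evo H t * A‖ = ‖A‖ :=
  CStarRing.norm_mem_unitary_mul A (evo_mem_unitary hH t)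

lemma norm_mul_evo {H : 𝔄} (hH : IsSelfAdjoint H) (t : ℝ) (A : 𝔄) : ‖A * evo H t‖ = ‖A‖ :=
  CStarRing.norm_mul_mem_unitary A (evo_mem_unitary hH t)

lemma norm_heis {H : 𝔄} (hH : IsSelfAdjoint H) (t : ℝ) (A : 𝔄) : ‖heis H t A‖ = ‖A‖ := by
  rw [heis, norm_mul_evo hH, norm_evo_mul hH]

lemma norm_lie_le (A B : 𝔄) : ‖⁅A, B⁆‖ ≤ 2 * ‖A‖ * ‖B‖ := by
  rw [Ring.lie_def]
  calc ‖A * B - B * A‖ ≤ ‖A * B‖ + ‖B * A‖ := norm_sub_le _ _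
    _ ≤ ‖A‖ * ‖B‖ + ‖B‖ * ‖A‖ := add_le_add (norm_mul_le _ _) (norm_mul_le _ _)
    _ = 2 * ‖A‖ * ‖B‖ := by ring

/-- A differential inequality for the commutator of `A` with an evolved observable: only the part
`HS` of the Hamiltonian that does not commute with `A` contributes. -/
lemma norm_lie_heis_le {H Hc HS A B : 𝔄} (hc : IsSelfAdjoint Hc)
    (hH : H = Hc + HS) (hA : Commute A Hc) {T : ℝ} {β β' : ℝ → ℝ} (h0 : ‖⁅A, B⁆‖ ≤ β 0)
    (hβ : ∀ t, HasDerivAt β (β' t) t)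
    (hb : ∀ t ∈ Set.Ico 0 T, 2 * ‖A‖ * ‖⁅HS, heis H t B⁆‖ ≤ β' t) :
    ∀ t ∈ Set.Icc 0 T, ‖⁅A, heis H t B⁆‖ ≤ β t := by
  -- Interaction picture with respect to `Hc`: the derivative of `G` involves only `HS`, and since
  -- `A` commutes with `Hc` the undone rotation does not affect the norm of the commutator with `A`.
  set G : ℝ → 𝔄 := fun t => evo Hc (-t) * heis H t B * evo Hc t with hG
  set G' : ℝ → 𝔄 := fun t => evo Hc (-t) * ⁅Complex.I • HS, heis H t B⁆ * evo Hc t with hG'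
  have hd : ∀ t, HasDerivAt G (G' t) t := by
    intro t
    have h1 := ((hasDerivAt_evo_neg Hc t).mul (((hasDerivAt_evo' H t).mul_const B).mul
      (hasDerivAt_evo_neg H t))).mul (hasDerivAt_evo' Hc t)
    have e : Complex.I • H = Complex.I • Hc + Complex.I • HS := by rw [hH, smul_add]
    refine HasDerivAt.congr_deriv (f := G) h1 ?_
    simp only [hG', heis, Ring.lie_def, e, Pi.mul_apply]
    generalize Complex.I • HS = S
    generalize Complex.I • Hc = Q
    noncomm_ring
  have key : ∀ t, ‖⁅A, heis H t B⁆‖ = ‖⁅A, G t⁆‖ := by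
    intro t
    have : ⁅A, G t⁆ = evo Hc (-t) * ⁅A, heis H t B⁆ * evo Hc t := by
      simp only [hG, Ring.lie_def, mul_sub, sub_mul]
      have h1 := (commute_evo hA (-t)).eq
      have h2 := (commute_evo hA t).eq
      congr 1
      · rw [← mul_assoc, ← mul_assoc, h1]
        noncomm_ring
      · rw [mul_assoc, ← h2]
        noncomm_ring
    rw [this, norm_mul_evo hc, norm_evo_mul hc]
  intro t ht
  rw [key]
  have hFd : ∀ t, HasDerivAt (fun t => ⁅A, G t⁆) ⁅A, G' t⁆ t := by
    intro t
    simp only [Ring.lie_def]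
    exact ((hd t).const_mul A).sub ((hd t).mul_const A)
  refine image_norm_le_of_norm_deriv_right_le_deriv_boundary (a := 0) (b := T)
    (f := fun t => ⁅A, G t⁆) (f' := fun t => ⁅A, G' t⁆) ?_ ?_ ?_ hβ ?_ ht
  · exact fun s _ => (hFd s).continuousAt.continuousWithinAt
  · exact fun s _ => (hFd s).hasDerivWithinAt
  · simpa [hG, heis_zero, evo_zero] using h0
  · intro s hs
    refine (norm_lie_le _ _).trans (le_trans (le_of_eq ?_) (hb s hs))
    simp only [hG']
    rw [norm_mul_evo hc, norm_evo_mul hc, Ring.lie_def, Ring.lie_def, smul_mul_assoc,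
      mul_smul_comm, ← smul_sub, norm_smul]
    simp

end Dynamics

/-! ### The Lieb–Robinson bound -/

section LiebRobinson

variable {𝔄 : Type*} [CStarAlgebra 𝔄] {V : Type*} [DecidableEq V]

/-- Union bound over the points at which `Z'` can meet `Z`. -/
lemma sum_not_disjoint_le {Λ Z : Finset V} (hZ : Z ⊆ Λ) {c : Finset V → ℝ}
    (hc : ∀ Z' ⊆ Λ, 0 ≤ c Z') {w : V → ℝ} {v : ℝ}
    (hw : ∀ x ∈ Λ, ∑ Z' ∈ Λ.powerset with x ∈ Z', c Z' ≤ v * w x) :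
    ∑ Z' ∈ Λ.powerset with ¬ Disjoint Z' Z, c Z' ≤ v * ∑ x ∈ Z, w x := by
  calc ∑ Z' ∈ Λ.powerset with ¬ Disjoint Z' Z, c Z'
      ≤ ∑ Z' ∈ Λ.powerset, ∑ x ∈ Z, if x ∈ Z' then c Z' else 0 := by
        rw [Finset.sum_filter]
        refine Finset.sum_le_sum fun Z' hZ' => ?_
        have hc' := hc Z' (Finset.mem_powerset.mp hZ')
        have hnn : ∀ x ∈ Z, 0 ≤ if x ∈ Z' then c Z' else 0 := fun x _ => by split_ifs <;> simp [hc']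
        split_ifs with h
        · exact Finset.sum_nonneg hnn
        · obtain ⟨x, hx1, hx2⟩ := Finset.not_disjoint_iff.mp h
          have := Finset.single_le_sum hnn hx2
          rwa [if_pos hx1] at this
    _ = ∑ x ∈ Z, ∑ Z' ∈ Λ.powerset with x ∈ Z', c Z' := by
        rw [Finset.sum_comm]
        simp only [Finset.sum_filter]
    _ ≤ ∑ x ∈ Z, v * w x := Finset.sum_le_sum fun x hx => hw x (hZ hx)
    _ = v * ∑ x ∈ Z, w x := by rw [Finset.mul_sum]

/-- The Lieb–Robinson bound, for an interaction whose decay is encoded in a weight `w`. -/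
theorem lieb_robinson {Λ X Y : Finset V} (hX : X ⊆ Λ) {h : Finset V → 𝔄}
    (hsa : ∀ Z ⊆ Λ, IsSelfAdjoint (h Z))
    (hcomm : ∀ Z ⊆ Λ, ∀ Z' ⊆ Λ, Disjoint Z Z' → Commute (h Z) (h Z'))
    {A B : 𝔄} (hAB : Commute A B) (hA : ∀ Z ⊆ Λ, Disjoint Z X → Commute (h Z) A)
    (hB : ∀ Z ⊆ Λ, Disjoint Z Y → Commute (h Z) B)
    {w : V → ℝ} {v : ℝ} (hv : 0 ≤ v) (hw0 : ∀ x ∈ Λ, 0 ≤ w x) (hw1 : ∀ x ∈ Y, 1 ≤ w x)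
    (hw : ∀ x ∈ Λ, ∑ Z ∈ Λ.powerset with x ∈ Z, 2 * ‖h Z‖ * ∑ z ∈ Z, w z ≤ v * w x)
    {t : ℝ} (ht : 0 ≤ t) :
    ‖⁅A, heis (∑ Z ∈ Λ.powerset, h Z) t B⁆‖ ≤
      2 * ‖A‖ * ‖B‖ * (∑ x ∈ X, w x) * (Real.exp (v * t) - 1) := by
  set H := ∑ Z ∈ Λ.powerset, h Z with hH
  set W : Finset V → ℝ := fun Z => ∑ x ∈ Z, w x with hW
  have hW0 : ∀ Z ⊆ Λ, 0 ≤ W Z := fun Z hZ => Finset.sum_nonneg fun x hx => hw0 x (hZ hx)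
  set R := ∑ Z ∈ Λ.powerset, 2 * ‖h Z‖ with hR
  have hR0 : 0 ≤ R := Finset.sum_nonneg fun Z _ => by positivity
  -- The terms disjoint from `Z` commute with whatever is supported in `Z`, so only the second sum
  -- drives the growth of its commutators.
  have hsplit : ∀ Z : Finset V, H = (∑ Z' ∈ Λ.powerset with Disjoint Z' Z, h Z') +
      ∑ Z' ∈ Λ.powerset with ¬ Disjoint Z' Z, h Z' := fun Z =>
    (Finset.sum_filter_add_sum_filter_not _ _ _).symm
  have hsac : ∀ Z : Finset V, IsSelfAdjoint (∑ Z' ∈ Λ.powerset with Disjoint Z' Z, h Z') :=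
    fun Z => isSelfAdjoint_sum _ fun Z' hZ' => hsa Z' (by simp at hZ'; exact hZ'.1)
  have hHsa : IsSelfAdjoint H := isSelfAdjoint_sum _ fun Z' hZ' => hsa Z' (by simpa using hZ')
  have hsum : ∀ Z ⊆ Λ, ∀ s (b : Finset V → ℝ),
      (∀ Z' ⊆ Λ, ‖⁅h Z', heis H s B⁆‖ ≤ ‖B‖ * (2 * ‖h Z'‖ * b Z')) →
      ‖⁅∑ Z' ∈ Λ.powerset with ¬ Disjoint Z' Z, h Z', heis H s B⁆‖ ≤
        ‖B‖ * ∑ Z' ∈ Λ.powerset with ¬ Disjoint Z' Z, 2 * ‖h Z'‖ * b Z' := by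
    intro Z hZ s b hb
    rw [Ring.lie_def, Finset.sum_mul, Finset.mul_sum, ← Finset.sum_sub_distrib, Finset.mul_sum]
    refine norm_sum_le_of_le _ fun Z' hZ' => hb Z' ?_
    simp at hZ'
    exact hZ'.1
  have hWsum : ∀ Z ⊆ Λ, ∑ Z' ∈ Λ.powerset with ¬ Disjoint Z' Z, 2 * ‖h Z'‖ * W Z' ≤ v * W Z :=
    fun Z hZ => sum_not_disjoint_le hZ
      (fun Z' hZ' => mul_nonneg (by positivity) (hW0 Z' hZ')) hw
  have hRsum : ∀ Z : Finset V, ∑ Z' ∈ Λ.powerset with ¬ Disjoint Z' Z, 2 * ‖h Z'‖ ≤ R :=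
    fun Z => Finset.sum_le_sum_of_subset_of_nonneg (Finset.filter_subset _ _)
      fun Z' _ _ => by positivity
  have hone : ∀ Z ⊆ Λ, (if Disjoint Z Y then (0 : ℝ) else 1) ≤ W Z := by
    intro Z hZ
    split_ifs with hd
    · exact hW0 Z hZ
    · obtain ⟨x, hx1, hx2⟩ := Finset.not_disjoint_iff.mp hd
      exact (hw1 x hx2).trans (Finset.single_le_sum (fun y hy => hw0 y (hZ hy)) hx1)
  have hderiv : ∀ s : ℝ, HasDerivAt (fun s => Real.exp (v * s) - 1) (v * Real.exp (v * s)) s := by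
    intro s
    have := (((hasDerivAt_id s).const_mul v).exp).sub_const 1
    simpa [mul_comm] using this
  -- Picard iteration of the differential inequality. The hypothesis `hw` makes `W Z * exp (v s)`
  -- reproduce itself, while the trivial initial bound becomes the remainder `(R s)ⁿ / n!`.
  have step : ∀ n : ℕ, ∀ Z ⊆ Λ, ∀ s, 0 ≤ s → ‖⁅h Z, heis H s B⁆‖ ≤
      ‖B‖ * (2 * ‖h Z‖ * ((if Disjoint Z Y then 0 else 1) + W Z * (Real.exp (v * s) - 1) +
        R ^ n * (s ^ n / n.factorial))) := by
    intro n
    induction n with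
    | zero =>
      intro Z hZ s hs
      refine (norm_lie_le _ _).trans ?_
      rw [norm_heis hHsa]
      have h1 : 0 ≤ W Z * (Real.exp (v * s) - 1) :=
        mul_nonneg (hW0 Z hZ) (sub_nonneg.mpr (Real.one_le_exp (mul_nonneg hv hs)))
      have h2 : (0 : ℝ) ≤ if Disjoint Z Y then 0 else 1 := by split_ifs <;> norm_num
      calc 2 * ‖h Z‖ * ‖B‖ = ‖B‖ * (2 * ‖h Z‖ * 1) := by ring
        _ ≤ _ := by
          gcongr
          simp
          linarith
    | succ n ih =>
      intro Z hZ s hs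
      refine norm_lie_heis_le (T := s) (β := fun s => ‖B‖ * (2 * ‖h Z‖ *
        ((if Disjoint Z Y then 0 else 1) + W Z * (Real.exp (v * s) - 1) +
        R ^ (n + 1) * (s ^ (n + 1) / (n + 1).factorial))))
        (β' := fun s => ‖B‖ * (2 * ‖h Z‖ *
        (W Z * (v * Real.exp (v * s)) + R ^ (n + 1) * (s ^ n / n.factorial))))
        (hsac Z) (hsplit Z) ?_ ?_ (fun s => ?_) ?_ s ⟨hs, le_rfl⟩
      · refine Commute.sum_right _ _ _ fun Z' hZ' => ?_
        simp at hZ'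
        exact (hcomm Z' hZ'.1 Z hZ hZ'.2).symm
      · split_ifs with hd
        · have := (hB Z hZ hd).eq
          simp [Ring.lie_def, this]
        · refine (norm_lie_le _ _).trans (le_of_eq ?_)
          simp
          ring
      · refine HasDerivAt.const_mul _ (HasDerivAt.const_mul _ (HasDerivAt.add
          (((hderiv s).const_mul _).const_add _) (HasDerivAt.const_mul _ ?_)))
        have := (hasDerivAt_pow (n + 1) s).div_const ((n + 1).factorial : ℝ)
        convert this using 1
        rw [Nat.factorial_succ]
        push_cast
        field_simp
      · intro r hr
        have h1 := hsum Z hZ r (fun Z' => W Z' * Real.exp (v * r) +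
          R ^ n * (r ^ n / n.factorial)) fun Z' hZ' => by
            refine (ih Z' hZ' r hr.1).trans ?_
            gcongr
            have := hone Z' hZ'
            linarith
        have h2 : ∑ Z' ∈ Λ.powerset with ¬ Disjoint Z' Z, 2 * ‖h Z'‖ *
            (W Z' * Real.exp (v * r) + R ^ n * (r ^ n / n.factorial)) ≤
            v * W Z * Real.exp (v * r) + R * (R ^ n * (r ^ n / n.factorial)) := by
          simp only [mul_add, ← mul_assoc (2 * ‖h _‖) (W _), Finset.sum_add_distrib, ← Finset.sum_mul]
          have := hr.1
          gcongr
          · exact hWsum Z hZ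
          · exact hRsum Z
        calc 2 * ‖h Z‖ * ‖⁅∑ Z' ∈ Λ.powerset with ¬ Disjoint Z' Z, h Z', heis H r B⁆‖
            ≤ 2 * ‖h Z‖ * (‖B‖ * (v * W Z * Real.exp (v * r) +
              R * (R ^ n * (r ^ n / n.factorial)))) := by
              gcongr
              exact h1.trans (by gcongr)
          _ = _ := by ring
  have hfin : ∀ Z ⊆ Λ, ∀ s, 0 ≤ s → ‖⁅h Z, heis H s B⁆‖ ≤
      ‖B‖ * (2 * ‖h Z‖ * (W Z * Real.exp (v * s))) := by
    intro Z hZ s hs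
    have hlim : Tendsto (fun n : ℕ => ‖B‖ * (2 * ‖h Z‖ * ((if Disjoint Z Y then 0 else 1) +
        W Z * (Real.exp (v * s) - 1) + R ^ n * (s ^ n / n.factorial)))) atTop
        (𝓝 (‖B‖ * (2 * ‖h Z‖ * ((if Disjoint Z Y then 0 else 1) +
        W Z * (Real.exp (v * s) - 1) + 0)))) := by
      refine ((tendsto_const_nhds.add ?_).const_mul _).const_mul _
      have := FloorSemiring.tendsto_pow_div_factorial_atTop (R * s)
      simpa [mul_pow, mul_div_assoc] using this
    refine (ge_of_tendsto' hlim fun n => step n Z hZ s hs).trans ?_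
    gcongr
    have := hone Z hZ
    linarith
  -- One more application, now to `A`, whose commutator with `B` vanishes at time zero; hence the
  -- factor `exp (v t) - 1`.
  refine norm_lie_heis_le (T := t) (β := fun s => 2 * ‖A‖ * ‖B‖ * W X * (Real.exp (v * s) - 1))
    (hsac X) (hsplit X) ?_ ?_ (fun s => (hderiv s).const_mul _) ?_ t ⟨ht, le_rfl⟩
  · refine Commute.sum_right _ _ _ fun Z' hZ' => ?_
    simp at hZ'
    exact (hA Z' hZ'.1 hZ'.2).symm
  · simp [Ring.lie_def, hAB.eq]
  · intro s hs
    have h1 := hsum X hX s (fun Z' => W Z' * Real.exp (v * s)) fun Z' hZ' => hfin Z' hZ' s hs.1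
    have h2 : ∑ Z' ∈ Λ.powerset with ¬ Disjoint Z' X, 2 * ‖h Z'‖ * (W Z' * Real.exp (v * s)) ≤
        v * W X * Real.exp (v * s) := by
      simp only [← mul_assoc, ← Finset.sum_mul]
      gcongr
      exact hWsum X hX
    calc 2 * ‖A‖ * ‖⁅∑ Z' ∈ Λ.powerset with ¬ Disjoint Z' X, h Z', heis H s B⁆‖
        ≤ 2 * ‖A‖ * (‖B‖ * (v * W X * Real.exp (v * s))) := by
          gcongr
          exact h1.trans (by gcongr)
      _ = 2 * ‖A‖ * ‖B‖ * W X * (v * Real.exp (v * s)) := by ring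

end LiebRobinson

/-! ### Decay laws and their two-point kernels -/

section Decay

/-- The commutator bound of the Lieb–Robinson estimate decays as `exp (-rate r)`. -/
def DecayLaw.rate (D : DecayLaw) (r : ℕ) : ℝ :=
  match D with
  | .powerPair _ _ eta => eta * Real.log (1 + r)
  | .powerSum eta _ => eta * Real.log (1 + r)
  | .expPair _ mu _ _ _ => mu * r
  | .expSum mu _ => mu * r

lemma log_one_add_mono {r s : ℕ} (h : r ≤ s) : Real.log (1 + r) ≤ Real.log (1 + s) :=
  Real.log_le_log (by positivity) (by exact_mod_cast Nat.add_le_add_left h 1)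

lemma DecayLaw.rate_mono {D : DecayLaw} (hD : D.Admissible) : Monotone D.rate := by
  intro r s h
  have h' : (r : ℝ) ≤ s := by exact_mod_cast h
  have hl := log_one_add_mono h
  cases D with
  | powerPair lam p eta => exact mul_le_mul_of_nonneg_left hl hD.2.2.le
  | powerSum eta s => exact mul_le_mul_of_nonneg_left hl hD.1.le
  | expPair lam mu eps eta K => exact mul_le_mul_of_nonneg_left h' hD.2.1.le
  | expSum mu s => exact mul_le_mul_of_nonneg_left h' hD.1.le

lemma DecayLaw.rate_zero (D : DecayLaw) : D.rate 0 = 0 := by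
  cases D <;> simp [DecayLaw.rate]

lemma DecayLaw.rate_nonneg {D : DecayLaw} (hD : D.Admissible) (r : ℕ) : 0 ≤ D.rate r := by
  rw [← D.rate_zero]
  exact DecayLaw.rate_mono hD (Nat.zero_le r)

/-- A power of `1 + r` is an exponential of its logarithm; from here on the four laws are treated
alike. -/
lemma DecayLaw.profile_eq (D : DecayLaw) (ΔE : ℝ) (r : ℕ) :
    D.profile ΔE r = Real.exp (-(D.rate r / (1 + 2 * D.velocity / ΔE))) := by
  have h : (0 : ℝ) < 1 + (r : ℝ) := by positivity
  cases D <;> simp only [DecayLaw.profile, DecayLaw.rate] <;>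
    first
    | (rw [Real.rpow_def_of_pos h]; congr 1; ring)
    | (congr 1; ring)

lemma one_div_one_add_rpow (eta : ℝ) (r : ℕ) :
    1 / (1 + (r : ℝ)) ^ eta = Real.exp (-(eta * Real.log (1 + r))) := by
  have h : (0 : ℝ) < 1 + (r : ℝ) := by positivity
  rw [Real.rpow_def_of_pos h, one_div, ← Real.exp_neg, mul_comm]

/-- A real supremum over an unbounded family has the default value `0`; boundedness makes the
supremum in `velocity` a genuine one. -/
lemma bddAbove_rpow_mul_exp {eps : ℝ} (heps : 0 < eps) (eta : ℝ) :
    BddAbove (Set.range fun k : ℕ => (1 + (k : ℝ)) ^ eta * Real.exp (-eps * (k : ℝ))) := by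
  have h1 : Tendsto (fun k : ℕ => 1 + (k : ℝ)) atTop atTop :=
    tendsto_atTop_add_const_left _ _ tendsto_natCast_atTop_atTop
  have h2 := ((tendsto_rpow_mul_exp_neg_mul_atTop_nhds_zero eta eps heps).comp h1).mul_const
    (Real.exp eps)
  refine Tendsto.bddAbove_range (a := 0 * Real.exp eps) (h2.congr fun k => ?_)
  simp only [Function.comp, mul_assoc, ← Real.exp_add]
  congr 2
  ring

lemma DecayLaw.velocity_pos {D : DecayLaw} (hD : D.Admissible) : 0 < D.velocity := by
  cases D with
  | powerPair lam p eta =>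
    obtain ⟨h1, h2, h3⟩ := hD
    simp only [DecayLaw.velocity]
    positivity
  | powerSum eta s =>
    obtain ⟨h1, h2⟩ := hD
    simp only [DecayLaw.velocity]
    positivity
  | expPair lam mu eps eta K =>
    obtain ⟨h1, h2, h3, h4, h5⟩ := hD
    have h6 : (0 : ℝ) < ⨆ k : ℕ, (1 + (k : ℝ)) ^ eta * Real.exp (-eps * (k : ℝ)) :=
      lt_of_lt_of_le (by simp) (le_ciSup (bddAbove_rpow_mul_exp h3 eta) 0)
    simp only [DecayLaw.velocity]
    positivity
  | expSum mu s =>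
    obtain ⟨h1, h2⟩ := hD
    simp only [DecayLaw.velocity]
    positivity

/-- Connectedness is essential: the graph distance of unconnected vertices has the default value
`0`. -/
lemma FiniteLattice.dist_triangle {V : Type*} (L : FiniteLattice V) {x y z : V}
    (hx : x ∈ L.sites) (hy : y ∈ L.sites) (hz : z ∈ L.sites) :
    L.dist x z ≤ L.dist x y + L.dist y z := by
  obtain ⟨p, hp⟩ := (L.reachable x hx y hy).exists_walk_length_eq_dist
  obtain ⟨q, hq⟩ := (L.reachable y hy z hz).exists_walk_length_eq_dist
  have := SimpleGraph.dist_le (p.append q)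
  rw [SimpleGraph.Walk.length_append, hp, hq] at this
  exact this

lemma FiniteLattice.dist_comm {V : Type*} (L : FiniteLattice V) (x y : V) :
    L.dist x y = L.dist y x :=
  SimpleGraph.dist_comm

lemma FiniteLattice.dist_self {V : Type*} (L : FiniteLattice V) (x : V) : L.dist x x = 0 :=
  SimpleGraph.dist_self

lemma dist_le_setDiam {V : Type*} (d : V → V → ℕ) {X : Finset V} {x y : V} (hx : x ∈ X)
    (hy : y ∈ X) : d x y ≤ setDiam d X :=
  Finset.le_sup (f := fun p : V × V => d p.1 p.2) (Finset.mem_product.mpr ⟨hx, hy⟩ : (x, y) ∈ X ×ˢ X)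

lemma setDist_le {V : Type*} (d : V → V → ℕ) {X Y : Finset V} {x y : V} (hx : x ∈ X)
    (hy : y ∈ Y) : setDist d X Y ≤ d x y :=
  Nat.sInf_le ⟨x, hx, y, hy, rfl⟩

/-- One of the distances from `z` to `x` and `y` is at least half the distance from `x` to `y`. That
factor is replaced at the cost of `2 ^ eta`, and the other is summed over `z`; the two cases give
the second `2`. -/
lemma rpow_convolution_le {eta K : ℝ} (heta : 0 ≤ eta) {V : Type*} (L : FiniteLattice V)
    (hK : ∀ x ∈ L.sites, ∑ y ∈ L.sites, 1 / (1 + (L.dist x y : ℝ)) ^ eta ≤ K) {x y : V}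
    (hx : x ∈ L.sites) (hy : y ∈ L.sites) :
    ∑ z ∈ L.sites, 1 / (1 + (L.dist x z : ℝ)) ^ eta * (1 / (1 + (L.dist z y : ℝ)) ^ eta) ≤
      (2 : ℝ) ^ (eta + 1) * K * (1 / (1 + (L.dist x y : ℝ)) ^ eta) := by
  have key : ∀ a b d : ℝ, 1 ≤ a → 1 ≤ b → 1 ≤ d → d ≤ 2 * a →
      1 / a ^ eta * (1 / b ^ eta) ≤ 2 ^ eta * (1 / d ^ eta) * (1 / b ^ eta) := by
    intro a b d ha hb hd h
    have hb' : 0 < b ^ eta := Real.rpow_pos_of_pos (by linarith) _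
    have ha' : 0 < a ^ eta := Real.rpow_pos_of_pos (by linarith) _
    have hd' : 0 < d ^ eta := Real.rpow_pos_of_pos (by linarith) _
    refine mul_le_mul_of_nonneg_right ?_ (by positivity)
    rw [mul_one_div, div_le_div_iff₀ ha' hd', one_mul, ← Real.mul_rpow (by norm_num) (by linarith)]
    exact Real.rpow_le_rpow (by linarith) h heta
  have h1 : ∀ z ∈ L.sites,
      1 / (1 + (L.dist x z : ℝ)) ^ eta * (1 / (1 + (L.dist z y : ℝ)) ^ eta) ≤
      2 ^ eta * (1 / (1 + (L.dist x y : ℝ)) ^ eta) * (1 / (1 + (L.dist x z : ℝ)) ^ eta +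
        1 / (1 + (L.dist y z : ℝ)) ^ eta) := by
    intro z hz
    have ht : (L.dist x y : ℝ) ≤ L.dist x z + L.dist z y := by
      exact_mod_cast L.dist_triangle hx hz hy
    rw [L.dist_comm y z]
    have p1 : (0 : ℝ) ≤ L.dist x z := by positivity
    have p2 : (0 : ℝ) ≤ L.dist z y := by positivity
    have p3 : (0 : ℝ) ≤ L.dist x y := by positivity
    rw [mul_add]
    rcases le_total (L.dist x z : ℝ) (L.dist z y) with h | h
    · have := key (1 + L.dist z y) (1 + L.dist x z) (1 + L.dist x y) (by linarith) (by linarith)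
        (by linarith) (by linarith)
      rw [mul_comm]
      refine this.trans (le_add_of_nonneg_right (by positivity))
    · have := key (1 + L.dist x z) (1 + L.dist z y) (1 + L.dist x y) (by linarith) (by linarith)
        (by linarith) (by linarith)
      refine this.trans (le_add_of_nonneg_left (by positivity))
  refine (Finset.sum_le_sum h1).trans ?_
  rw [← Finset.mul_sum, Finset.sum_add_distrib]
  calc _ ≤ 2 ^ eta * (1 / (1 + (L.dist x y : ℝ)) ^ eta) * (K + K) := by
        gcongr
        · exact hK x hx
        · exact hK y hy
    _ = _ := by
        rw [Real.rpow_add (by norm_num)]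
        norm_num
        ring

variable {V : Type*} [LinearOrder V] {M : Sites V}

/-- A two-point function that encodes the decay of an interaction with the law `D`. -/
def IsDecayKernel (L : FiniteLattice V) (D : DecayLaw) (ν : Finset V → ℝ) (F : V → V → ℝ) : Prop :=
  (∀ x y, 0 ≤ F x y) ∧ (∀ x, 1 ≤ F x x) ∧
  (∀ x y, F x y ≤ Real.exp (-D.rate (L.dist x y))) ∧
  ∀ x ∈ L.sites, ∀ y ∈ L.sites,
    ∑ Z ∈ L.sites.powerset with x ∈ Z, 2 * ν Z * ∑ z ∈ Z, F z y ≤ D.velocity * F x y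

/-- After exchanging the sums over `Z` and `z`, the inner sum runs over the sets containing both `x`
and `z`; what remains is a convolution of `F` with itself. -/
lemma pair_sum_le {L : FiniteLattice V} {ν : Finset V → ℝ} {F : V → V → ℝ} {lam p : ℝ}
    (hlam : 0 ≤ lam)
    (hF : ∀ x y, 0 ≤ F x y)
    (h1 : ∀ x ∈ L.sites, ∀ y ∈ L.sites, ∑ X ∈ L.sites.powerset with x ∈ X ∧ y ∈ X, ν X
          ≤ lam * F x y)
    (h2 : ∀ x ∈ L.sites, ∀ y ∈ L.sites, ∑ z ∈ L.sites, F x z * F z y ≤ p * F x y)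
    {x y : V} (hx : x ∈ L.sites) (hy : y ∈ L.sites) :
    ∑ Z ∈ L.sites.powerset with x ∈ Z, 2 * ν Z * ∑ z ∈ Z, F z y ≤ 2 * lam * p * F x y := by
  calc ∑ Z ∈ L.sites.powerset with x ∈ Z, 2 * ν Z * ∑ z ∈ Z, F z y
      = ∑ z ∈ L.sites, 2 * F z y * ∑ Z ∈ L.sites.powerset with x ∈ Z ∧ z ∈ Z, ν Z := by
        have h3 : ∀ Z ∈ L.sites.powerset.filter (x ∈ ·), 2 * ν Z * ∑ z ∈ Z, F z y =
            ∑ z ∈ L.sites, if z ∈ Z then 2 * F z y * ν Z else 0 := by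
          intro Z hZ
          simp only [Finset.mem_filter, Finset.mem_powerset] at hZ
          rw [← Finset.sum_filter, Finset.mul_sum, Finset.filter_mem_eq_inter,
            Finset.inter_eq_right.mpr hZ.1]
          exact Finset.sum_congr rfl fun z _ => by ring
        rw [Finset.sum_congr rfl h3, Finset.sum_comm]
        refine Finset.sum_congr rfl fun z _ => ?_
        rw [← Finset.sum_filter, Finset.filter_filter, Finset.mul_sum]
    _ ≤ ∑ z ∈ L.sites, 2 * F z y * (lam * F x z) :=
        Finset.sum_le_sum fun z hz => mul_le_mul_of_nonneg_left (h1 x hx z hz)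
          (mul_nonneg zero_le_two (hF _ _))
    _ = 2 * lam * ∑ z ∈ L.sites, F x z * F z y := by
        rw [Finset.mul_sum]
        exact Finset.sum_congr rfl fun z _ => by ring
    _ ≤ 2 * lam * (p * F x y) := mul_le_mul_of_nonneg_left (h2 x hx y hy) (by positivity)
    _ = _ := by ring

/-- Moving the first argument of `F` from `x` to another point of `Z` costs at most the factor `g`
at the diameter of `Z`, once for each of the points of `Z`. -/
lemma diam_sum_le {L : FiniteLattice V} {ν : Finset V → ℝ} (hν : ∀ X, 0 ≤ ν X) {F : V → V → ℝ}
    (hF : ∀ x y, 0 ≤ F x y) {g : ℕ → ℝ} {s : ℝ}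
    (hg : ∀ x ∈ L.sites, ∀ y ∈ L.sites, ∀ z ∈ L.sites, ∀ r, L.dist x z ≤ r → F z y ≤ g r * F x y)
    (h1 : ∀ x ∈ L.sites, ∑ X ∈ L.sites.powerset with x ∈ X,
        ν X * (X.card : ℝ) * g (setDiam L.dist X) ≤ s)
    {x y : V} (hx : x ∈ L.sites) (hy : y ∈ L.sites) :
    ∑ Z ∈ L.sites.powerset with x ∈ Z, 2 * ν Z * ∑ z ∈ Z, F z y ≤ 2 * s * F x y := by
  calc ∑ Z ∈ L.sites.powerset with x ∈ Z, 2 * ν Z * ∑ z ∈ Z, F z y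
      ≤ ∑ Z ∈ L.sites.powerset with x ∈ Z,
        2 * ν Z * (Z.card * (g (setDiam L.dist Z) * F x y)) := by
        refine Finset.sum_le_sum fun Z hZ => ?_
        simp only [Finset.mem_filter, Finset.mem_powerset] at hZ
        refine mul_le_mul_of_nonneg_left ?_ (mul_nonneg zero_le_two (hν Z))
        rw [← nsmul_eq_mul]
        exact Finset.sum_le_card_nsmul _ _ _ fun z hz =>
          hg x hx y hy z (hZ.1 hz) _ (dist_le_setDiam _ hZ.2 hz)
    _ = 2 * (∑ Z ∈ L.sites.powerset with x ∈ Z, ν Z * Z.card * g (setDiam L.dist Z)) * F x y := by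
        rw [Finset.mul_sum, Finset.sum_mul]
        exact Finset.sum_congr rfl fun Z _ => by ring
    _ ≤ _ := by
        have := h1 x hx
        have := hF x y
        gcongr

lemma exists_decayKernel {L : FiniteLattice V} {D : DecayLaw} (hD : D.Admissible)
    {h : (X : Finset V) → Op M X} (hh : D.Holds L h) :
    ∃ F, IsDecayKernel L D (fun X => ‖h X‖) F := by
  cases D with
  | powerPair lam p eta =>
    obtain ⟨d1, d2, d3⟩ := hD
    refine ⟨fun x y => 1 / (1 + (L.dist x y : ℝ)) ^ eta, fun x y => by positivity, ?_, ?_, ?_⟩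
    · simp [L.dist_self]
    · exact fun x y => (one_div_one_add_rpow _ _).le
    · intro x hx y hy
      refine pair_sum_le (ν := fun X => ‖h X‖)
        (F := fun x y => 1 / (1 + (L.dist x y : ℝ)) ^ eta) d1.le (fun x y => by positivity) ?_ ?_ hx hy
      · intro x hx y hy
        simpa [div_eq_mul_inv] using hh.1 x hx y hy
      · intro x hx y hy
        simpa [div_eq_mul_inv] using hh.2 x hx y hy
  | powerSum eta s =>
    obtain ⟨d1, d2⟩ := hD
    refine ⟨fun x y => 1 / (1 + (L.dist x y : ℝ)) ^ eta, fun x y => by positivity, ?_, ?_, ?_⟩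
    · simp [L.dist_self]
    · exact fun x y => (one_div_one_add_rpow _ _).le
    · intro x hx y hy
      refine diam_sum_le (F := fun x y => 1 / (1 + (L.dist x y : ℝ)) ^ eta)
        (g := fun r => (1 + (r : ℝ)) ^ eta) (fun _ => norm_nonneg _)
        (fun x y => by positivity) ?_ hh hx hy
      intro x hx y hy z hz r hr
      have h1 : (L.dist x y : ℝ) ≤ L.dist x z + L.dist z y := by
        exact_mod_cast L.dist_triangle hx hz hy
      have h2 : (L.dist x z : ℝ) ≤ r := by exact_mod_cast hr
      rw [mul_one_div, div_le_div_iff₀ (by positivity) (by positivity), one_mul,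
        ← Real.mul_rpow (by positivity) (by positivity)]
      refine Real.rpow_le_rpow (by positivity) ?_ d1.le
      -- This is the cross term in `1 + d(x,y) ≤ (1 + r) (1 + d(z,y))`.
      have : (0 : ℝ) ≤ r * L.dist z y := by positivity
      nlinarith
  | expPair lam mu eps eta K =>
    obtain ⟨d1, d2, d3, d4, d5⟩ := hD
    have hb := bddAbove_rpow_mul_exp d3 eta
    set lam' := ⨆ k : ℕ, (1 + (k : ℝ)) ^ eta * Real.exp (-eps * (k : ℝ)) with hlam'
    have hlam0 : 0 ≤ lam' := Real.iSup_nonneg fun k => by positivity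
    -- A pure exponential need not have a convolution bounded by a multiple of itself. The
    -- polynomial factor provides summability and is paid for by the extra decay `eps`, at the price
    -- of `lam'`.
    refine ⟨fun x y => Real.exp (-(mu * L.dist x y)) * (1 / (1 + (L.dist x y : ℝ)) ^ eta),
      fun x y => by positivity, ?_, ?_, ?_⟩
    · simp [L.dist_self]
    · intro x y
      refine mul_le_of_le_one_right (by positivity) ?_
      rw [div_le_one (by positivity)]
      exact Real.one_le_rpow (by simp) d4.le
    · intro x hx y hy
      have e : DecayLaw.velocity (.expPair lam mu eps eta K) =
          2 * (lam * lam') * ((2 : ℝ) ^ (eta + 1) * K) := by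
        simp only [DecayLaw.velocity]
        ring
      rw [e]
      refine pair_sum_le (ν := fun X => ‖h X‖) (F := fun x y => Real.exp (-(mu * L.dist x y)) *
        (1 / (1 + (L.dist x y : ℝ)) ^ eta)) (mul_nonneg d1.le hlam0) (fun x y => by positivity) ?_ ?_ hx hy
      · intro x hx y hy
        refine (hh.2 x hx y hy).trans ?_
        have h1 := le_ciSup hb (L.dist x y)
        have h2 : 0 < (1 + (L.dist x y : ℝ)) ^ eta := by positivity
        have h3 : Real.exp (-eps * L.dist x y) ≤ lam' * (1 / (1 + (L.dist x y : ℝ)) ^ eta) := by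
          rw [mul_one_div, le_div_iff₀ h2, mul_comm]
          exact h1
        calc lam * Real.exp (-(mu + eps) * L.dist x y)
            = lam * (Real.exp (-(mu * L.dist x y)) * Real.exp (-eps * L.dist x y)) := by
              rw [← Real.exp_add]
              congr 2
              ring
          _ ≤ lam * (Real.exp (-(mu * L.dist x y)) *
              (lam' * (1 / (1 + (L.dist x y : ℝ)) ^ eta))) := by gcongr
          _ = _ := by ring
      · intro x hx y hy
        have h1 := rpow_convolution_le d4.le L hh.1 hx hy
        calc ∑ z ∈ L.sites, Real.exp (-(mu * L.dist x z)) * (1 / (1 + (L.dist x z : ℝ)) ^ eta) *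
              (Real.exp (-(mu * L.dist z y)) * (1 / (1 + (L.dist z y : ℝ)) ^ eta))
            ≤ ∑ z ∈ L.sites, Real.exp (-(mu * L.dist x y)) *
              (1 / (1 + (L.dist x z : ℝ)) ^ eta * (1 / (1 + (L.dist z y : ℝ)) ^ eta)) := by
              refine Finset.sum_le_sum fun z hz => ?_
              have ht : (L.dist x y : ℝ) ≤ L.dist x z + L.dist z y := by
                exact_mod_cast L.dist_triangle hx hz hy
              have : Real.exp (-(mu * L.dist x z)) * Real.exp (-(mu * L.dist z y)) ≤
                  Real.exp (-(mu * L.dist x y)) := by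
                rw [← Real.exp_add]
                apply Real.exp_le_exp.mpr
                nlinarith
              calc _ = Real.exp (-(mu * L.dist x z)) * Real.exp (-(mu * L.dist z y)) *
                  (1 / (1 + (L.dist x z : ℝ)) ^ eta * (1 / (1 + (L.dist z y : ℝ)) ^ eta)) := by
                    ring
                _ ≤ _ := by gcongr
          _ ≤ _ := by
              rw [← Finset.mul_sum]
              calc _ ≤ Real.exp (-(mu * L.dist x y)) * ((2 : ℝ) ^ (eta + 1) * K *
                    (1 / (1 + (L.dist x y : ℝ)) ^ eta)) := by gcongr
                _ = _ := by ring
  | expSum mu s =>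
    obtain ⟨d1, d2⟩ := hD
    refine ⟨fun x y => Real.exp (-(mu * L.dist x y)), fun x y => by positivity, ?_, ?_, ?_⟩
    · simp [L.dist_self]
    · exact fun x y => le_rfl
    · intro x hx y hy
      refine diam_sum_le (F := fun x y => Real.exp (-(mu * L.dist x y)))
        (g := fun r => Real.exp (mu * r)) (fun _ => norm_nonneg _)
        (fun x y => by positivity) ?_ hh hx hy
      intro x hx y hy z hz r hr
      have h1 : (L.dist x y : ℝ) ≤ L.dist x z + L.dist z y := by
        exact_mod_cast L.dist_triangle hx hz hy
      have h2 : (L.dist x z : ℝ) ≤ r := by exact_mod_cast hr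
      rw [← Real.exp_add]
      apply Real.exp_le_exp.mpr
      nlinarith

lemma hamiltonian_isHermitian {Λ : Finset V} {h : (X : Finset V) → Op M X}
    (hsa : ∀ X ⊆ Λ, (h X).IsHermitian) : (hamiltonian Λ h).IsHermitian := by
  rw [hamiltonian, Matrix.IsHermitian, Matrix.conjTranspose_sum]
  refine Finset.sum_congr rfl fun X hX => ?_
  rw [← embed_conjTranspose, hsa X (Finset.mem_powerset.mp hX)]

/-- The Lieb–Robinson bound for lattice systems. -/
theorem lattice_lieb_robinson {L : FiniteLattice V} {D : DecayLaw} (hD : D.Admissible)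
    {h : (X : Finset V) → Op M X} (hh : D.Holds L h)
    (hsa : ∀ X ⊆ L.sites, (h X).IsHermitian) (hev : ∀ X ⊆ L.sites, IsEven (h X))
    {X Y : Finset V} (hX : X ⊆ L.sites) (hY : Y ⊆ L.sites)
    {a : Op M X} {b : Op M Y} (hAB : Commute (embed X L.sites a) (embed Y L.sites b)) (t : ℝ) :
    ‖⁅embed X L.sites a, heis (hamiltonian L.sites h) t (embed Y L.sites b)⁆‖ ≤
      2 * ‖a‖ * ‖b‖ * (X.card : ℝ) * (Y.card : ℝ) *
        Real.exp (-D.rate (setDist L.dist X Y)) * (Real.exp (D.velocity * |t|) - 1) := by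
  obtain ⟨F, hF0, hF1, hF2, hF3⟩ := exists_decayKernel hD hh
  -- A superposition of kernels based at the points of `Y`: at least `1` on `Y`, and
  -- self-reproducing because each kernel is.
  set w : V → ℝ := fun x => ∑ y ∈ Y, F x y with hw
  have hv := (DecayLaw.velocity_pos hD).le
  have hemb : ∀ Z ⊆ L.sites, ∀ {W : Finset V}, W ⊆ L.sites → Disjoint Z W → ∀ c : Op M W,
      Commute (embed Z L.sites (h Z)) (embed W L.sites c) := fun Z hZ W hW hd c =>
    commute_embed hd hZ hW ((hev Z hZ).isBosonicPair c)
  have hsum : ∀ x ∈ L.sites, ∑ Z ∈ L.sites.powerset with x ∈ Z,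
      2 * ‖embed Z L.sites (h Z)‖ * ∑ z ∈ Z, w z ≤ D.velocity * w x := by
    intro x hx
    calc _ ≤ ∑ Z ∈ L.sites.powerset with x ∈ Z, 2 * ‖h Z‖ * ∑ z ∈ Z, w z := by
          refine Finset.sum_le_sum fun Z hZ => ?_
          simp only [Finset.mem_filter, Finset.mem_powerset] at hZ
          have := norm_embed_le hZ.1 (h Z)
          have : 0 ≤ ∑ z ∈ Z, w z :=
            Finset.sum_nonneg fun z _ => Finset.sum_nonneg fun y _ => hF0 z y
          gcongr
      _ = ∑ y ∈ Y, ∑ Z ∈ L.sites.powerset with x ∈ Z, 2 * ‖h Z‖ * ∑ z ∈ Z, F z y := by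
          rw [Finset.sum_comm]
          refine Finset.sum_congr rfl fun Z _ => ?_
          rw [← Finset.mul_sum, Finset.sum_comm]
      _ ≤ ∑ y ∈ Y, D.velocity * F x y := Finset.sum_le_sum fun y hy => hF3 x hx y (hY hy)
      _ = _ := by rw [hw, Finset.mul_sum]
  have hWX : ∑ x ∈ X, w x ≤ X.card * (Y.card * Real.exp (-D.rate (setDist L.dist X Y))) := by
    rw [← nsmul_eq_mul, ← nsmul_eq_mul]
    refine Finset.sum_le_card_nsmul _ _ _ fun x hx => Finset.sum_le_card_nsmul _ _ _ fun y hy => ?_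
    refine (hF2 x y).trans (Real.exp_le_exp.mpr (neg_le_neg ?_))
    exact DecayLaw.rate_mono hD (setDist_le _ hx hy)
  have hw0 : ∀ x ∈ L.sites, 0 ≤ w x := fun x _ => Finset.sum_nonneg fun y _ => hF0 x y
  have hw1 : ∀ x ∈ Y, 1 ≤ w x := fun x hx =>
    (hF1 x).trans (Finset.single_le_sum (f := fun y => F x y) (fun y _ => hF0 x y) hx)
  have main : ‖⁅embed X L.sites a, heis (hamiltonian L.sites h) t (embed Y L.sites b)⁆‖ ≤
      2 * ‖embed X L.sites a‖ * ‖embed Y L.sites b‖ * (∑ x ∈ X, w x) *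
        (Real.exp (D.velocity * |t|) - 1) := by
    have hsa' : ∀ Z ⊆ L.sites, IsSelfAdjoint (embed Z L.sites (h Z)) := fun Z hZ => by
      rw [IsSelfAdjoint, Matrix.star_eq_conjTranspose, ← embed_conjTranspose, hsa Z hZ]
    rcases le_total 0 t with ht | ht
    · rw [abs_of_nonneg ht]
      exact lieb_robinson hX hsa' (fun Z hZ Z' hZ' hd => hemb Z hZ hZ' hd _) hAB
        (fun Z hZ hd => hemb Z hZ hX hd _) (fun Z hZ hd => hemb Z hZ hY hd _) hv hw0 hw1 hsum ht
    · rw [abs_of_nonpos ht]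
      -- Negative times are positive times for the Hamiltonian with the opposite sign.
      have := lieb_robinson (h := fun Z => -embed Z L.sites (h Z)) hX (fun Z hZ => (hsa' Z hZ).neg)
        (fun Z hZ Z' hZ' hd => ((hemb Z hZ hZ' hd _).neg_left).neg_right) hAB
        (fun Z hZ hd => (hemb Z hZ hX hd _).neg_left) (fun Z hZ hd => (hemb Z hZ hY hd _).neg_left)
        hv hw0 hw1 (by simpa only [norm_neg] using hsum) (neg_nonneg.mpr ht)
      rwa [Finset.sum_neg_distrib, heis_neg_left, neg_neg] at this
  refine main.trans ?_
  have he : 0 ≤ Real.exp (D.velocity * |t|) - 1 :=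
    sub_nonneg.mpr (Real.one_le_exp (by positivity))
  have := norm_embed_le hX a
  have := norm_embed_le hY b
  calc _ ≤ 2 * ‖a‖ * ‖b‖ * (X.card * (Y.card * Real.exp (-D.rate (setDist L.dist X Y)))) *
        (Real.exp (D.velocity * |t|) - 1) := by
        have : 0 ≤ ∑ x ∈ X, w x := Finset.sum_nonneg fun x hx => hw0 x (hX hx)
        gcongr
    _ = _ := by ring

end Decay

/-! ### The Gaussian frequency filter -/

section Filter

open MeasureTheory

lemma integrableOn_exp_mul_sinc {α : ℝ} (hα : 0 < α) (ω : ℝ) :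
    IntegrableOn (fun t : ℝ => Real.exp (-α * t ^ 2) * (Real.sin (ω * t) / t)) (Set.Ioi 0) := by
  refine ((integrable_exp_neg_mul_sq hα).integrableOn.mul_const |ω|).mono' ?_ ?_
  · refine Measurable.aestronglyMeasurable ?_
    fun_prop
  · filter_upwards [ae_restrict_mem measurableSet_Ioi] with t ht
    have ht : (0 : ℝ) < t := ht
    rw [norm_mul, Real.norm_eq_abs, abs_of_pos (Real.exp_pos _), Real.norm_eq_abs, abs_div,
      abs_of_pos ht]
    gcongr
    rw [div_le_iff₀ ht]
    refine (Real.abs_sin_le_abs).trans ?_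
    rw [abs_mul, abs_of_pos ht]

/-- Half of the real part of the Gaussian Fourier transform, by evenness. -/
lemma integral_exp_mul_cos {α : ℝ} (hα : 0 < α) (ω : ℝ) :
    ∫ t in Set.Ioi (0 : ℝ), Real.exp (-α * t ^ 2) * Real.cos (ω * t) =
      √(Real.pi / α) / 2 * Real.exp (-(1 / (4 * α)) * ω ^ 2) := by
  have h1 := fourierIntegral_gaussian (b := α) (by simpa using hα) ω
  have h2 : ∫ t : ℝ, Real.exp (-α * t ^ 2) * Real.cos (ω * t) =
      √(Real.pi / α) * Real.exp (-(1 / (4 * α)) * ω ^ 2) := by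
    have h3 := congrArg Complex.re h1
    have h4 : (∫ x : ℝ, Complex.exp (Complex.I * ω * x) * Complex.exp (-(α : ℂ) * x ^ 2)).re =
        ∫ t : ℝ, Real.exp (-α * t ^ 2) * Real.cos (ω * t) := by
      have hint : Integrable fun x : ℝ =>
          Complex.exp (Complex.I * ω * x) * Complex.exp (-(α : ℂ) * x ^ 2) := by
        refine (integrable_exp_neg_mul_sq hα).mono' ?_ (ae_of_all _ fun x => ?_)
        · exact Continuous.aestronglyMeasurable (by fun_prop)
        · rw [norm_mul, Complex.norm_exp, Complex.norm_exp]
          simp [← Complex.ofReal_pow]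
      rw [← RCLike.re_eq_complex_re, ← integral_re hint]
      refine integral_congr_ae (ae_of_all _ fun x => ?_)
      have e1 : Complex.exp (-(α : ℂ) * x ^ 2) = (Real.exp (-α * x ^ 2) : ℂ) := by
        push_cast
        rfl
      have e2 : Complex.exp (Complex.I * ω * x) = Complex.exp ((ω * x : ℝ) * Complex.I) := by
        congr 1
        push_cast
        ring
      simp only [e1, e2, RCLike.re_eq_complex_re, Complex.re_mul_ofReal,
        Complex.exp_ofReal_mul_I_re]
      ring
    rw [h4] at h3
    rw [h3]
    have e3 : ((Real.pi : ℂ) / α) ^ (1 / 2 : ℂ) = (√(Real.pi / α) : ℂ) := by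
      rw [Real.sqrt_eq_rpow, Complex.ofReal_cpow (by positivity)]
      push_cast
      rfl
    have e4 : Complex.exp (-(ω : ℂ) ^ 2 / (4 * α)) = (Real.exp (-(1 / (4 * α)) * ω ^ 2) : ℂ) := by
      push_cast
      congr 1
      ring
    rw [e3, e4, ← Complex.ofReal_mul, Complex.ofReal_re]
  have h5 := integral_comp_abs (f := fun t => Real.exp (-α * t ^ 2) * Real.cos (ω * t))
  have h6 : ∀ t : ℝ, Real.exp (-α * |t| ^ 2) * Real.cos (ω * |t|) =
      Real.exp (-α * t ^ 2) * Real.cos (ω * t) := by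
    intro t
    rcases abs_choice t with h | h <;> simp [h]
  simp only [h6, h2] at h5
  linarith

/-- Differentiation in `ω` removes the denominator and leaves the cosine integral; at `ω = 0` both
sides vanish. -/
lemma integral_exp_mul_sinc {α : ℝ} (hα : 0 < α) (ω : ℝ) :
    ∫ t in Set.Ioi (0 : ℝ), Real.exp (-α * t ^ 2) * (Real.sin (ω * t) / t) =
      ∫ s in (0 : ℝ)..ω, √(Real.pi / α) / 2 * Real.exp (-(1 / (4 * α)) * s ^ 2) := by
  have hd : ∀ s : ℝ, HasDerivAt
      (fun s => ∫ t in Set.Ioi (0 : ℝ), Real.exp (-α * t ^ 2) * (Real.sin (s * t) / t))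
      (√(Real.pi / α) / 2 * Real.exp (-(1 / (4 * α)) * s ^ 2)) s := by
    intro s
    rw [← integral_exp_mul_cos hα s]
    refine (hasDerivAt_integral_of_dominated_loc_of_deriv_le (s := Set.univ) (x₀ := s)
      (μ := volume.restrict (Set.Ioi (0 : ℝ)))
      (F := fun s t => Real.exp (-α * t ^ 2) * (Real.sin (s * t) / t))
      (F' := fun s t => Real.exp (-α * t ^ 2) * Real.cos (s * t))
      (bound := fun t => Real.exp (-α * t ^ 2)) Filter.univ_mem ?_
      (integrableOn_exp_mul_sinc hα s) ?_ ?_ ?_ ?_).2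
    · exact Filter.Eventually.of_forall fun x => (integrableOn_exp_mul_sinc hα x).1
    · exact Continuous.aestronglyMeasurable (by fun_prop)
    · refine ae_of_all _ fun t x _ => ?_
      rw [norm_mul, Real.norm_eq_abs, abs_of_pos (Real.exp_pos _)]
      exact mul_le_of_le_one_right (Real.exp_pos _).le (Real.abs_cos_le_one _)
    · exact (integrable_exp_neg_mul_sq hα).integrableOn
    · filter_upwards [ae_restrict_mem measurableSet_Ioi] with t ht x _
      have ht : (0 : ℝ) < t := ht
      have h1 : HasDerivAt (fun x => Real.sin (x * t) / t) (Real.cos (x * t)) x := by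
        have := (((hasDerivAt_id x).mul_const t).sin).div_const t
        simpa [ht.ne'] using this
      exact h1.const_mul _
  have h0 := intervalIntegral.integral_eq_sub_of_hasDerivAt (a := 0) (b := ω) (fun s _ => hd s)
    (Continuous.intervalIntegrable (by fun_prop) _ _)
  rw [h0]
  simp

/-- A regularized Dirichlet integral. Its distance from `π / 2` is a Gaussian tail beyond `ω`, and
`(s + ω)² ≥ s² + ω²` extracts the exponential factor from the tail. -/
lemma abs_integral_exp_mul_sinc_sub_le {α : ℝ} (hα : 0 < α) {ω : ℝ} (hω : 0 ≤ ω) :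
    |(∫ t in Set.Ioi (0 : ℝ), Real.exp (-α * t ^ 2) * (Real.sin (ω * t) / t)) - Real.pi / 2| ≤
      Real.pi / 2 * Real.exp (-(1 / (4 * α)) * ω ^ 2) := by
  have hβ : 0 < 1 / (4 * α) := by positivity
  set g : ℝ → ℝ := fun s => √(Real.pi / α) / 2 * Real.exp (-(1 / (4 * α)) * s ^ 2) with hg
  have hgi : Integrable g := (integrable_exp_neg_mul_sq hβ).const_mul _
  have htot : ∫ s in Set.Ioi (0 : ℝ), g s = Real.pi / 2 := by
    rw [hg, integral_const_mul, integral_gaussian_Ioi]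
    have : √(Real.pi / α) * √(Real.pi / (1 / (4 * α))) = 2 * Real.pi := by
      rw [← Real.sqrt_mul (by positivity), show Real.pi / α * (Real.pi / (1 / (4 * α))) =
        (2 * Real.pi) ^ 2 by field_simp; ring, Real.sqrt_sq (by positivity)]
    linarith
  rw [integral_exp_mul_sinc hα]
  change |(∫ s in (0 : ℝ)..ω, g s) - _| ≤ _
  have h1 := intervalIntegral.integral_interval_add_Ioi (a := 0) (b := ω) hgi.integrableOn
    hgi.integrableOn
  have h2 : (∫ s in (0 : ℝ)..ω, g s) - Real.pi / 2 = -∫ s in Set.Ioi ω, g s := by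
    rw [← htot, ← h1]
    ring
  have h3 : ∫ s in Set.Ioi ω, g s = ∫ s in Set.Ioi (0 : ℝ), g (s + ω) := by
    rw [← (measurePreserving_add_right volume ω).setIntegral_preimage_emb
      (measurableEmbedding_addRight ω)]
    simp
  have h4 : 0 ≤ ∫ s in Set.Ioi (0 : ℝ), g (s + ω) :=
    setIntegral_nonneg measurableSet_Ioi fun s _ => by positivity
  rw [h2, abs_neg, h3, abs_of_nonneg h4, ← htot, ← integral_mul_const]
  refine setIntegral_mono_on (hgi.comp_add_right ω).integrableOn
    (hgi.mul_const _).integrableOn measurableSet_Ioi fun s hs => ?_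
  have hs : (0 : ℝ) < s := hs
  simp only [hg, mul_assoc, ← Real.exp_add]
  gcongr
  have : 0 ≤ 1 / (4 * α) * (s * ω) := by positivity
  nlinarith

/-- A function of the time with frequencies at least `ΔE` that is small for short times has small
total amplitude. -/
lemma norm_sum_le_of_filter {ι : Type*} (s : Finset ι) (c : ι → ℂ) (ω : ι → ℝ)
    {ΔE v l δ M N : ℝ} (hΔE : 0 < ΔE) (hv : 0 < v) (hl : 0 ≤ l) (hδ : 0 ≤ δ) (hN : 0 ≤ N)
    (hω : ∀ i ∈ s, ΔE ≤ ω i) (hM : ∑ i ∈ s, ‖c i‖ ≤ M)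
    (hg : ∀ t, 0 < t → ‖∑ i ∈ s, c i * Real.sin (ω i * t)‖ ≤
      N * (Real.exp (-l) * (Real.exp (v * t) - 1)) + δ * t) :
    ‖∑ i ∈ s, c i‖ ≤ (3 * M + N) * Real.exp (-(l / (1 + 2 * v / ΔE))) + δ * (l / (v + ΔE / 2)) := by
  set k := l / (1 + 2 * v / ΔE) with hk
  -- The cutoff time at which the two errors balance: the commutator has grown to `exp (v T - l) =
  -- exp (-k)`, where also `k = ΔE * T / 2`.
  set T := l / (v + ΔE / 2) with hT
  have hM0 : 0 ≤ M := (Finset.sum_nonneg fun i _ => norm_nonneg _).trans hM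
  have hT0 : 0 ≤ T := by positivity
  have hkT : k = ΔE * T / 2 := by
    rw [hk, hT]
    field_simp
    ring
  have hlT : v * T - l = -k := by
    rw [hkT, hT]
    field_simp
    ring
  have hsum : ‖∑ i ∈ s, c i‖ ≤ M := (norm_sum_le _ _).trans hM
  -- For `k ≤ 1` the trivial bound `M` is enough, since `3 exp (-1) ≥ 1`; otherwise `T > 0` and one
  -- may divide by `k`.
  rcases le_or_gt k 1 with hk1 | hk1
  · have h1 : 1 ≤ 3 * Real.exp (-k) := by
      have h2 : Real.exp (-1) ≤ Real.exp (-k) := Real.exp_le_exp.mpr (by linarith)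
      have h3 := Real.exp_one_lt_d9
      have h4 : Real.exp 1 * Real.exp (-1) = 1 := by rw [← Real.exp_add]; simp
      have h5 := Real.exp_pos (-1)
      nlinarith
    have h2 : 0 ≤ N * Real.exp (-k) + δ * T := by positivity
    nlinarith
  have hTpos : 0 < T := by
    rcases hT0.eq_or_lt with h | h
    · rw [hkT, ← h] at hk1
      norm_num at hk1
    · exact h
  -- With this width both `α T²` and `ΔE² / (4 α)` equal `k`, so the tail in time and the error in
  -- frequency are of the same order `exp (-k)`.
  set α := ΔE / (2 * T) with hα
  have hα0 : 0 < α := by positivity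
  have hαT : α * T ^ 2 = k := by
    rw [hkT, hα]
    field_simp
  set J : ℝ → ℝ := fun w => ∫ t in Set.Ioi (0 : ℝ), Real.exp (-α * t ^ 2) * (Real.sin (w * t) / t)
  set f : ℝ → ℂ := fun t => ∑ i ∈ s, c i * ((Real.exp (-α * t ^ 2) * (Real.sin (ω i * t) / t) : ℝ) : ℂ)
    with hf
  have hfi : ∀ i, IntegrableOn (fun t : ℝ =>
      c i * ((Real.exp (-α * t ^ 2) * (Real.sin (ω i * t) / t) : ℝ) : ℂ)) (Set.Ioi 0) := fun i =>
    ((integrableOn_exp_mul_sinc hα0 (ω i)).ofReal).const_mul (c i)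
  have hfint : IntegrableOn f (Set.Ioi 0) := integrable_finsetSum _ fun i _ => hfi i
  have hJ : ∫ t in Set.Ioi (0 : ℝ), f t = ∑ i ∈ s, c i * (J (ω i) : ℂ) := by
    rw [hf, integral_finsetSum _ fun i _ => hfi i]
    refine Finset.sum_congr rfl fun i _ => ?_
    rw [integral_const_mul, integral_complex_ofReal]
  have hfeq : ∀ t : ℝ, f t = ((Real.exp (-α * t ^ 2) / t : ℝ) : ℂ) *
      ∑ i ∈ s, c i * Real.sin (ω i * t) := by
    intro t
    rw [hf, Finset.mul_sum]
    refine Finset.sum_congr rfl fun i _ => ?_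
    push_cast
    ring
  have hfn : ∀ t, 0 < t → ‖f t‖ = Real.exp (-α * t ^ 2) / t *
      ‖∑ i ∈ s, c i * Real.sin (ω i * t)‖ := by
    intro t ht
    rw [hfeq, norm_mul, Complex.norm_real, Real.norm_eq_abs, abs_of_nonneg (by positivity)]
  have hshort : ‖∫ t in Set.Ioc (0 : ℝ) T, f t‖ ≤ N * Real.exp (-k) + δ * T := by
    have hprim : ∫ t in (0 : ℝ)..T, (N * Real.exp (-l) * (v * Real.exp (v * t)) + δ) =
        N * Real.exp (-l) * (Real.exp (v * T) - 1) + δ * T := by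
      rw [intervalIntegral.integral_eq_sub_of_hasDerivAt
        (f := fun t => N * Real.exp (-l) * Real.exp (v * t) + δ * t)]
      · simp
        ring
      · intro t _
        have h1 := (((hasDerivAt_id t).const_mul v).exp).const_mul (N * Real.exp (-l))
        have h2 := (hasDerivAt_id t).const_mul δ
        refine (h1.add h2).congr_deriv ?_
        simp only [id]
        ring
      · exact Continuous.intervalIntegrable (by fun_prop) _ _
    rw [intervalIntegral.integral_of_le hT0] at hprim
    have hle : ‖∫ t in Set.Ioc (0 : ℝ) T, f t‖ ≤
        ∫ t in Set.Ioc (0 : ℝ) T, (N * Real.exp (-l) * (v * Real.exp (v * t)) + δ) := by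
      refine norm_integral_le_of_norm_le ?_ ?_
      · exact (Continuous.integrableOn_Icc (by fun_prop)).mono_set Set.Ioc_subset_Icc_self
      · filter_upwards [ae_restrict_mem measurableSet_Ioc] with t ht
        have ht0 : 0 < t := ht.1
        rw [hfn t ht0]
        have h1 : Real.exp (-α * t ^ 2) ≤ 1 := Real.exp_le_one_iff.mpr (by
          have : 0 ≤ α * t ^ 2 := by positivity
          linarith)
        -- The factor `t` cancels the singularity `1 / t` of the filter, and the remaining majorant
        -- has an explicit primitive.
        have h2 : Real.exp (v * t) - 1 ≤ v * Real.exp (v * t) * t := by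
          have h3 := Real.add_one_le_exp (-(v * t))
          have h4 : Real.exp (v * t) * Real.exp (-(v * t)) = 1 := by rw [← Real.exp_add]; simp
          have h5 := Real.exp_pos (v * t)
          nlinarith
        calc Real.exp (-α * t ^ 2) / t * ‖∑ i ∈ s, c i * Real.sin (ω i * t)‖
            ≤ 1 / t * (N * (Real.exp (-l) * (v * Real.exp (v * t) * t)) + δ * t) := by
              have := hg t ht0
              gcongr
              exact this.trans (by gcongr)
          _ = _ := by field_simp
    rw [hprim] at hle
    refine hle.trans ?_
    have h6 : Real.exp (-l) * Real.exp (v * T) = Real.exp (-k) := by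
      rw [← Real.exp_add, ← hlT]
      congr 1
      ring
    have h7 : 0 ≤ N * Real.exp (-l) := by positivity
    calc _ = N * (Real.exp (-l) * Real.exp (v * T)) - N * Real.exp (-l) + δ * T := by ring
      _ ≤ _ := by rw [h6]; linarith
  have hlong : ‖∫ t in Set.Ioi T, f t‖ ≤ M * Real.exp (-k) / 2 := by
    have hderiv : ∀ t : ℝ, HasDerivAt (fun t => -(M / T ^ 2 / (2 * α)) * Real.exp (-α * t ^ 2))
        (M / T ^ 2 * (t * Real.exp (-α * t ^ 2))) t := by
      intro t
      have h1 := ((((hasDerivAt_id t).pow 2).const_mul (-α)).exp).const_mul (-(M / T ^ 2 / (2 * α)))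
      refine h1.congr_deriv ?_
      simp only [id, Nat.cast_ofNat, Pi.pow_apply, Nat.add_one_sub_one, pow_one]
      field_simp
    have htend : Tendsto (fun t : ℝ => -(M / T ^ 2 / (2 * α)) * Real.exp (-α * t ^ 2)) atTop
        (𝓝 (-(M / T ^ 2 / (2 * α)) * 0)) := by
      refine Tendsto.const_mul _ (Real.tendsto_exp_atBot.comp ?_)
      exact (tendsto_pow_atTop (by norm_num)).const_mul_atTop_of_neg (by linarith)
    have hpos : ∀ t ∈ Set.Ioi T, 0 ≤ M / T ^ 2 * (t * Real.exp (-α * t ^ 2)) := by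
      intro t ht
      have : 0 < t := hTpos.trans ht
      positivity
    have hint := integrableOn_Ioi_deriv_of_nonneg' (fun t _ => hderiv t) hpos htend
    have hval := integral_Ioi_of_hasDerivAt_of_nonneg' (fun t _ => hderiv t) hpos htend
    have hle : ‖∫ t in Set.Ioi T, f t‖ ≤
        ∫ t in Set.Ioi T, M / T ^ 2 * (t * Real.exp (-α * t ^ 2)) := by
      refine norm_integral_le_of_norm_le hint ?_
      filter_upwards [ae_restrict_mem measurableSet_Ioi] with t ht
      have ht' : T < t := ht
      have ht0 : 0 < t := hTpos.trans ht'
      rw [hfn t ht0]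
      have h1 : ‖∑ i ∈ s, c i * Real.sin (ω i * t)‖ ≤ M := by
        refine (norm_sum_le _ _).trans (le_trans (Finset.sum_le_sum fun i _ => ?_) hM)
        rw [norm_mul, Complex.norm_real]
        exact mul_le_of_le_one_right (norm_nonneg _) (Real.abs_sin_le_one _)
      -- Beyond `T` this makes the Gaussian tail explicitly integrable; it comes to `M exp (-k) / (2
      -- k)`, and `k > 1`.
      have h2 : 1 / t ≤ t / T ^ 2 := by
        rw [div_le_div_iff₀ ht0 (by positivity)]
        nlinarith
      calc Real.exp (-α * t ^ 2) / t * ‖∑ i ∈ s, c i * Real.sin (ω i * t)‖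
          ≤ Real.exp (-α * t ^ 2) / t * M := by gcongr
        _ = M * Real.exp (-α * t ^ 2) * (1 / t) := by ring
        _ ≤ M * Real.exp (-α * t ^ 2) * (t / T ^ 2) := by gcongr
        _ = _ := by ring
    rw [hval] at hle
    refine hle.trans ?_
    have h3 : -α * T ^ 2 = -k := by rw [← hαT]; ring
    rw [h3]
    have h4 : M / T ^ 2 / (2 * α) = M / (2 * k) := by
      rw [← hαT]
      field_simp
    rw [h4]
    have h5 : M / (2 * k) ≤ M / 2 := by gcongr; linarith
    have h6 := Real.exp_pos (-k)
    nlinarith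
  have hsplit : ∫ t in Set.Ioi (0 : ℝ), f t = (∫ t in Set.Ioc (0 : ℝ) T, f t) + ∫ t in Set.Ioi T, f t := by
    rw [← setIntegral_union (Set.Ioc_disjoint_Ioi le_rfl) measurableSet_Ioi
      (hfint.mono_set Set.Ioc_subset_Ioi_self) (hfint.mono_set (Set.Ioi_subset_Ioi hT0)),
      Set.Ioc_union_Ioi_eq_Ioi hT0]
  have hJn : ‖∑ i ∈ s, c i * (J (ω i) : ℂ)‖ ≤ N * Real.exp (-k) + δ * T + M * Real.exp (-k) / 2 := by
    rw [← hJ, hsplit]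
    exact (norm_add_le _ _).trans (add_le_add hshort hlong)
  have herr : ‖∑ i ∈ s, c i * ((J (ω i) - Real.pi / 2 : ℝ) : ℂ)‖ ≤
      M * (Real.pi / 2 * Real.exp (-k)) := by
    refine (norm_sum_le _ _).trans (le_trans (Finset.sum_le_sum fun i hi => ?_)
      (le_trans (Finset.sum_mul s (fun i => ‖c i‖) _).ge (mul_le_mul_of_nonneg_right hM ?_)))
    · rw [norm_mul, Complex.norm_real]
      have hωi := hω i hi
      refine mul_le_mul_of_nonneg_left ((abs_integral_exp_mul_sinc_sub_le hα0
        (hΔE.le.trans hωi)).trans ?_) (norm_nonneg _)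
      gcongr
      have h1 : 1 / (4 * α) * ΔE ^ 2 = k := by
        rw [hkT, hα]
        field_simp
        ring
      have h2 : 1 / (4 * α) * ΔE ^ 2 ≤ 1 / (4 * α) * ω i ^ 2 := by gcongr
      linarith
    · positivity
  have hfinal : ((Real.pi / 2 : ℝ) : ℂ) * ∑ i ∈ s, c i = (∑ i ∈ s, c i * (J (ω i) : ℂ)) -
      ∑ i ∈ s, c i * ((J (ω i) - Real.pi / 2 : ℝ) : ℂ) := by
    rw [← Finset.sum_sub_distrib, Finset.mul_sum]
    refine Finset.sum_congr rfl fun i _ => ?_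
    push_cast
    ring
  have hn := congrArg norm hfinal
  rw [norm_mul, Complex.norm_real, Real.norm_eq_abs, abs_of_pos (by positivity)] at hn
  have hn2 := (norm_sub_le (∑ i ∈ s, c i * (J (ω i) : ℂ))
      (∑ i ∈ s, c i * ((J (ω i) - Real.pi / 2 : ℝ) : ℂ))).trans (add_le_add hJn herr)
  rw [← hn] at hn2
  have hpi := Real.pi_gt_three
  have hpi2 := Real.pi_lt_four
  have hek := Real.exp_pos (-k)
  have h8 : 0 ≤ M * Real.exp (-k) := by positivity
  have h9 := norm_nonneg (∑ i ∈ s, c i)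
  nlinarith

end Filter

/-! ### Norm estimates for matrices -/

section MatrixBounds

open Matrix

variable {n : Type*} [Fintype n]

lemma norm_dotProduct_le (x y : n → ℂ) :
    ∑ k, ‖x k‖ * ‖y k‖ ≤ ‖WithLp.toLp 2 x‖ * ‖WithLp.toLp 2 y‖ := by
  rw [EuclideanSpace.norm_eq, EuclideanSpace.norm_eq]
  exact Real.sum_mul_le_sqrt_mul_sqrt _ _ _

lemma norm_toLp_star (x : n → ℂ) : ‖WithLp.toLp 2 (star x)‖ = ‖WithLp.toLp 2 x‖ := by
  simp [EuclideanSpace.norm_eq]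

variable [DecidableEq n]

lemma norm_toLp_mulVec_le (A : Matrix n n ℂ) (x : n → ℂ) :
    ‖WithLp.toLp 2 (A *ᵥ x)‖ ≤ ‖A‖ * ‖WithLp.toLp 2 x‖ :=
  Matrix.l2_opNorm_mulVec A (WithLp.toLp 2 x)

/-- Cauchy–Schwarz over the intermediate states. It bounds the total amplitude entering the filter
independently of the dimension. -/
lemma sum_norm_vecMul_mul_norm_mulVec_le (A B : Matrix n n ℂ) (x y : n → ℂ) :
    ∑ k, ‖(star x ᵥ* A) k‖ * ‖(B *ᵥ y) k‖ ≤
      ‖A‖ * ‖B‖ * (‖WithLp.toLp 2 x‖ * ‖WithLp.toLp 2 y‖) := by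
  refine (norm_dotProduct_le _ _).trans ?_
  have h1 : ‖WithLp.toLp 2 (star x ᵥ* A)‖ ≤ ‖A‖ * ‖WithLp.toLp 2 x‖ := by
    have := norm_toLp_mulVec_le Aᴴ x
    rwa [l2_opNorm_conjTranspose, ← norm_toLp_star, star_mulVec, conjTranspose_conjTranspose] at this
  have h2 := norm_toLp_mulVec_le B y
  calc _ ≤ (‖A‖ * ‖WithLp.toLp 2 x‖) * (‖B‖ * ‖WithLp.toLp 2 y‖) := by gcongr
    _ = _ := by ring

lemma norm_star_dotProduct_mulVec_le (A : Matrix n n ℂ) (x y : n → ℂ) :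
    ‖star x ⬝ᵥ A *ᵥ y‖ ≤ ‖A‖ * (‖WithLp.toLp 2 x‖ * ‖WithLp.toLp 2 y‖) := by
  rw [dotProduct]
  refine (norm_sum_le _ _).trans ?_
  simp only [norm_mul]
  refine (norm_dotProduct_le _ _).trans ?_
  rw [norm_toLp_star]
  have := norm_toLp_mulVec_le A y
  calc _ ≤ ‖WithLp.toLp 2 x‖ * (‖A‖ * ‖WithLp.toLp 2 y‖) := by gcongr
    _ = _ := by ring

lemma norm_apply_le (A : Matrix n n ℂ) (i j : n) : ‖A i j‖ ≤ ‖A‖ := by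
  have := norm_star_dotProduct_mulVec_le A (Pi.single i 1) (Pi.single j 1)
  simpa [← Pi.single_star] using this

lemma sum_norm_row_mul_norm_col_le (A B : Matrix n n ℂ) (i : n) :
    ∑ k, ‖A i k‖ * ‖B k i‖ ≤ ‖A‖ * ‖B‖ := by
  have := sum_norm_vecMul_mul_norm_mulVec_le A B (Pi.single i 1) (Pi.single i 1)
  simpa [← Pi.single_star] using this

/-- The operator norm is at most the Hilbert–Schmidt norm. -/
lemma sq_norm_le_sum (A : Matrix n n ℂ) : ‖A‖ ^ 2 ≤ ∑ i, ∑ j, ‖A i j‖ ^ 2 := by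
  have h0 : 0 ≤ ∑ i, ∑ j, ‖A i j‖ ^ 2 := by positivity
  have h1 : ‖A‖ ≤ √(∑ i, ∑ j, ‖A i j‖ ^ 2) := by
    rw [l2_opNorm_def]
    refine ContinuousLinearMap.opNorm_le_bound _ (Real.sqrt_nonneg _) fun x => ?_
    rw [← Real.sqrt_sq (norm_nonneg x), ← Real.sqrt_mul h0, EuclideanSpace.norm_eq]
    refine Real.sqrt_le_sqrt ?_
    rw [Finset.sum_mul]
    refine Finset.sum_le_sum fun i _ => ?_
    have h2 : ‖(A *ᵥ x.ofLp) i‖ ≤ ∑ j, ‖A i j‖ * ‖x j‖ := by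
      rw [mulVec, dotProduct]
      refine (norm_sum_le _ _).trans (le_of_eq ?_)
      simp only [norm_mul]
    calc _ ≤ (∑ j, ‖A i j‖ * ‖x j‖) ^ 2 := by gcongr; exact h2
      _ ≤ (∑ j, ‖A i j‖ ^ 2) * ∑ j, ‖x j‖ ^ 2 := Finset.sum_mul_sq_le_sq_mul_sq _ _ _
      _ = _ := by rw [EuclideanSpace.norm_sq_eq]
  calc ‖A‖ ^ 2 ≤ √(∑ i, ∑ j, ‖A i j‖ ^ 2) ^ 2 := by gcongr
    _ = _ := Real.sq_sqrt h0

end MatrixBounds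

/-! ### Clustering in the energy basis -/

section Diagonal

open Matrix

variable {n : Type*} [DecidableEq n]

/-- The Hamiltonian with the energies `E` in the standard basis. -/
def diagHam (E : n → ℝ) : Matrix n n ℂ := diagonal fun i => (E i : ℂ)

lemma diagHam_isSelfAdjoint (E : n → ℝ) : IsSelfAdjoint (diagHam E) := by
  rw [IsSelfAdjoint, star_eq_conjTranspose, diagHam, diagonal_conjTranspose]
  congr 1
  funext i
  simp

variable [Fintype n]

lemma evo_diagHam (E : n → ℝ) (t : ℝ) :
    evo (diagHam E) t = diagonal fun i => Complex.exp ((t * E i : ℝ) * Complex.I) := by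
  have h : t • (Complex.I • diagHam E) = diagonal fun i => ((t * E i : ℝ) * Complex.I : ℂ) := by
    rw [diagHam, ← diagonal_smul, ← diagonal_smul]
    congr 1
    funext i
    simp
    ring
  rw [evo, h, Matrix.exp_diagonal]
  congr 1
  funext i
  rw [Complex.exp_eq_exp_ℂ, Pi.coe_exp]

lemma heis_diagHam_apply (E : n → ℝ) (t : ℝ) (A : Matrix n n ℂ) (i j : n) :
    heis (diagHam E) t A i j = Complex.exp ((t * (E i - E j) : ℝ) * Complex.I) * A i j := by
  rw [heis, evo_diagHam, evo_diagHam, mul_diagonal, diagonal_mul, mul_right_comm, ← Complex.exp_add]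
  congr 2
  push_cast
  ring

lemma heis_diagHam_sub_const (E : n → ℝ) (e : ℝ) (t : ℝ) (A : Matrix n n ℂ) :
    heis (diagHam fun i => E i - e) t A = heis (diagHam E) t A := by
  ext i j
  rw [heis_diagHam_apply, heis_diagHam_apply]
  congr 4
  ring

lemma exp_sub_exp_neg (x : ℝ) :
    Complex.exp (x * Complex.I) - Complex.exp (-x * Complex.I) = 2 * Complex.I * Real.sin x := by
  rw [Complex.exp_mul_I, Complex.exp_mul_I, Complex.ofReal_sin, Complex.cos_neg, Complex.sin_neg]
  ring

/-- Taking the part odd in time combines the phases of the two orderings into one sine with the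
symmetrized amplitude, as the filter requires. -/
lemma lie_heis_sub_apply (E : n → ℝ) (t : ℝ) (A B : Matrix n n ℂ) (i : n) :
    (⁅A, heis (diagHam E) t B⁆ - ⁅A, heis (diagHam E) (-t) B⁆) i i =
      2 * Complex.I * ∑ k, (A i k * B k i + B i k * A k i) * Real.sin ((E k - E i) * t) := by
  simp only [Ring.lie_def, Matrix.sub_apply, Matrix.mul_apply, heis_diagHam_apply]
  rw [← Finset.sum_sub_distrib, ← Finset.sum_sub_distrib, ← Finset.sum_sub_distrib, Finset.mul_sum]
  refine Finset.sum_congr rfl fun k _ => ?_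
  have h := exp_sub_exp_neg ((E k - E i) * t)
  have e1 : ((t * (E k - E i) : ℝ) * Complex.I : ℂ) = ((E k - E i) * t : ℝ) * Complex.I := by
    push_cast; ring
  have e2 : ((t * (E i - E k) : ℝ) * Complex.I : ℂ) = -((E k - E i) * t : ℝ) * Complex.I := by
    push_cast; ring
  have e3 : ((-t * (E k - E i) : ℝ) * Complex.I : ℂ) = -((E k - E i) * t : ℝ) * Complex.I := by
    push_cast; ring
  have e4 : ((-t * (E i - E k) : ℝ) * Complex.I : ℂ) = ((E k - E i) * t : ℝ) * Complex.I := by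
    push_cast; ring
  rw [e1, e2, e3, e4]
  linear_combination (A i k * B k i + B i k * A k i) * h

/-- Clustering for the average over a degenerate sector, in the energy basis. -/
theorem diag_average_clustering {E : n → ℝ} {K : Finset n} {ΔE v l N : ℝ} (hΔE : 0 < ΔE)
    (hv : 0 < v) (hl : 0 ≤ l) (hN : 0 ≤ N)
    (hgap : ∀ i ∈ K, ∀ k ∉ K, E i + ΔE ≤ E k) {A B : Matrix n n ℂ} (hAB : Commute A B)
    (hLR : ∀ t, ‖⁅A, heis (diagHam E) t B⁆‖ ≤ N * (Real.exp (-l) * (Real.exp (v * |t|) - 1))) :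
    ‖(K.card : ℂ)⁻¹ * ∑ i ∈ K, ∑ k ∈ Kᶜ, A i k * B k i‖ ≤
      (3 * ‖A‖ * ‖B‖ + N / 2) * Real.exp (-(l / (1 + 2 * v / ΔE))) := by
  rcases K.eq_empty_or_nonempty with rfl | hK
  · simp
    positivity
  have hq : (0 : ℝ) < K.card := by exact_mod_cast hK.card_pos
  have hqc : (K.card : ℂ) ≠ 0 := by exact_mod_cast hq.ne'
  set c : n × n → ℂ := fun p => (K.card : ℂ)⁻¹ * (A p.1 p.2 * B p.2 p.1 + B p.1 p.2 * A p.2 p.1)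
    with hc
  have havg : ∀ f : n → ℝ, ∀ m : ℝ, (∀ i ∈ K, f i ≤ m) → (K.card : ℝ)⁻¹ * ∑ i ∈ K, f i ≤ m := by
    intro f m h
    rw [inv_mul_le_iff₀ hq, ← nsmul_eq_mul]
    exact Finset.sum_le_card_nsmul _ _ _ h
  have hnorm : ‖(K.card : ℂ)⁻¹‖ = (K.card : ℝ)⁻¹ := by simp
  have hM : ∑ p ∈ K ×ˢ Kᶜ, ‖c p‖ ≤ 2 * ‖A‖ * ‖B‖ := by
    rw [Finset.sum_product]
    simp only [hc, norm_mul, hnorm, ← Finset.mul_sum]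
    refine havg _ _ fun i _ => ?_
    calc ∑ k ∈ Kᶜ, ‖A i k * B k i + B i k * A k i‖
        ≤ ∑ k, ‖A i k * B k i + B i k * A k i‖ :=
          Finset.sum_le_sum_of_subset_of_nonneg (Finset.subset_univ _) fun _ _ _ => norm_nonneg _
      _ ≤ ∑ k, (‖A i k‖ * ‖B k i‖ + ‖B i k‖ * ‖A k i‖) := by
          refine Finset.sum_le_sum fun k _ => (norm_add_le _ _).trans ?_
          rw [norm_mul, norm_mul]
      _ ≤ ‖A‖ * ‖B‖ + ‖B‖ * ‖A‖ := by
          rw [Finset.sum_add_distrib]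
          exact add_le_add (sum_norm_row_mul_norm_col_le A B i) (sum_norm_row_mul_norm_col_le B A i)
      _ = _ := by ring
  -- Transitions inside the sector cancel: the amplitude is symmetric in `i` and `k`, the sine
  -- antisymmetric. Hence the average has no error from the width of the sector, and the filter is
  -- used with `δ = 0`.
  have hanti : ∀ t, ∑ i ∈ K, ∑ k ∈ K, (A i k * B k i + B i k * A k i) *
      (Real.sin ((E k - E i) * t) : ℂ) = 0 := by
    intro t
    refine self_eq_neg.mp (Finset.sum_comm.trans ?_)
    rw [← Finset.sum_neg_distrib]
    refine Finset.sum_congr rfl fun i _ => ?_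
    rw [← Finset.sum_neg_distrib]
    refine Finset.sum_congr rfl fun k _ => ?_
    rw [← neg_sub (E k) (E i), neg_mul, Real.sin_neg]
    push_cast
    ring
  have hg : ∀ t, 0 < t → ‖∑ p ∈ K ×ˢ Kᶜ, c p * (Real.sin ((E p.2 - E p.1) * t) : ℂ)‖ ≤
      N * (Real.exp (-l) * (Real.exp (v * t) - 1)) + 0 * t := by
    intro t ht
    have h1 : ∑ p ∈ K ×ˢ Kᶜ, c p * (Real.sin ((E p.2 - E p.1) * t) : ℂ) =
        (K.card : ℂ)⁻¹ * ∑ i ∈ K, ∑ k, (A i k * B k i + B i k * A k i) *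
          (Real.sin ((E k - E i) * t) : ℂ) := by
      have h2 : ∀ i, ∑ k, (A i k * B k i + B i k * A k i) * (Real.sin ((E k - E i) * t) : ℂ) =
          (∑ k ∈ K, (A i k * B k i + B i k * A k i) * (Real.sin ((E k - E i) * t) : ℂ)) +
          ∑ k ∈ Kᶜ, (A i k * B k i + B i k * A k i) * (Real.sin ((E k - E i) * t) : ℂ) :=
        fun i => (Finset.sum_add_sum_compl K _).symm
      simp only [h2]
      rw [Finset.sum_add_distrib, hanti, zero_add, Finset.sum_product]
      simp only [hc, Finset.mul_sum, mul_assoc]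
    rw [h1, norm_mul, hnorm]
    refine (mul_le_mul_of_nonneg_left (norm_sum_le _ _) (by positivity)).trans ?_
    refine havg _ _ fun i _ => ?_
    have h3 := congrArg norm (lie_heis_sub_apply E t A B i)
    rw [norm_mul, norm_mul, Complex.norm_I, Complex.norm_ofNat] at h3
    have h4 : ‖(⁅A, heis (diagHam E) t B⁆ - ⁅A, heis (diagHam E) (-t) B⁆) i i‖ ≤
        2 * (N * (Real.exp (-l) * (Real.exp (v * t) - 1))) := by
      refine (norm_apply_le _ _ _).trans ((norm_sub_le _ _).trans ?_)
      have h5 := hLR t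
      have h6 := hLR (-t)
      rw [abs_neg] at h6
      rw [abs_of_pos ht] at h5 h6
      linarith
    rw [h3] at h4
    linarith
  have hmain := norm_sum_le_of_filter (K ×ˢ Kᶜ) c (fun p => E p.2 - E p.1) hΔE hv hl le_rfl hN
    (fun p hp => by
      obtain ⟨h1, h2⟩ := Finset.mem_product.mp hp
      have := hgap p.1 h1 p.2 (Finset.mem_compl.mp h2)
      linarith) hM hg
  -- Both full traces over the sector agree as `A` and `B` commute, and both parts within the sector
  -- agree by symmetry; so the filtered sum is twice the desired one.
  have hsym : ∑ i ∈ K, ∑ k ∈ Kᶜ, B i k * A k i = ∑ i ∈ K, ∑ k ∈ Kᶜ, A i k * B k i := by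
    have h1 : ∀ i, ∑ k, A i k * B k i = ∑ k, B i k * A k i := by
      intro i
      have := congrFun (congrFun hAB.eq i) i
      simpa [Matrix.mul_apply] using this
    have h2 : ∑ i ∈ K, ∑ k ∈ K, B i k * A k i = ∑ i ∈ K, ∑ k ∈ K, A i k * B k i := by
      rw [Finset.sum_comm]
      exact Finset.sum_congr rfl fun i _ => Finset.sum_congr rfl fun k _ => mul_comm _ _
    have h3 : ∑ i ∈ K, ∑ k, A i k * B k i = ∑ i ∈ K, ∑ k, B i k * A k i :=
      Finset.sum_congr rfl fun i _ => h1 i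
    have h4 : ∀ C D : Matrix n n ℂ, ∑ i ∈ K, ∑ k, C i k * D k i =
        ∑ i ∈ K, ∑ k ∈ K, C i k * D k i + ∑ i ∈ K, ∑ k ∈ Kᶜ, C i k * D k i := by
      intro C D
      rw [← Finset.sum_add_distrib]
      exact Finset.sum_congr rfl fun i _ => (Finset.sum_add_sum_compl K _).symm
    rw [h4, h4, h2] at h3
    exact (add_left_cancel h3).symm
  have hsumc : ∑ p ∈ K ×ˢ Kᶜ, c p = 2 * ((K.card : ℂ)⁻¹ * ∑ i ∈ K, ∑ k ∈ Kᶜ, A i k * B k i) := by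
    rw [Finset.sum_product]
    simp only [hc, ← Finset.mul_sum, Finset.sum_add_distrib, hsym]
    ring
  rw [hsumc, norm_mul, Complex.norm_ofNat] at hmain
  linarith

lemma star_dotProduct_mul_diagonal_mul_mulVec (A B : Matrix n n ℂ) (w x : n → ℂ) :
    star x ⬝ᵥ (A * diagonal w * B) *ᵥ x = ∑ k, (star x ᵥ* A) k * (B *ᵥ x) k * w k := by
  rw [← mulVec_mulVec, ← mulVec_mulVec, dotProduct_mulVec, dotProduct]
  refine Finset.sum_congr rfl fun k _ => ?_
  rw [mulVec_diagonal]
  ring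

/-- Clustering in a vector of a quasi-degenerate sector, in the energy basis. -/
theorem diag_vector_clustering {E : n → ℝ} {K : Finset n} {ΔE v l N δ : ℝ} (hΔE : 0 < ΔE)
    (hv : 0 < v) (hl : 0 ≤ l) (hN : 0 ≤ N)
    (hgap : ∀ i ∈ K, ∀ k ∉ K, E i + ΔE ≤ E k) (hδ : ∀ i ∈ K, ∀ k ∈ K, |E i - E k| ≤ δ)
    {A B : Matrix n n ℂ} (hAB : Commute A B)
    (hLR : ∀ t, ‖⁅A, heis (diagHam E) t B⁆‖ ≤ N * (Real.exp (-l) * (Real.exp (v * |t|) - 1)))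
    {x : n → ℂ} (hx : ∀ i ∉ K, x i = 0) (hx1 : ‖WithLp.toLp 2 x‖ = 1)
    {P : Matrix n n ℂ} (hP : P = diagonal fun i => if i ∈ K then 1 else 0) :
    ‖star x ⬝ᵥ (A * B) *ᵥ x‖ ≤
      (3 * ‖A‖ * ‖B‖ + N / 2) * Real.exp (-(l / (1 + 2 * v / ΔE))) +
        ‖P * A * P‖ * ‖B‖ + 2 * ‖A‖ * ‖B‖ * δ * (l / (v + ΔE / 2)) := by
  obtain ⟨i₀, hi₀⟩ : K.Nonempty := by
    rw [Finset.nonempty_iff_ne_empty]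
    rintro rfl
    have : x = 0 := funext fun i => hx i (Finset.notMem_empty i)
    rw [this] at hx1
    simp at hx1
  have hδ0 : 0 ≤ δ := (abs_nonneg _).trans (hδ i₀ hi₀ i₀ hi₀)
  -- Measuring energies from a level of the sector leaves the Heisenberg evolution unchanged and
  -- makes the evolution inside the sector nearly trivial, with error at most `|t| * δ`.
  set E' : n → ℝ := fun i => E i - E i₀ with hE'
  set u : ℝ → Matrix n n ℂ := evo (diagHam E') with hu
  have hu1 : ∀ t, u t = diagonal fun i => Complex.exp ((t * E' i : ℝ) * Complex.I) := evo_diagHam E'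
  have hnu : ∀ t (C : Matrix n n ℂ), ‖u t * C‖ = ‖C‖ := norm_evo_mul (diagHam_isSelfAdjoint E')
  have hP1 : ‖P‖ ≤ 1 := by
    rw [hP, l2_opNorm_diagonal, pi_norm_le_iff_of_nonneg zero_le_one]
    intro i
    split_ifs <;> simp
  have hPP : P * P = P := by
    rw [hP, diagonal_mul_diagonal]
    congr 1
    funext i
    split_ifs <;> simp
  have hPx : P *ᵥ x = x := by
    funext i
    rw [hP, mulVec_diagonal]
    by_cases hi : i ∈ K
    · simp [hi]
    · simp [hi, hx i hi]
  have hxP : star x ᵥ* P = star x := by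
    funext i
    rw [hP, vecMul_diagonal]
    by_cases hi : i ∈ K
    · simp [hi]
    · simp [hi, hx i hi]
  have hcomp : ∀ C, ‖star x ⬝ᵥ C *ᵥ x‖ ≤ ‖P * C * P‖ := by
    intro C
    have h1 : star x ⬝ᵥ C *ᵥ x = star x ⬝ᵥ (P * C * P) *ᵥ x := by
      rw [← mulVec_mulVec, ← mulVec_mulVec, hPx, dotProduct_mulVec (star x) P, hxP]
    rw [h1]
    refine (norm_star_dotProduct_mulVec_le _ _ _).trans ?_
    rw [hx1]
    simp
  have hphase : ∀ t, ∀ i ∈ K, ‖Complex.exp ((t * E' i : ℝ) * Complex.I) - 1‖ ≤ |t| * δ := by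
    intro t i hi
    rw [mul_comm]
    refine (Real.norm_exp_I_mul_ofReal_sub_one_le).trans ?_
    rw [Real.norm_eq_abs, abs_mul]
    exact mul_le_mul_of_nonneg_left (hδ i hi i₀ hi₀) (abs_nonneg t)
  have hR : ∀ t, ‖(u t - 1) * P‖ ≤ |t| * δ := by
    intro t
    rw [hu1, hP, ← diagonal_one, diagonal_sub, diagonal_mul_diagonal, l2_opNorm_diagonal,
      pi_norm_le_iff_of_nonneg (by positivity)]
    intro i
    by_cases hi : i ∈ K
    · simpa [hi] using hphase t i hi
    · simp [hi]
      positivity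
  have hcP : ∀ t, P * (u t - 1) = (u t - 1) * P := by
    intro t
    rw [hu1, hP, ← diagonal_one, diagonal_sub, diagonal_mul_diagonal, diagonal_mul_diagonal]
    congr 1
    funext i
    ring
  have hPC : ∀ C, ‖P * C‖ ≤ ‖C‖ := fun C =>
    (norm_mul_le _ _).trans (mul_le_of_le_one_left (norm_nonneg _) hP1)
  have hCP : ∀ C, ‖C * P‖ ≤ ‖C‖ := fun C =>
    (norm_mul_le _ _).trans (mul_le_of_le_one_right (norm_nonneg _) hP1)
  set c : n → ℂ := fun k => (star x ᵥ* A) k * (B *ᵥ x) k + (star x ᵥ* B) k * (A *ᵥ x) k with hc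
  have hM : ∑ k ∈ Kᶜ, ‖c k‖ ≤ 2 * ‖A‖ * ‖B‖ := by
    calc ∑ k ∈ Kᶜ, ‖c k‖ ≤ ∑ k, ‖c k‖ :=
          Finset.sum_le_sum_of_subset_of_nonneg (Finset.subset_univ _) fun _ _ _ => norm_nonneg _
      _ ≤ ∑ k, (‖(star x ᵥ* A) k‖ * ‖(B *ᵥ x) k‖ + ‖(star x ᵥ* B) k‖ * ‖(A *ᵥ x) k‖) := by
          refine Finset.sum_le_sum fun k _ => (norm_add_le _ _).trans ?_
          rw [norm_mul, norm_mul]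
      _ ≤ 2 * ‖A‖ * ‖B‖ := by
          rw [Finset.sum_add_distrib]
          have h1 := sum_norm_vecMul_mul_norm_mulVec_le A B x x
          have h2 := sum_norm_vecMul_mul_norm_mulVec_le B A x x
          rw [hx1] at h1 h2
          linarith
  have hcW : ∀ w : n → ℂ, ∑ k, c k * w k =
      star x ⬝ᵥ (A * diagonal w * B + B * diagonal w * A) *ᵥ x := by
    intro w
    rw [add_mulVec, dotProduct_add, star_dotProduct_mul_diagonal_mul_mulVec,
      star_dotProduct_mul_diagonal_mul_mulVec, ← Finset.sum_add_distrib]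
    exact Finset.sum_congr rfl fun k _ => by rw [hc]; ring
  have hcK : ∀ w : n → ℂ, ∑ k ∈ Kᶜ, c k * w k =
      star x ⬝ᵥ (A * diagonal w * B + B * diagonal w * A) *ᵥ x -
      star x ⬝ᵥ (A * (diagonal w * P) * B + B * (diagonal w * P) * A) *ᵥ x := by
    intro w
    have h1 : diagonal w * P = diagonal fun k => w k * if k ∈ K then 1 else 0 := by
      rw [hP, diagonal_mul_diagonal]
    rw [h1, ← hcW, ← hcW, ← Finset.sum_sub_distrib]
    symm
    rw [← Finset.sum_add_sum_compl K, Finset.sum_eq_zero, zero_add]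
    · refine Finset.sum_congr rfl fun k hk => ?_
      rw [if_neg (Finset.mem_compl.mp hk)]
      ring
    · intro k hk
      rw [if_pos hk]
      ring
  have hg : ∀ t, 0 < t → ‖∑ k ∈ Kᶜ, c k * (Real.sin (E' k * t) : ℂ)‖ ≤
      N * (Real.exp (-l) * (Real.exp (v * t) - 1)) + 4 * ‖A‖ * ‖B‖ * δ * t := by
    intro t ht
    have hsin : diagonal (fun k => 2 * Complex.I * (Real.sin (E' k * t) : ℂ)) = u t - u (-t) := by
      rw [hu1, hu1, diagonal_sub]
      congr 1
      funext k
      rw [← exp_sub_exp_neg]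
      congr 3
      · push_cast; ring
      · push_cast; ring
    have h2i : 2 * Complex.I * ∑ k ∈ Kᶜ, c k * (Real.sin (E' k * t) : ℂ) =
        ∑ k ∈ Kᶜ, c k * (2 * Complex.I * (Real.sin (E' k * t) : ℂ)) := by
      rw [Finset.mul_sum]
      exact Finset.sum_congr rfl fun k _ => by ring
    -- Exact identity: the odd part of the commutator, less the phases acquired by `x` itself, less
    -- the intermediate states inside the sector. The two corrections are of order `δ * t`.
    have hops : 2 * Complex.I * ∑ k ∈ Kᶜ, c k * (Real.sin (E' k * t) : ℂ) =
        star x ⬝ᵥ (⁅A, heis (diagHam E) t B⁆ - ⁅A, heis (diagHam E) (-t) B⁆) *ᵥ x -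
        star x ⬝ᵥ (A * u t * B * (u (-t) - 1) - A * u (-t) * B * (u t - 1) -
          (u t - 1) * (B * u (-t) * A) + (u (-t) - 1) * (B * u t * A)) *ᵥ x -
        star x ⬝ᵥ (A * ((u t - 1) * P - (u (-t) - 1) * P) * B +
          B * ((u t - 1) * P - (u (-t) - 1) * P) * A) *ᵥ x := by
      rw [h2i, hcK, hsin, ← heis_diagHam_sub_const E (E i₀), ← heis_diagHam_sub_const E (E i₀)]
      rw [← dotProduct_sub, ← sub_mulVec, ← dotProduct_sub, ← sub_mulVec, ← dotProduct_sub,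
        ← sub_mulVec]
      congr 2
      simp only [heis, Ring.lie_def, neg_neg]
      change _ = A * (u t * B * u (-t)) - u t * B * u (-t) * A -
        (A * (u (-t) * B * u t) - u (-t) * B * u t * A) - _ - _
      noncomm_ring
    have e1 : ‖star x ⬝ᵥ (⁅A, heis (diagHam E) t B⁆ - ⁅A, heis (diagHam E) (-t) B⁆) *ᵥ x‖ ≤
        2 * (N * (Real.exp (-l) * (Real.exp (v * t) - 1))) := by
      refine (norm_star_dotProduct_mulVec_le _ _ _).trans ?_
      rw [hx1, mul_one, mul_one]
      refine (norm_sub_le _ _).trans ?_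
      have h5 := hLR t
      have h6 := hLR (-t)
      rw [abs_neg] at h6
      rw [abs_of_pos ht] at h5 h6
      linarith
    have hR1 : ∀ s, |s| = t → ‖(u s - 1) * P‖ ≤ t * δ := fun s hs => hs ▸ hR s
    have ht1 : |t| = t := abs_of_pos ht
    have ht2 : |-t| = t := by rw [abs_neg, ht1]
    have hABu : ∀ C D : Matrix n n ℂ, ∀ s, ‖C * u s * D‖ ≤ ‖C‖ * ‖D‖ := by
      intro C D s
      rw [mul_assoc]
      refine (norm_mul_le _ _).trans ?_
      rw [hnu]
    have e2 : ‖star x ⬝ᵥ (A * u t * B * (u (-t) - 1) - A * u (-t) * B * (u t - 1) -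
          (u t - 1) * (B * u (-t) * A) + (u (-t) - 1) * (B * u t * A)) *ᵥ x‖ ≤
          4 * ‖A‖ * ‖B‖ * δ * t := by
      refine (hcomp _).trans ?_
      have h1 : ∀ r s, |s| = t → ‖P * (A * u r * B * ((u s - 1) * P))‖ ≤ ‖A‖ * ‖B‖ * (t * δ) := by
        intro r s hs
        refine (hPC _).trans ((norm_mul_le _ _).trans ?_)
        exact mul_le_mul (hABu A B r) (hR1 s hs) (norm_nonneg _) (by positivity)
      have h2 : ∀ r s, |s| = t → ‖((u s - 1) * P) * (B * u r * A) * P‖ ≤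
          ‖A‖ * ‖B‖ * (t * δ) := by
        intro r s hs
        refine (hCP _).trans ((norm_mul_le _ _).trans ?_)
        rw [mul_comm (‖A‖ * ‖B‖), mul_comm ‖A‖]
        exact mul_le_mul (hR1 s hs) (hABu B A r) (norm_nonneg _) (by positivity)
      have h3 : P * (A * u t * B * (u (-t) - 1) - A * u (-t) * B * (u t - 1) -
          (u t - 1) * (B * u (-t) * A) + (u (-t) - 1) * (B * u t * A)) * P =
          P * (A * u t * B * ((u (-t) - 1) * P)) - P * (A * u (-t) * B * ((u t - 1) * P)) -
          ((u t - 1) * P) * (B * u (-t) * A) * P + ((u (-t) - 1) * P) * (B * u t * A) * P := by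
        calc _ = P * (A * u t * B * ((u (-t) - 1) * P)) - P * (A * u (-t) * B * ((u t - 1) * P)) -
              (P * (u t - 1)) * (B * u (-t) * A) * P + (P * (u (-t) - 1)) * (B * u t * A) * P := by
              noncomm_ring
          _ = _ := by rw [hcP, hcP]
      rw [h3]
      refine (norm_add_le _ _).trans ?_
      have h4 := norm_sub_le (P * (A * u t * B * ((u (-t) - 1) * P)) -
        P * (A * u (-t) * B * ((u t - 1) * P))) (((u t - 1) * P) * (B * u (-t) * A) * P)
      have h5 := norm_sub_le (P * (A * u t * B * ((u (-t) - 1) * P)))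
        (P * (A * u (-t) * B * ((u t - 1) * P)))
      linarith [h1 t (-t) ht2, h1 (-t) t ht1, h2 (-t) t ht1, h2 t (-t) ht2]
    have e3 : ‖star x ⬝ᵥ (A * ((u t - 1) * P - (u (-t) - 1) * P) * B +
          B * ((u t - 1) * P - (u (-t) - 1) * P) * A) *ᵥ x‖ ≤ 4 * ‖A‖ * ‖B‖ * δ * t := by
      refine (norm_star_dotProduct_mulVec_le _ _ _).trans ?_
      rw [hx1, mul_one, mul_one]
      have h1 : ‖(u t - 1) * P - (u (-t) - 1) * P‖ ≤ 2 * (t * δ) := by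
        refine (norm_sub_le _ _).trans ?_
        linarith [hR1 t ht1, hR1 (-t) ht2]
      have h2 : ∀ C D F : Matrix n n ℂ, ‖C * F * D‖ ≤ ‖C‖ * ‖F‖ * ‖D‖ := fun C D F =>
        (norm_mul_le _ _).trans (mul_le_mul_of_nonneg_right (norm_mul_le _ _) (norm_nonneg _))
      calc _ ≤ ‖A‖ * ‖(u t - 1) * P - (u (-t) - 1) * P‖ * ‖B‖ +
            ‖B‖ * ‖(u t - 1) * P - (u (-t) - 1) * P‖ * ‖A‖ :=
            (norm_add_le _ _).trans (add_le_add (h2 _ _ _) (h2 _ _ _))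
        _ ≤ ‖A‖ * (2 * (t * δ)) * ‖B‖ + ‖B‖ * (2 * (t * δ)) * ‖A‖ := by gcongr
        _ = _ := by ring
    have hn := congrArg norm hops
    rw [norm_mul, norm_mul, Complex.norm_I, Complex.norm_ofNat] at hn
    have h4 := norm_sub_le (star x ⬝ᵥ (⁅A, heis (diagHam E) t B⁆ -
        ⁅A, heis (diagHam E) (-t) B⁆) *ᵥ x -
        star x ⬝ᵥ (A * u t * B * (u (-t) - 1) - A * u (-t) * B * (u t - 1) -
          (u t - 1) * (B * u (-t) * A) + (u (-t) - 1) * (B * u t * A)) *ᵥ x)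
        (star x ⬝ᵥ (A * ((u t - 1) * P - (u (-t) - 1) * P) * B +
          B * ((u t - 1) * P - (u (-t) - 1) * P) * A) *ᵥ x)
    have h5 := norm_sub_le (star x ⬝ᵥ (⁅A, heis (diagHam E) t B⁆ -
        ⁅A, heis (diagHam E) (-t) B⁆) *ᵥ x)
        (star x ⬝ᵥ (A * u t * B * (u (-t) - 1) - A * u (-t) * B * (u t - 1) -
          (u t - 1) * (B * u (-t) * A) + (u (-t) - 1) * (B * u t * A)) *ᵥ x)
    linarith
  have hmain := norm_sum_le_of_filter Kᶜ c E' hΔE hv hl (δ := 4 * ‖A‖ * ‖B‖ * δ) (by positivity) hN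
    (fun k hk => by
      have := hgap i₀ hi₀ k (Finset.mem_compl.mp hk)
      simp only [hE']
      linarith) hM hg
  have hone := hcK fun _ => 1
  simp only [mul_one, diagonal_one, one_mul] at hone
  have hBA : B * A = A * B := hAB.eq.symm
  -- Commutativity symmetrizes the correlation; the excited states give the filtered sum, and the
  -- sector part is controlled by the block `P * A * P`.
  have h2AB : 2 * (star x ⬝ᵥ (A * B) *ᵥ x) =
      ∑ k ∈ Kᶜ, c k + star x ⬝ᵥ (A * P * B + B * P * A) *ᵥ x := by
    rw [hone, hBA, add_mulVec, dotProduct_add]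
    ring
  have hAPB : ‖star x ⬝ᵥ (A * P * B + B * P * A) *ᵥ x‖ ≤ 2 * (‖P * A * P‖ * ‖B‖) := by
    refine (hcomp _).trans ?_
    have h1 : P * (A * P * B + B * P * A) * P =
        (P * A * P) * (B * P) + (P * B) * (P * A * P) := by
      have h2 : P * A * P * B * P = P * A * P * (B * P) := by noncomm_ring
      calc _ = P * A * P * B * P + P * B * P * A * P := by noncomm_ring
        _ = _ := by noncomm_ring
    rw [h1]
    refine (norm_add_le _ _).trans ?_
    have h3 := (norm_mul_le (P * A * P) (B * P)).trans
      (mul_le_mul_of_nonneg_left (hCP B) (norm_nonneg _))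
    have h4 := (norm_mul_le (P * B) (P * A * P)).trans
      (mul_le_mul_of_nonneg_right (hPC B) (norm_nonneg _))
    linarith
  have hn := congrArg norm h2AB
  rw [norm_mul, Complex.norm_ofNat] at hn
  have h6 := norm_add_le (∑ k ∈ Kᶜ, c k) (star x ⬝ᵥ (A * P * B + B * P * A) *ᵥ x)
  linarith

end Diagonal

/-! ### Transfer to a general Hamiltonian and its spectral projection -/

section EnergyBasis

open Matrix

lemma map_evo {𝔄 𝔅 : Type*} [CStarAlgebra 𝔄] [CStarAlgebra 𝔅] (φ : 𝔄 ≃⋆ₐ[ℂ] 𝔅) (H : 𝔄) (t : ℝ) :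
    φ (evo H t) = evo (φ H) t := by
  let _ : NormedAlgebra ℚ 𝔄 := NormedAlgebra.restrictScalars ℚ ℂ 𝔄
  let _ : NormedAlgebra ℚ 𝔅 := NormedAlgebra.restrictScalars ℚ ℂ 𝔅
  have hc : Continuous φ := (StarAlgEquiv.isometry φ).continuous
  rw [evo, NormedSpace.map_exp φ hc]
  congr 1
  rw [← Complex.coe_smul, map_smul, map_smul, Complex.coe_smul]

lemma map_heis {𝔄 𝔅 : Type*} [CStarAlgebra 𝔄] [CStarAlgebra 𝔅] (φ : 𝔄 ≃⋆ₐ[ℂ] 𝔅) (H : 𝔄) (t : ℝ)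
    (A : 𝔄) : φ (heis H t A) = heis (φ H) t (φ A) := by
  rw [heis, map_mul, map_mul, map_evo, map_evo, heis]

/-- An automorphism of the real algebra that fixes `p` and respects the adjoint of `a` preserves
the norm of `p a p`. -/
lemma norm_compression_eq {𝔄 : Type*} [CStarAlgebra 𝔄] (R : 𝔄 ≃ₐ[ℝ] 𝔄) {a p : 𝔄}
    (hp : IsSelfAdjoint p) (hRp : R p = p) (hRa : R (star a) = star (R a)) :
    ‖p * R a * p‖ = ‖p * a * p‖ := by
  have key : R (star (p * a * p) * (p * a * p)) = star (p * R a * p) * (p * R a * p) := by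
    simp only [star_mul, hp.star_eq, map_mul, hRp, hRa]
  -- `R` need be neither complex linear nor a star map, but it preserves real spectra, and the real
  -- spectral radius of `x† x` determines the norm of `x`.
  have h1 : ∀ x : 𝔄, (spectralRadius ℝ (star x * x)).toReal = ‖x‖ ^ 2 := by
    intro x
    rw [(IsSelfAdjoint.star_mul_self x).toReal_spectralRadius_eq_norm, CStarRing.norm_star_mul_self,
      sq]
  have h2 := h1 (p * R a * p)
  rw [← key, spectralRadius, AlgEquiv.spectrum_eq, ← spectralRadius, h1] at h2
  exact ((sq_eq_sq₀ (norm_nonneg _) (norm_nonneg _)).mp h2).symm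

variable {n : Type*} [Fintype n] [DecidableEq n] {H : Matrix n n ℂ}

/-- On the finite spectrum `f` is interpolated by a polynomial with real coefficients, which
antilinear automorphisms respect as well. -/
lemma map_cfc_of_map_eq (hH : H.IsHermitian) (R : Matrix n n ℂ ≃ₐ[ℝ] Matrix n n ℂ) (hR : R H = H)
    (f : ℝ → ℝ) : R (cfc f H) = cfc f H := by
  have hfin : (spectrum ℝ H).Finite := by
    rw [hH.spectrum_real_eq_range_eigenvalues]
    exact Set.finite_range _
  set p := Lagrange.interpolate hfin.toFinset id f with hp
  have h1 : cfc f H = Polynomial.aeval H p := by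
    rw [← cfc_polynomial p H hH.isSelfAdjoint]
    refine cfc_congr fun x hx => ?_
    exact (Lagrange.eval_interpolate_at_node f (Set.injOn_id _) (hfin.mem_toFinset.mpr hx)).symm
  rw [h1, ← Polynomial.aeval_algHom_apply, hR]

/-- The representation of the operators as matrices in a basis of eigenvectors of `H`. -/
def energyRep (hH : H.IsHermitian) : Matrix n n ℂ ≃⋆ₐ[ℂ] Matrix n n ℂ :=
  (Unitary.conjStarAlgAut ℂ (Matrix n n ℂ) hH.eigenvectorUnitary).symm

lemma energyRep_apply (hH : H.IsHermitian) (A : Matrix n n ℂ) : energyRep hH A =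
    (star hH.eigenvectorUnitary : Matrix n n ℂ) * A * (hH.eigenvectorUnitary : Matrix n n ℂ) :=
  Unitary.conjStarAlgAut_symm_apply _ _

lemma energyRep_self (hH : H.IsHermitian) : energyRep hH H = diagHam hH.eigenvalues := by
  exact (congrArg (energyRep hH) hH.spectral_theorem).trans (StarAlgEquiv.symm_apply_apply _ _)

/-- The eigenvectors of `H` with energies in `S`. -/
def sector (hH : H.IsHermitian) (S : Set ℝ) : Finset n :=
  open Classical in Finset.univ.filter fun i => hH.eigenvalues i ∈ S

lemma mem_sector {hH : H.IsHermitian} {S : Set ℝ} {i : n} :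
    i ∈ sector hH S ↔ hH.eigenvalues i ∈ S := by
  simp [sector]

/-- The spectral projection. -/
def specProj (S : Set ℝ) (H : Matrix n n ℂ) : Matrix n n ℂ := cfc (S.indicator (1 : ℝ → ℝ)) H

lemma energyRep_specProj (hH : H.IsHermitian) (S : Set ℝ) :
    energyRep hH (specProj S H) = diagonal fun i => if i ∈ sector hH S then 1 else 0 := by
  rw [specProj, hH.cfc_eq, Matrix.IsHermitian.cfc, energyRep, StarAlgEquiv.symm_apply_apply]
  congr 1
  funext i
  by_cases h : hH.eigenvalues i ∈ S <;> simp [mem_sector, h]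

lemma rank_specProj (hH : H.IsHermitian) (S : Set ℝ) :
    (specProj S H).rank = (sector hH S).card := by
  have hU : IsUnit (hH.eigenvectorUnitary : Matrix n n ℂ).det :=
    (Matrix.isUnit_iff_isUnit_det _).mp (Unitary.toUnits hH.eigenvectorUnitary).isUnit
  have hU' : IsUnit (star hH.eigenvectorUnitary : Matrix n n ℂ).det :=
    (Matrix.isUnit_iff_isUnit_det _).mp (Unitary.toUnits (star hH.eigenvectorUnitary)).isUnit
  have h1 := energyRep_apply hH (specProj S H)
  rw [energyRep_specProj] at h1
  have h2 := congrArg Matrix.rank h1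
  rw [rank_mul_eq_left_of_isUnit_det _ _ hU, rank_mul_eq_right_of_isUnit_det _ _ hU'] at h2
  rw [← h2, rank_diagonal, Fintype.card_subtype]
  congr 1
  ext i
  simp

lemma isSelfAdjoint_specProj (S : Set ℝ) (H : Matrix n n ℂ) : IsSelfAdjoint (specProj S H) :=
  cfc_predicate _ _

lemma trace_energyRep (hH : H.IsHermitian) (A : Matrix n n ℂ) :
    (energyRep hH A).trace = A.trace := by
  rw [energyRep_apply, Matrix.trace_mul_cycle]
  have : (hH.eigenvectorUnitary : Matrix n n ℂ) * star (hH.eigenvectorUnitary : Matrix n n ℂ) = 1 :=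
    Unitary.mul_star_self_of_mem hH.eigenvectorUnitary.2
  rw [this, one_mul]

lemma norm_energyRep (hH : H.IsHermitian) (A : Matrix n n ℂ) : ‖energyRep hH A‖ = ‖A‖ :=
  StarAlgEquiv.norm_map _ _

lemma norm_lie_heis_energyRep (hH : H.IsHermitian) (A B : Matrix n n ℂ) (t : ℝ) :
    ‖⁅energyRep hH A, heis (diagHam hH.eigenvalues) t (energyRep hH B)⁆‖ = ‖⁅A, heis H t B⁆‖ := by
  rw [← norm_energyRep hH ⁅A, heis H t B⁆, Ring.lie_def, Ring.lie_def, map_sub, map_mul, map_mul,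
    map_heis, energyRep_self]

/-- `S` is separated by a gap `ΔE` from the part of the spectrum of `H` above it. -/
def HasGap (S : Set ℝ) (H : Matrix n n ℂ) (ΔE : ℝ) : Prop :=
  ∀ E ∈ S, ∀ E' ∈ spectrum ℝ H \ S, E + ΔE < E'

lemma HasGap.eigenvalues_le {S : Set ℝ} {ΔE : ℝ} (h : HasGap S H ΔE) (hH : H.IsHermitian) :
    ∀ i ∈ sector hH S, ∀ k ∉ sector hH S, hH.eigenvalues i + ΔE ≤ hH.eigenvalues k := by
  intro i hi k hk
  rw [mem_sector] at hi hk
  refine (h _ hi _ ⟨?_, hk⟩).le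
  rw [hH.spectrum_real_eq_range_eigenvalues]
  exact Set.mem_range_self k

lemma trace_mul_diagonal_mul_diagonal (K : Finset n) (A B : Matrix n n ℂ) (w : n → ℂ) :
    (A * diagonal w * B * diagonal fun i => if i ∈ K then 1 else 0).trace =
      ∑ i ∈ K, ∑ k, A i k * w k * B k i := by
  rw [Matrix.trace, ← Finset.sum_filter_add_sum_filter_not _ (fun i => i ∈ K)]
  rw [Finset.sum_eq_zero (s := Finset.univ.filter fun i => i ∉ K), add_zero]
  · simp only [Finset.filter_univ_mem]
    refine Finset.sum_congr rfl fun i hi => ?_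
    rw [diag_apply, mul_diagonal, if_pos hi, mul_one, Matrix.mul_apply]
    exact Finset.sum_congr rfl fun k _ => by rw [mul_diagonal]
  · intro i hi
    rw [diag_apply, mul_diagonal, if_neg (by simpa using hi), mul_zero]

/-- Clustering for the average over the sector, for operators with a Lieb–Robinson bound. -/
theorem average_clustering (hH : H.IsHermitian) {S : Set ℝ} {ΔE v l N : ℝ} (hΔE : 0 < ΔE)
    (hv : 0 < v) (hl : 0 ≤ l) (hN : 0 ≤ N) (hgap : HasGap S H ΔE) {A B : Matrix n n ℂ}
    (hAB : Commute A B)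
    (hLR : ∀ t, ‖⁅A, heis H t B⁆‖ ≤ N * (Real.exp (-l) * (Real.exp (v * |t|) - 1))) :
    ‖((specProj S H).rank : ℂ)⁻¹ * (A * (1 - specProj S H) * B * specProj S H).trace‖ ≤
      (3 * ‖A‖ * ‖B‖ + N / 2) * Real.exp (-(l / (1 + 2 * v / ΔE))) := by
  have h := diag_average_clustering hΔE hv hl hN (hgap.eigenvalues_le hH)
    (hAB.map (energyRep hH)) (fun t => by rw [norm_lie_heis_energyRep]; exact hLR t)
  rw [norm_energyRep, norm_energyRep] at h
  convert h using 3
  · rw [rank_specProj hH]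
  · rw [← trace_energyRep hH]
    simp only [map_mul, map_sub, map_one, energyRep_specProj]
    rw [← diagonal_one, diagonal_sub, trace_mul_diagonal_mul_diagonal]
    refine Finset.sum_congr rfl fun i _ => ?_
    rw [← Finset.sum_add_sum_compl (sector hH S), Finset.sum_eq_zero, zero_add]
    · refine Finset.sum_congr rfl fun k hk => ?_
      rw [if_neg (Finset.mem_compl.mp hk)]
      ring
    · intro k hk
      rw [if_pos hk]
      ring

lemma norm_one_sub_specProj_le (hH : H.IsHermitian) (S : Set ℝ) : ‖1 - specProj S H‖ ≤ 1 := by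
  rw [← norm_energyRep hH, map_sub, map_one, energyRep_specProj, ← diagonal_one, diagonal_sub,
    l2_opNorm_diagonal, pi_norm_le_iff_of_nonneg zero_le_one]
  intro i
  split_ifs <;> simp

/-- The trivial bound, needed for overlapping supports, where no commutation is assumed and the
profile equals `1`. -/
lemma norm_average_le (hH : H.IsHermitian) (S : Set ℝ) (A B : Matrix n n ℂ) :
    ‖((specProj S H).rank : ℂ)⁻¹ * (A * (1 - specProj S H) * B * specProj S H).trace‖ ≤
      ‖A‖ * ‖B‖ := by
  set C := A * (1 - specProj S H) * B with hC
  have h1 : ‖C‖ ≤ ‖A‖ * ‖B‖ := by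
    refine (norm_mul_le _ _).trans (mul_le_mul_of_nonneg_right ?_ (norm_nonneg _))
    exact (norm_mul_le _ _).trans
      (mul_le_of_le_one_right (norm_nonneg _) (norm_one_sub_specProj_le hH S))
  refine le_trans ?_ h1
  rw [rank_specProj hH, ← trace_energyRep hH, map_mul, energyRep_specProj, norm_mul, norm_inv,
    Complex.norm_natCast]
  have h2 := trace_mul_diagonal_mul_diagonal (sector hH S) (energyRep hH C) 1 fun _ => 1
  rw [diagonal_one, mul_one, mul_one] at h2
  rw [h2]
  refine inv_mul_le_of_le_mul₀ (by positivity) (norm_nonneg _) ?_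
  refine (norm_sum_le _ _).trans ?_
  rw [← nsmul_eq_mul]
  refine Finset.sum_le_card_nsmul _ _ _ fun i _ => ?_
  rw [Finset.sum_eq_single i]
  · rw [one_apply_eq, mul_one, mul_one, ← norm_energyRep hH C]
    exact norm_apply_le _ _ _
  · intro k _ hk
    rw [one_apply_ne hk, mul_zero]
  · simp

/-- Clustering in a vector of the sector, for operators with a Lieb–Robinson bound. -/
theorem vector_clustering (hH : H.IsHermitian) {S : Set ℝ} {ΔE v l N δ : ℝ} (hΔE : 0 < ΔE)
    (hv : 0 < v) (hl : 0 ≤ l) (hN : 0 ≤ N) (hgap : HasGap S H ΔE)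
    (hδ : ∀ E ∈ S, ∀ E' ∈ S, |E - E'| ≤ δ) {A B : Matrix n n ℂ} (hAB : Commute A B)
    (hLR : ∀ t, ‖⁅A, heis H t B⁆‖ ≤ N * (Real.exp (-l) * (Real.exp (v * |t|) - 1)))
    {x : n → ℂ} (hx : specProj S H *ᵥ x = x) (hx1 : star x ⬝ᵥ x = 1) :
    ‖star x ⬝ᵥ (A * B) *ᵥ x‖ ≤
      (3 * ‖A‖ * ‖B‖ + N / 2) * Real.exp (-(l / (1 + 2 * v / ΔE))) +
        ‖specProj S H * A * specProj S H‖ * ‖B‖ +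
        2 * ‖A‖ * ‖B‖ * δ * (l / (v + ΔE / 2)) := by
  set U : Matrix n n ℂ := hH.eigenvectorUnitary.1 with hU
  have hUU : U * star U = 1 := Unitary.mul_star_self_of_mem hH.eigenvectorUnitary.2
  set y : n → ℂ := star U *ᵥ x with hy
  have hform : ∀ C, star x ⬝ᵥ C *ᵥ x = star y ⬝ᵥ energyRep hH C *ᵥ y := by
    intro C
    have h1 : C = U * energyRep hH C * star U := by
      rw [energyRep_apply]
      calc C = (U * star U) * C * (U * star U) := by rw [hUU]; simp
        _ = _ := by noncomm_ring
    have h2 : star y = star x ᵥ* U := by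
      rw [hy, star_mulVec, star_eq_conjTranspose, conjTranspose_conjTranspose]
    conv_lhs => rw [h1]
    rw [h2, ← mulVec_mulVec, ← mulVec_mulVec, dotProduct_mulVec (star x) U]
  have hy0 : ∀ i ∉ sector hH S, y i = 0 := by
    intro i hi
    have h1 : energyRep hH (specProj S H) *ᵥ y = y := by
      rw [energyRep_apply, hy, mulVec_mulVec, mul_assoc, hUU, mul_one, ← mulVec_mulVec, hx]
    have h2 := congrFun h1 i
    rw [energyRep_specProj, mulVec_diagonal, if_neg hi, zero_mul] at h2
    exact h2.symm
  have hy1 : ‖WithLp.toLp 2 y‖ = 1 := by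
    have h1 := hform 1
    rw [one_mulVec, hx1, map_one, one_mulVec] at h1
    have h2 : ‖WithLp.toLp 2 y‖ ^ 2 = 1 := by
      have h3 : (‖WithLp.toLp 2 y‖ ^ 2 : ℂ) = 1 := by
        rw [h1, ← Complex.ofReal_pow, EuclideanSpace.norm_sq_eq, dotProduct]
        push_cast
        refine Finset.sum_congr rfl fun i _ => ?_
        rw [Pi.star_apply, RCLike.star_def, Complex.conj_mul']
      exact_mod_cast h3
    nlinarith [norm_nonneg (WithLp.toLp 2 y)]
  have h := diag_vector_clustering hΔE hv hl hN (hgap.eigenvalues_le hH)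
    (fun i hi k hk => hδ _ (mem_sector.mp hi) _ (mem_sector.mp hk))
    (hAB.map (energyRep hH)) (fun t => by rw [norm_lie_heis_energyRep]; exact hLR t) hy0 hy1
    (energyRep_specProj hH S)
  simp only [← map_mul, norm_energyRep] at h
  rwa [hform]

end EnergyBasis

/-! ### Linear dependence of blocks in the sector -/

section Gram

open Matrix

variable {n : Type*} [Fintype n] [DecidableEq n] {H : Matrix n n ℂ}

/-- Among `q ^ 2 + 1` nearly orthogonal operators, one has a small block in the `q`-dimensional
sector. -/
theorem exists_small_block (hH : H.IsHermitian) (S : Set ℝ) {q : ℕ}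
    (hq : (specProj S H).rank = q) (hq0 : 0 < q) {η : ℝ}
    (b : Fin (q ^ 2 + 1) → Matrix n n ℂ)
    (hb : ∀ i j, i ≠ j →
      ‖(q : ℂ)⁻¹ * ((b i)ᴴ * specProj S H * b j * specProj S H).trace‖ ≤ η) :
    ∃ j, ‖specProj S H * b j * specProj S H‖ ^ 2 ≤ q ^ 3 * η := by
  set K := sector hH S with hK
  have hqK : K.card = q := by rw [← hq, rank_specProj hH]
  have hqr : (0 : ℝ) < q := by exact_mod_cast hq0
  -- The blocks in the sector, as vectors of a space of dimension `q ^ 2`; `Γ` is their Gram matrix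
  -- for the Hilbert–Schmidt product.
  set β : Fin (q ^ 2 + 1) → (K × K → ℂ) := fun j p => energyRep hH (b j) p.1 p.2 with hβ
  set Γ : Fin (q ^ 2 + 1) → Fin (q ^ 2 + 1) → ℂ := fun i j => ∑ p, star (β i p) * β j p with hΓ
  have hΓtr : ∀ i j, Γ i j = ((b i)ᴴ * specProj S H * b j * specProj S H).trace := by
    intro i j
    rw [← trace_energyRep hH]
    simp only [map_mul, energyRep_specProj]
    rw [trace_mul_diagonal_mul_diagonal, ← star_eq_conjTranspose, map_star, hΓ]
    simp only [hβ, Fintype.sum_prod_type]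
    rw [Finset.sum_comm, ← Finset.sum_coe_sort K]
    refine Finset.sum_congr rfl fun x _ => ?_
    rw [← Finset.sum_add_sum_compl K, Finset.sum_eq_zero (s := Kᶜ), add_zero, ← Finset.sum_coe_sort K]
    · refine Finset.sum_congr rfl fun y _ => ?_
      rw [if_pos y.2, star_apply, mul_one]
    · intro k hk
      rw [if_neg (Finset.mem_compl.mp hk)]
      ring
  have hoff : ∀ i j, i ≠ j → ‖Γ i j‖ ≤ q * η := by
    intro i j hij
    have := hb i j hij
    rw [← hΓtr, norm_mul, norm_inv, Complex.norm_natCast, inv_mul_le_iff₀ hqr] at this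
    exact this
  have hdep : ¬ LinearIndependent ℂ β := by
    intro hli
    have := hli.fintype_card_le_finrank
    simp [hqK] at this
    nlinarith
  obtain ⟨g, hg, i₁, hi₁⟩ := Fintype.not_linearIndependent_iff.mp hdep
  -- Pairing the linear relation with the block of largest coefficient bounds its diagonal entry of
  -- `Γ` by the `q ^ 2` off-diagonal ones, each at most `q * η`.
  obtain ⟨j, -, hj⟩ := Finset.exists_max_image Finset.univ (fun i => ‖g i‖) ⟨i₁, Finset.mem_univ _⟩
  have hgj : 0 < ‖g j‖ := lt_of_lt_of_le (norm_pos_iff.mpr hi₁) (hj i₁ (Finset.mem_univ _))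
  have hrel : ∑ i, g i * Γ j i = 0 := by
    have h1 : ∑ p, star (β j p) * (∑ i, g i • β i) p = 0 := by rw [hg]; simp
    rw [← h1]
    simp only [Finset.sum_apply, Pi.smul_apply, smul_eq_mul, Finset.mul_sum, hΓ]
    rw [Finset.sum_comm]
    exact Finset.sum_congr rfl fun p _ => Finset.sum_congr rfl fun i _ => by ring
  have hdiag : ‖Γ j j‖ ≤ q ^ 3 * η := by
    have h1 : g j * Γ j j = -∑ i ∈ Finset.univ.erase j, g i * Γ j i := by
      rw [← Finset.add_sum_erase _ _ (Finset.mem_univ j)] at hrel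
      exact eq_neg_of_add_eq_zero_left hrel
    have h2 : ‖g j‖ * ‖Γ j j‖ ≤ ‖g j‖ * (q ^ 3 * η) := by
      rw [← norm_mul, h1, norm_neg]
      refine (norm_sum_le _ _).trans ?_
      calc ∑ i ∈ Finset.univ.erase j, ‖g i * Γ j i‖
          ≤ ∑ i ∈ Finset.univ.erase j, ‖g j‖ * (q * η) := by
            refine Finset.sum_le_sum fun i hi => ?_
            rw [norm_mul]
            exact mul_le_mul (hj i (Finset.mem_univ _)) (hoff j i (Finset.ne_of_mem_erase hi).symm)
              (norm_nonneg _) (norm_nonneg _)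
        _ = ‖g j‖ * (q ^ 3 * η) := by
            rw [Finset.sum_const, Finset.card_erase_of_mem (Finset.mem_univ _)]
            simp
            ring
    exact le_of_mul_le_mul_left h2 hgj
  refine ⟨j, le_trans ?_ hdiag⟩
  rw [← norm_energyRep hH]
  simp only [map_mul, energyRep_specProj]
  have h4 : Γ j j = ((∑ x ∈ K, ∑ y ∈ K, ‖energyRep hH (b j) x y‖ ^ 2 : ℝ) : ℂ) := by
    rw [← Finset.sum_coe_sort K]
    simp only [hΓ, hβ, Fintype.sum_prod_type]
    push_cast
    refine Finset.sum_congr rfl fun x _ => ?_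
    rw [← Finset.sum_coe_sort K]
    refine Finset.sum_congr rfl fun y _ => ?_
    rw [RCLike.star_def, Complex.conj_mul']
  rw [h4, Complex.norm_real, Real.norm_of_nonneg (by positivity)]
  refine (sq_norm_le_sum _).trans (le_of_eq ?_)
  rw [← Finset.sum_add_sum_compl K, Finset.sum_eq_zero (s := Kᶜ), add_zero]
  · refine Finset.sum_congr rfl fun x hx => ?_
    rw [← Finset.sum_add_sum_compl K, Finset.sum_eq_zero (s := Kᶜ), add_zero]
    · refine Finset.sum_congr rfl fun y hy => ?_
      rw [mul_diagonal, diagonal_mul, if_pos hx, if_pos hy, one_mul, mul_one]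
    · intro y hy
      rw [mul_diagonal, if_neg (Finset.mem_compl.mp hy)]
      simp
  · intro x hx
    refine Finset.sum_eq_zero fun y _ => ?_
    rw [mul_diagonal, diagonal_mul, if_neg (Finset.mem_compl.mp hx)]
    simp

end Gram

/-! ### Finite lattices of a system and the infinite-volume limit -/

section Systems

open Matrix

lemma DecayLaw.profile_zero (D : DecayLaw) (ΔE : ℝ) : D.profile ΔE 0 = 1 := by
  simp [DecayLaw.profile_eq, DecayLaw.rate_zero]

lemma FiniteLattice.setDist_eq_zero {V : Type*} (L : FiniteLattice V) {X Y : Finset V}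
    (h : ¬ Disjoint X Y) : setDist L.dist X Y = 0 := by
  obtain ⟨x, hx, hy⟩ := Finset.not_disjoint_iff.mp h
  have := setDist_le L.dist hx hy
  rw [L.dist_self] at this
  exact Nat.le_zero.mp this

variable {V : Type*} [LinearOrder V] (Q : System V) (S : ℕ → Set ℝ)

namespace System

lemma isHermitian_ham (n : ℕ) : (Q.ham n).IsHermitian :=
  hamiltonian_isHermitian (Q.isHermitian n)

variable {Q S} {D : DecayLaw} {ΔE : ℝ}

lemma degeneracy_pos (hS : Q.UniformGap S ΔE) (n : ℕ) : 0 < Q.degeneracy S n := by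
  have hH := Q.isHermitian_ham n
  obtain ⟨E, hE⟩ := hS.nonempty n
  have h1 := hS.subset n hE
  rw [hH.spectrum_real_eq_range_eigenvalues] at h1
  obtain ⟨i, rfl⟩ := h1
  have h2 : Q.degeneracy S n = (sector hH (S n)).card := rank_specProj hH (S n)
  rw [h2]
  exact Finset.card_pos.mpr ⟨i, mem_sector.mpr hE⟩

/-- Finiteness of the spectrum matters: the diameter of an unbounded set has the default value `0`.
-/
lemma abs_sub_le_diam (hS : Q.UniformGap S ΔE) (n : ℕ) :
    ∀ E ∈ S n, ∀ E' ∈ S n, |E - E'| ≤ Metric.diam (S n) := by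
  have hfin : (S n).Finite := by
    refine Set.Finite.subset ?_ (hS.subset n)
    rw [(Q.isHermitian_ham n).spectrum_real_eq_range_eigenvalues]
    exact Set.finite_range _
  exact fun E hE E' hE' => Metric.dist_le_diam_of_mem hfin.isBounded hE hE'

lemma lieb_robinson (hD : D.Admissible) {n : ℕ} (hh : D.Holds (Q.lattice n) (Q.interaction n))
    {X Y : Finset V} (hX : X ⊆ (Q.lattice n).sites) (hY : Y ⊆ (Q.lattice n).sites)
    {a : Op Q.toSites X} {b : Op Q.toSites Y} (hab : Commute (Q.obs n X a) (Q.obs n Y b)) (t : ℝ) :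
    ‖⁅Q.obs n X a, heis (Q.ham n) t (Q.obs n Y b)⁆‖ ≤
      2 * ‖a‖ * ‖b‖ * (X.card : ℝ) * (Y.card : ℝ) *
        (Real.exp (-D.rate (setDist (Q.lattice n).dist X Y)) *
          (Real.exp (D.velocity * |t|) - 1)) := by
  rw [← mul_assoc]
  exact lattice_lieb_robinson hD hh (Q.isHermitian n) (Q.isEven n) hX hY hab t

/-- The final constant `4` is `3` from the filter plus half of the Lieb–Robinson prefactor `2`;
nonempty supports allow the volume factors to be inserted. -/
lemma coefficient_le {X Y : Finset V} (hX : X.Nonempty) (hY : Y.Nonempty) {n : ℕ}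
    (hX' : X ⊆ (Q.lattice n).sites) (hY' : Y ⊆ (Q.lattice n).sites)
    (a : Op Q.toSites X) (b : Op Q.toSites Y) :
    3 * ‖Q.obs n X a‖ * ‖Q.obs n Y b‖ + 2 * ‖a‖ * ‖b‖ * (X.card : ℝ) * (Y.card : ℝ) / 2 ≤
      4 * ‖a‖ * ‖b‖ * (X.card : ℝ) * (Y.card : ℝ) := by
  have h1 : ‖Q.obs n X a‖ ≤ ‖a‖ := norm_embed_le hX' a
  have h2 : ‖Q.obs n Y b‖ ≤ ‖b‖ := norm_embed_le hY' b
  have h3 : (1 : ℝ) ≤ X.card := by exact_mod_cast hX.card_pos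
  have h4 : (1 : ℝ) ≤ Y.card := by exact_mod_cast hY.card_pos
  have h5 : (1 : ℝ) ≤ X.card * Y.card := one_le_mul_of_one_le_of_one_le h3 h4
  have h6 : ‖Q.obs n X a‖ * ‖Q.obs n Y b‖ ≤ ‖a‖ * ‖b‖ * (X.card * Y.card) :=
    (mul_le_mul h1 h2 (norm_nonneg _) (norm_nonneg _)).trans
      (le_mul_of_one_le_right (by positivity) h5)
  linarith

/-- Clustering of the average over the sector. -/
theorem norm_groundAvg_sub_le (hD : D.Admissible) (hΔE : 0 < ΔE) (hS : Q.UniformGap S ΔE) {n : ℕ}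
    (hh : D.Holds (Q.lattice n) (Q.interaction n)) {X Y : Finset V}
    (hX : X.Nonempty) (hY : Y.Nonempty)
    (hX' : X ⊆ (Q.lattice n).sites) (hY' : Y ⊆ (Q.lattice n).sites)
    {a : Op Q.toSites X} {b : Op Q.toSites Y}
    (hab : Disjoint X Y → Commute (Q.obs n X a) (Q.obs n Y b)) :
    ‖(Q.degeneracy S n : ℂ)⁻¹ *
      (Q.obs n X a * (1 - Q.groundProj S n) * Q.obs n Y b * Q.groundProj S n).trace‖ ≤
      4 * ‖a‖ * ‖b‖ * (X.card : ℝ) * (Y.card : ℝ) *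
        D.profile ΔE (setDist (Q.lattice n).dist X Y) := by
  have hcoef := coefficient_le hX hY hX' hY' a b
  by_cases hd : Disjoint X Y
  · have h := average_clustering (Q.isHermitian_ham n) hΔE (DecayLaw.velocity_pos hD)
      (DecayLaw.rate_nonneg hD (setDist (Q.lattice n).dist X Y))
      (N := 2 * ‖a‖ * ‖b‖ * (X.card : ℝ) * (Y.card : ℝ)) (by positivity) (hS.gap n) (hab hd)
      (lieb_robinson hD hh hX' hY' (hab hd))
    refine h.trans ?_
    rw [DecayLaw.profile_eq]
    exact mul_le_mul_of_nonneg_right hcoef (Real.exp_pos _).le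
  · rw [FiniteLattice.setDist_eq_zero _ hd, DecayLaw.profile_zero, mul_one]
    refine (norm_average_le (Q.isHermitian_ham n) (S n) _ _).trans (le_trans ?_ hcoef)
    have : 0 ≤ ‖Q.obs n X a‖ * ‖Q.obs n Y b‖ := by positivity
    have : 0 ≤ ‖a‖ * ‖b‖ * (X.card : ℝ) * (Y.card : ℝ) := by positivity
    linarith

/-- Clustering in a vector of the sector. -/
theorem norm_expectation_le (hD : D.Admissible) (hΔE : 0 < ΔE) (hS : Q.UniformGap S ΔE) {n : ℕ}
    (hh : D.Holds (Q.lattice n) (Q.interaction n)) {X Y : Finset V}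
    (hX : X.Nonempty) (hY : Y.Nonempty)
    (hX' : X ⊆ (Q.lattice n).sites) (hY' : Y ⊆ (Q.lattice n).sites)
    {a : Op Q.toSites X} {b : Op Q.toSites Y} (hab : IsBosonicPair a b)
    {x : Config Q.toSites (Q.lattice n).sites → ℂ} (hx1 : star x ⬝ᵥ x = 1)
    (hx : Q.groundProj S n *ᵥ x = x) :
    ‖star x ⬝ᵥ Q.obs n (X ∪ Y) (prodObs a b) *ᵥ x‖ ≤
      4 * ‖a‖ * ‖b‖ * (X.card : ℝ) * (Y.card : ℝ) *
        D.profile ΔE (setDist (Q.lattice n).dist X Y) +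
      ‖Q.groundProj S n * Q.obs n X a * Q.groundProj S n‖ * ‖b‖ +
      2 * ‖a‖ * ‖b‖ * Metric.diam (S n) *
        (D.rate (setDist (Q.lattice n).dist X Y) / (D.velocity + ΔE / 2)) := by
  have hcoef := coefficient_le hX hY hX' hY' a b
  have hna : ‖Q.obs n X a‖ ≤ ‖a‖ := norm_embed_le hX' a
  have hnb : ‖Q.obs n Y b‖ ≤ ‖b‖ := norm_embed_le hY' b
  have hv := DecayLaw.velocity_pos hD
  have hr := DecayLaw.rate_nonneg hD (setDist (Q.lattice n).dist X Y)
  have hdiam : 0 ≤ Metric.diam (S n) := Metric.diam_nonneg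
  have hprod : Q.obs n (X ∪ Y) (prodObs a b) = Q.obs n X a * Q.obs n Y b := embed_prodObs hX' hY' a b
  rw [hprod]
  by_cases hd : Disjoint X Y
  · have hcom := commute_embed hd hX' hY' hab
    have h := vector_clustering (Q.isHermitian_ham n) hΔE hv hr
      (N := 2 * ‖a‖ * ‖b‖ * (X.card : ℝ) * (Y.card : ℝ)) (by positivity) (hS.gap n)
      (abs_sub_le_diam hS n) hcom (lieb_robinson hD hh hX' hY' hcom) hx hx1
    refine h.trans ?_
    rw [DecayLaw.profile_eq]
    refine add_le_add (add_le_add (mul_le_mul_of_nonneg_right hcoef (Real.exp_pos _).le) ?_) ?_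
    · exact mul_le_mul_of_nonneg_left hnb (norm_nonneg _)
    · change 2 * ‖Q.obs n X a‖ * ‖Q.obs n Y b‖ * _ * _ ≤ _
      gcongr
  · rw [FiniteLattice.setDist_eq_zero _ hd, DecayLaw.profile_zero, mul_one, DecayLaw.rate_zero]
    have h1 := norm_star_dotProduct_mulVec_le (Q.obs n X a * Q.obs n Y b) x x
    have h2 : ‖WithLp.toLp 2 x‖ * ‖WithLp.toLp 2 x‖ = 1 := by
      have h3 : ((‖WithLp.toLp 2 x‖ ^ 2 : ℝ) : ℂ) = 1 := by
        rw [← hx1, EuclideanSpace.norm_sq_eq, dotProduct]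
        push_cast
        refine Finset.sum_congr rfl fun i _ => ?_
        rw [Pi.star_apply, RCLike.star_def, Complex.conj_mul']
      rw [← sq]
      exact_mod_cast h3
    rw [h2, mul_one] at h1
    have h4 := norm_mul_le (Q.obs n X a) (Q.obs n Y b)
    have h5 : 0 ≤ ‖Q.obs n X a‖ * ‖Q.obs n Y b‖ := mul_nonneg (norm_nonneg _) (norm_nonneg _)
    have h6 : ‖Q.obs n X a‖ * ‖Q.obs n Y b‖ ≤ 4 * ‖a‖ * ‖b‖ * (X.card : ℝ) * (Y.card : ℝ) := by
      have : 0 ≤ 2 * ‖a‖ * ‖b‖ * (X.card : ℝ) * (Y.card : ℝ) := by positivity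
      linarith
    have h7 : 0 ≤ ‖Q.groundProj S n * Q.obs n X a * Q.groundProj S n‖ * ‖b‖ :=
      mul_nonneg (norm_nonneg _) (norm_nonneg _)
    rw [zero_div, mul_zero, add_zero]
    exact ((h1.trans h4).trans h6).trans (le_add_of_nonneg_right h7)

lemma obs_conjTranspose (n : ℕ) (X : Finset V) (a : Op Q.toSites X) :
    Q.obs n X aᴴ = (Q.obs n X a)ᴴ :=
  embed_conjTranspose a

/-- The zeroth observable is the adjoint of `a`, so pairs involving it reduce to commutation of `a`
with an image, possibly after taking both adjoints; other pairs need the one-sided adjoint. -/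
lemma images_commute {n m : ℕ} {X : Finset V} (hX : X ⊆ (Q.lattice n).sites) {a : Op Q.toSites X}
    {Y : Fin (m + 1) → Finset V} {b : ∀ j, Op Q.toSites (Y j)}
    (hY : ∀ j, Y j ⊆ (Q.lattice n).sites) (hY0 : Y 0 = X)
    (hb0 : Q.obs n (Y 0) (b 0) = (Q.obs n X a)ᴴ)
    (hab : ∀ j : Fin m, IsBosonicPair a (b j.succ))
    (hbb : ∀ i j : Fin m, i ≠ j → IsBosonicPair (b i.succ) (b j.succ))
    {i j : Fin (m + 1)} (hij : i ≠ j) (hd : Disjoint (Y i) (Y j)) :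
    Commute (Q.obs n (Y i) (b i)ᴴ) (Q.obs n (Y j) (b j)) := by
  have h0 : ∀ k : Fin m, Disjoint (Y 0) (Y k.succ) →
      Commute (Q.obs n X a) (Q.obs n (Y k.succ) (b k.succ)) := fun k hk =>
    commute_embed (hY0 ▸ hk) hX (hY _) (hab k)
  induction i using Fin.cases with
  | zero =>
    induction j using Fin.cases with
    | zero => exact absurd rfl hij
    | succ j =>
      rw [obs_conjTranspose, hb0, conjTranspose_conjTranspose]
      exact h0 j hd
  | succ i =>
    induction j using Fin.cases with
    | zero =>
      rw [obs_conjTranspose, hb0]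
      exact ((h0 i hd.symm).star_star).symm
    | succ j =>
      exact commute_embed hd (hY _) (hY _)
        (hbb i j fun h => hij (congrArg Fin.succ h)).conjTranspose_left

/-- The block of an observable in the ground state sector is small if there are enough images of
the observable under symmetries. -/
theorem sq_norm_block_le (hD : D.Admissible) (hΔE : 0 < ΔE) (hS : Q.UniformGap S ΔE) {n : ℕ}
    (hh : D.Holds (Q.lattice n) (Q.interaction n)) {X : Finset V}
    (hX' : X ⊆ (Q.lattice n).sites) {a : Op Q.toSites X} {K : ℝ} (hK : 0 < K) {G₁ : ℕ → ℝ} {ε : ℝ}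
    (himg : Q.HasSymmetryImages S D ΔE K G₁ ε n a) :
    ‖Q.groundProj S n * Q.obs n X a * Q.groundProj S n‖ ^ 2 ≤ (1 + 4 / K) * ε := by
  obtain ⟨Y, b, R, hY, ⟨hY0, hb0⟩, hR, hab, hbb, hcorr, hsmall⟩ := himg
  have hH := Q.isHermitian_ham n
  have hq0 : 0 < Q.degeneracy S n := degeneracy_pos hS n
  have hqr : (0 : ℝ) < (Q.degeneracy S n : ℝ) ^ 3 := by positivity
  set P := Q.groundProj S n with hP
  set B : Fin (Q.degeneracy S n ^ 2 + 1) → Q.FinOp n := fun j => Q.obs n (Y j) (b j) with hB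
  have hPsa : IsSelfAdjoint P := isSelfAdjoint_specProj _ _
  -- `⟨Bᵢ† P Bⱼ⟩` is the full correlation, bounded by `G₁`, minus the excited part, bounded by `4 /
  -- K` times the clustering bound; `tildeG` dominates both bounds.
  have hgram : ∀ i j, i ≠ j →
      ‖(Q.degeneracy S n : ℂ)⁻¹ * ((B i)ᴴ * P * B j * P).trace‖ ≤ (1 + 4 / K) * ε / (Q.degeneracy S n : ℝ) ^ 3 := by
    intro i j hij
    have h1 := norm_groundAvg_sub_le hD hΔE hS hh (hY i).1 (hY j).1 (hY i).2 (hY j).2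
      (a := (b i)ᴴ) (b := b j)
      (images_commute hX' (fun j => (hY j).2) hY0 hb0 hab hbb hij)
    rw [obs_conjTranspose] at h1
    have h2 := hcorr i j hij
    have h3 : (Q.degeneracy S n : ℂ)⁻¹ * ((B i)ᴴ * P * B j * P).trace =
        Q.groundAvg S n ((B i)ᴴ * B j) - (Q.degeneracy S n : ℂ)⁻¹ * ((B i)ᴴ * (1 - P) * B j * P).trace := by
      rw [groundAvg, ← mul_sub, ← trace_sub]
      congr 2
      noncomm_ring
    have h4 : 4 * ‖(b i)ᴴ‖ * ‖b j‖ * ((Y i).card : ℝ) * ((Y j).card : ℝ) *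
        D.profile ΔE (setDist (Q.lattice n).dist (Y i) (Y j)) ≤
        4 / K * Q.tildeG D ΔE K G₁ n (b i)ᴴ (b j) := by
      have h5 : Q.clusterBound D ΔE K n (b i)ᴴ (b j) ≤ Q.tildeG D ΔE K G₁ n (b i)ᴴ (b j) :=
        le_max_left _ _
      refine le_trans (le_of_eq ?_) (mul_le_mul_of_nonneg_left h5 (by positivity))
      rw [clusterBound]
      field_simp
    have h6 : G₁ (setDist (Q.lattice n).dist (Y i) (Y j)) ≤
        Q.tildeG D ΔE K G₁ n (b i)ᴴ (b j) := le_max_right _ _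
    have h7 : Q.tildeG D ΔE K G₁ n (b i)ᴴ (b j) ≤ ε / (Q.degeneracy S n : ℝ) ^ 3 := by
      rw [le_div_iff₀ hqr, mul_comm]
      exact (hsmall i j hij).le
    rw [h3]
    calc _ ≤ Q.tildeG D ΔE K G₁ n (b i)ᴴ (b j) + 4 / K * Q.tildeG D ΔE K G₁ n (b i)ᴴ (b j) :=
          (norm_sub_le _ _).trans (add_le_add (h2.trans h6) (h1.trans h4))
      _ = (1 + 4 / K) * Q.tildeG D ΔE K G₁ n (b i)ᴴ (b j) := by ring
      _ ≤ (1 + 4 / K) * (ε / (Q.degeneracy S n : ℝ) ^ 3) := by gcongr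
      _ = _ := by ring
  obtain ⟨j, hj⟩ := exists_small_block hH (S n) (q := Q.degeneracy S n) rfl hq0 B hgram
  rw [mul_div_cancel₀ _ hqr.ne'] at hj
  -- Whichever block is the small one, it has the norm of the block of `a`: for the adjoint
  -- trivially, for an image because the symmetry fixes `P`.
  have hnorm : ‖P * B j * P‖ = ‖P * Q.obs n X a * P‖ := by
    induction j using Fin.cases with
    | zero =>
      have h1 : P * B 0 * P = (P * Q.obs n X a * P)ᴴ := by
        rw [conjTranspose_mul, conjTranspose_mul, ← star_eq_conjTranspose P, hPsa.star_eq, hB]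
        simp only [hb0]
        rw [mul_assoc]
      rw [h1, l2_opNorm_conjTranspose]
    | succ j =>
      obtain ⟨h1, h2, h3⟩ := hR j
      have h4 : B j.succ = R j (Q.obs n X a) := h1
      rw [h4]
      refine norm_compression_eq (R j) hPsa (map_cfc_of_map_eq hH (R j) h3 _) ?_
      rw [star_eq_conjTranspose, star_eq_conjTranspose, ← h2, h1]
  rw [← hnorm]
  exact hj

/-- Clustering in the limiting ground state. -/
theorem norm_ground_expectation_le (hD : D.Admissible) (hΔE : 0 < ΔE)
    {ω : (X : Finset V) → Op Q.toSites X → ℂ}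
    (hh : ∀ n, D.Holds (Q.lattice n) (Q.interaction n)) (hS : Q.UniformGap S ΔE)
    (hω : Q.IsGroundExpectation S ω) {X Y : Finset V} (hX : X.Nonempty) (hY : Y.Nonempty)
    {a : Op Q.toSites X} {b : Op Q.toSites Y} (hab : IsBosonicPair a b) {K : ℝ} {G₁ : ℕ → ℝ}
    (hK : 0 < K)
    (himg : ∀ ε : ℝ, 0 < ε → ∃ M₀ : ℕ, 0 < M₀ ∧
      ∀ n, X ⊆ (Q.lattice n).sites → M₀ ≤ (Q.lattice n).sites.card →
        Q.HasSymmetryImages S D ΔE K G₁ ε n a) :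
    ‖ω (X ∪ Y) (prodObs a b)‖ ≤
      4 * ‖a‖ * ‖b‖ * (X.card : ℝ) * (Y.card : ℝ) * D.profile ΔE (setDist Q.dist X Y) := by
  obtain ⟨Φ, hΦ, hlim⟩ := hω
  have hsub : ∀ Z : Finset V, ∀ᶠ n in atTop, Z ⊆ (Q.lattice n).sites := fun Z =>
    (Filter.eventually_all_finset Z).mpr fun x _ => Q.exhausts x
  have hdist : ∀ᶠ n in atTop, setDist (Q.lattice n).dist X Y = setDist Q.dist X Y := by
    have h1 : ∀ᶠ n in atTop, ∀ x ∈ X, ∀ y ∈ Y, (Q.lattice n).dist x y = Q.dist x y :=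
      (Filter.eventually_all_finset X).mpr fun x _ =>
        (Filter.eventually_all_finset Y).mpr fun y _ => Q.dist_eq x y
    filter_upwards [h1] with n hn
    unfold setDist
    congr 1
    ext r
    constructor
    · rintro ⟨x, hx, y, hy, rfl⟩
      exact ⟨x, hx, y, hy, hn x hx y hy⟩
    · rintro ⟨x, hx, y, hy, rfl⟩
      exact ⟨x, hx, y, hy, (hn x hx y hy).symm⟩
  have hblock : Tendsto (fun n => ‖Q.groundProj S n * Q.obs n X a * Q.groundProj S n‖) atTop
      (𝓝 0) := by
    rw [Metric.tendsto_nhds]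
    intro ε hε
    have hc : 0 < 1 + 4 / K := by positivity
    -- Chosen so that the squared block norm is at most `ε ^ 2 / 2`, strictly below `ε ^ 2`.
    obtain ⟨M₀, -, hM₀⟩ := himg (ε ^ 2 / (2 * (1 + 4 / K))) (by positivity)
    filter_upwards [hsub X, Q.card_tendsto.eventually_ge_atTop M₀] with n hn1 hn2
    have h1 := sq_norm_block_le hD hΔE hS (hh n) hn1 hK (hM₀ n hn1 hn2)
    have h2 : (1 + 4 / K) * (ε ^ 2 / (2 * (1 + 4 / K))) = ε ^ 2 / 2 := by field_simp
    rw [h2] at h1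
    rw [Real.dist_0_eq_abs, abs_norm]
    refine lt_of_pow_lt_pow_left₀ 2 hε.le (lt_of_le_of_lt h1 ?_)
    have : 0 < ε ^ 2 := by positivity
    linarith
  have hbound : ∀ᶠ n in atTop,
      ‖star (Φ n) ⬝ᵥ (Q.obs n (X ∪ Y) (prodObs a b)).mulVec (Φ n)‖ ≤
      4 * ‖a‖ * ‖b‖ * (X.card : ℝ) * (Y.card : ℝ) * D.profile ΔE (setDist Q.dist X Y) +
      ‖Q.groundProj S n * Q.obs n X a * Q.groundProj S n‖ * ‖b‖ +
      2 * ‖a‖ * ‖b‖ * Metric.diam (S n) *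
        (D.rate (setDist Q.dist X Y) / (D.velocity + ΔE / 2)) := by
    filter_upwards [hsub X, hsub Y, hdist] with n h1 h2 h3
    rw [← h3]
    exact norm_expectation_le hD hΔE hS (hh n) hX hY h1 h2 hab (hΦ n).1 (hΦ n).2
  have hright : Tendsto (fun n =>
      4 * ‖a‖ * ‖b‖ * (X.card : ℝ) * (Y.card : ℝ) * D.profile ΔE (setDist Q.dist X Y) +
      ‖Q.groundProj S n * Q.obs n X a * Q.groundProj S n‖ * ‖b‖ +
      2 * ‖a‖ * ‖b‖ * Metric.diam (S n) *
        (D.rate (setDist Q.dist X Y) / (D.velocity + ΔE / 2))) atTop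
      (𝓝 (4 * ‖a‖ * ‖b‖ * (X.card : ℝ) * (Y.card : ℝ) * D.profile ΔE (setDist Q.dist X Y) +
        0 * ‖b‖ + 2 * ‖a‖ * ‖b‖ * 0 *
        (D.rate (setDist Q.dist X Y) / (D.velocity + ΔE / 2)))) :=
    (tendsto_const_nhds.add (hblock.mul_const _)).add
      ((hS.quasiDegenerate.const_mul _).mul_const _)
  -- At fixed supports the block and the width of the sector vanish in the limit, leaving only the
  -- clustering profile.
  have := le_of_tendsto_of_tendsto (hlim (X ∪ Y) (prodObs a b)).norm hright hbound
  simpa using this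

end System

end Systems

end

end LatticeClustering

theorem mainTheorem5 (D : LatticeClustering.DecayLaw) (hD : D.Admissible)
    (ΔE : ℝ) (hΔE : 0 < ΔE) :
    ∃ C : ℝ, 0 < C ∧
      ∀ (V : Type*) [LinearOrder V] (Q : LatticeClustering.System V) (S : ℕ → Set ℝ)
        (ω : (X : Finset V) → LatticeClustering.Op Q.toSites X → ℂ),
        (∀ n, D.Holds (Q.lattice n) (Q.interaction n)) →
        Q.UniformGap S ΔE →
        Q.IsGroundExpectation S ω →
        ∀ (X Y : Finset V), X.Nonempty → Y.Nonempty →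
        ∀ (a : LatticeClustering.Op Q.toSites X) (b : LatticeClustering.Op Q.toSites Y),
          LatticeClustering.IsBosonicPair a b →
          ∀ (K : ℝ) (G₁ : ℕ → ℝ), 0 < K → Tendsto G₁ atTop (𝓝 0) →
          (∀ ε : ℝ, 0 < ε → ∃ M₀ : ℕ, 0 < M₀ ∧
            ∀ n, X ⊆ (Q.lattice n).sites → M₀ ≤ (Q.lattice n).sites.card →
              Q.HasSymmetryImages S D ΔE K G₁ ε n a) →
          ‖ω (X ∪ Y) (LatticeClustering.prodObs a b)‖ ≤
            C * ‖a‖ * ‖b‖ * (X.card : ℝ) * (Y.card : ℝ) *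
              D.profile ΔE (LatticeClustering.setDist Q.dist X Y) :=
  ⟨4, by norm_num, fun _ _ _ _ _ hh hS hω _ _ hX hY _ _ hab _ _ hK _ himg =>
    LatticeClustering.System.norm_ground_expectation_le hD hΔE hh hS hω hX hY hab hK himg⟩
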